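/- Notation. Let $S^1=\mathbb R/\mathbb Z$ with its positive cyclic order, let $\mathcal H=\mathrm{Homeo}_+(S^1)$, and for a group $G$ let $\mathcal R_G=\mathrm{Hom}(G,\mathcal H)$, with the topology whose subbase consists of the sets $\{\varphi' : \sup_x|\varphi'(g)(x)-\varphi(g)(x)|<\varepsilon\}$ ($\varphi\in\mathcal R_G$, $g\in G$, $\varepsilon>0$). For $a\ne b$ in $S^1$, $[a,b]$ is the positively oriented closed arc from $a$ to $b$. For $X\subset S^1$ write $C\sqsubset X$ if $C$ is a connected component of $X$, let $X_\sharp$ be the union of the closures of the components of $S^1\setminus X$, and $X_*=X\cap X_\sharp$. For $A\subset S^1$ put $\mathrm{Stab}_\varphi(A)=\{g:\varphi(g)A=A\}$. Two homomorphisms $\varphi^1,\varphi^2\in\mathcal R_G$ are *semiconjugate* if either both have a global fixed point, or neither has one and there is a map $h:S^1\to S^1$, induced by a nondecreasing (not necessarily continuous) $\tilde h:\mathbb R\to\mathbb R$ with $\tilde h(x+1)=\tilde h(x)+1$, such that $\varphi^2(g)\circ h=h\circ\varphi^1(g)$ for all $g\in G$. A homomorphism $\varphi\in\mathcal R_G$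 is *locally stable* if all homomorphisms in some neighbourhood of $\varphi$ in $\mathcal R_G$ are semiconjugate to $\varphi$. For $k\ge1$, $\psi\in\mathcal R_G$ is a *$k$-fold lift* of $\varphi\in\mathcal R_G$ if $\varphi(g)\circ\pi_k=\pi_k\circ\psi(g)$ for all $g$, where $\pi_k(x)=kx$. Basic partitions. Let $\Gamma$ be a group with a finite symmetric generating set $S$, and $\varphi\in\mathcal R_\Gamma$. A *basic partition* for $\varphi$ is a finite union $P\subset S^1$ of disjoint closed intervals such that: for each $I\sqsubset P$ there is a unique $s_I\in S$ such that $\varphi(s_I)I=\bigcup_{i=1}^{l}I_i\cup\bigcup_{i=1}^{l-1}J_i$ for some $l\ge2$ and distinct $I_i\sqsubset P$, $J_i\sqsubset P_\sharp$; for $I\sqsubset P$ and $s\in S\setminus\{s_I\}$, $\varphi(s)I$ is a proper subset of some $I'\sqsubset P$; for $J\sqsubset P_\sharp$ and $s\in S$, either $\varphi(s)J\sqsubset P_\sharp$ or $\varphi(s)J\subset\mathrm{Int}\,P$. It is *pure* if the directed graph with vertices the components of $P_\sharp$, and with an edge $J_1\to J_2$ labelled $s$ whenever $s=s_I$ for the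 component $I$ of $P$ right adjacent to $J_1$ and $\varphi(s)J_1=J_2$, is a disjoint union of cycles. Put $P^1=P$ and $P^{l}=\bigcap_{s\in S\cup\{e\}}\varphi(s)P^{l-1}$ for $l\ge 2$. The *entrance* of a subgroup $\Lambda\subset\Gamma$ to $P$ is $E^\Lambda_\varphi(P)=\bigcup\{J\sqsubset P_\sharp:\{e\}\ne\mathrm{Stab}_\varphi(J)\subset\Lambda\}$. Basic configurations. Let $G$ be the fundamental group of a finite tree $\mathcal T$ of groups, with vertex groups $\Gamma_v$ and edge groups $\Lambda_e$. A *basic configuration* for $\varphi\in\mathcal R_G$ is given by finite symmetric generating sets $S_v$ of the $\Gamma_v$ and pure basic partitions $P_v$ for $\varphi_v$, where $\varphi_v\in\mathcal R_{\Gamma_v}$ is the restriction of $\varphi$, such that: each $\Lambda_e$ is infinite cyclic; if $e\ne e'$ are edges at $v$, then $\Lambda_e\cap\gamma\Lambda_{e'}\gamma^{-1}$ is trivial for all $\gamma\in\Gamma_v$; if $v$ is an end of $e$, the entrance $E_{v,e}$ of $\Lambda_e$ to $P_v$ with respect to $\varphi_v$ is nonempty and its stabilizer in $\Gamma_v$ is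 $\Lambda_e$; if $v,v'$ are the two ends of $e$, then $E_{v,e}\cup E_{v',e}=S^1$ and $\mathrm{Int}\,E_{v,e}\cap\mathrm{Int}\,E_{v',e}=\emptyset$. Put $P_*=\bigcup_v(P_v)_*$ and $P^l_*=\bigcup_v(P_v^l)_*$, and for $x\in P_*$ let $x_l^-$ and $x_l^+$ be the points of $P^l_*$ adjacent to $x$ on the left and on the right. The configuration is *robust* if for every sufficiently large $l$ there are pairwise disjoint closed intervals $K_x\subset[x_l^-,x_l^+]$ with $x\in\mathrm{Int}\,K_x$ ($x\in P_*$) such that for each $x\in P_*$ the group $\varphi(\mathrm{Stab}_\varphi(\{x\}))$ is cyclic and one of its generators maps $[x_l^-,x_l^+]$ into a proper subinterval of itself and maps $K_x$ into $\mathrm{Int}\,K_x$. **Corollary.** Let $G$ be the fundamental group of a finite tree of groups, and suppose that $\varphi^1\in\mathcal R_G$ admits a robust basic configuration. Let $k\ge1$ and let $\psi^1\in\mathcal R_G$ be a $k$-fold lift of $\varphi^1$. Then $\psi^1$ is locally stable. -/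

import Mathlib

open Set Topology

noncomputable section

namespace BasicPartition

/-- The circle `ℝ / ℤ`. -/
abbrev Circ : Type := UnitAddCircle

/-- The group of orientation preserving homeomorphisms of the circle: those homeomorphisms that
lift to an increasing bijection of `ℝ` commuting with the translation by one (the units of the
monoid `CircleDeg1Lift` are exactly these bijections). -/
def HomeoPlus : Subgroup (Circ ≃ₜ Circ) where
  carrier := {f | ∃ F : CircleDeg1Liftˣ, ∀ x : ℝ, f (x : Circ) = ((F x : ℝ) : Circ)}
  one_mem' := ⟨1, fun _ => rfl⟩
  mul_mem' := by
    rintro f g ⟨F, hF⟩ ⟨H, hH⟩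
    refine ⟨F * H, fun x => ?_⟩
    change f (g (x : Circ)) = _
    rw [hH, hF]
    rfl
  inv_mem' := by
    rintro f ⟨F, hF⟩
    refine ⟨F⁻¹, fun x => ?_⟩
    change f.symm (x : Circ) = _
    rw [Homeomorph.symm_apply_eq, hF]
    simp

/-- The underlying map of an element of `HomeoPlus`. -/
instance : CoeFun HomeoPlus (fun _ => Circ → Circ) := ⟨fun f => (f : Circ ≃ₜ Circ)⟩

/-- The uniform metric on the group of orientation preserving homeomorphisms. -/
def uniformDist (f h : HomeoPlus) : ℝ := ⨆ x : Circ, dist (f x) (h x)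

/-- The topology on the set of all homomorphisms `G →* HomeoPlus` whose subbase consists of the
sets `{φ' | uniformDist (φ' g) (φ g) < ε}`. -/
@[reducible] def weakTopology (G : Type*) [Group G] : TopologicalSpace (G →* HomeoPlus) :=
  TopologicalSpace.generateFrom
    {U | ∃ (φ : G →* HomeoPlus) (g : G) (ε : ℝ), 0 < ε ∧
      U = {φ' | uniformDist (φ' g) (φ g) < ε}}

/-- Degree one monotone maps of the circle (not necessarily continuous). -/
def IsDegreeOneMonotone (h : Circ → Circ) : Prop :=
  ∃ F : CircleDeg1Lift, ∀ x : ℝ, h (x : Circ) = ((F x : ℝ) : Circ)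

/-- The homomorphism has a global fixed point. -/
def HasGlobalFixedPoint {G : Type*} [Group G] (φ : G →* HomeoPlus) : Prop :=
  ∃ x : Circ, ∀ g : G, φ g x = x

/-- Semiconjugacy of homomorphisms into the group of circle homeomorphisms. -/
def Semiconjugate {G : Type*} [Group G] (φ₁ φ₂ : G →* HomeoPlus) : Prop :=
  (HasGlobalFixedPoint φ₁ ∧ HasGlobalFixedPoint φ₂) ∨
  (¬ HasGlobalFixedPoint φ₁ ∧ ¬ HasGlobalFixedPoint φ₂ ∧
    ∃ h : Circ → Circ, IsDegreeOneMonotone h ∧ ∀ (g : G) (x : Circ), φ₂ g (h x) = h (φ₁ g x))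

/-- Every homomorphism sufficiently near to `φ` is semiconjugate to `φ`. -/
def LocallyStable {G : Type*} [Group G] (φ : G →* HomeoPlus) : Prop :=
  ∃ U : Set (G →* HomeoPlus), IsOpen[weakTopology G] U ∧ φ ∈ U ∧ ∀ φ' ∈ U, Semiconjugate φ' φ

/-- `ψ` is a lift of `φ` through the covering `x ↦ k x` of the circle. -/
def IsFoldLift {G : Type*} [Group G] (k : ℕ) (ψ φ : G →* HomeoPlus) : Prop :=
  ∀ (g : G) (x : Circ), φ g (k • x) = k • ψ g x

/-- The stabilizer of a subset of the circle. -/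
def stab {G : Type*} [Group G] (φ : G →* HomeoPlus) (A : Set Circ) : Subgroup G where
  carrier := {g | φ g '' A = A}
  one_mem' := by
    rw [mem_ofPred_eq, map_one]
    exact image_id A
  mul_mem' := by
    intro a b ha hb
    rw [mem_ofPred_eq] at ha hb ⊢
    have h : (φ (a * b) : Circ → Circ) = φ a ∘ φ b := by
      rw [map_mul]
      rfl
    rw [h, image_comp, hb, ha]
  inv_mem' := by
    intro a ha
    rw [mem_ofPred_eq] at ha ⊢
    have h : (φ a⁻¹ : Circ → Circ) ∘ φ a = id := by
      rw [map_inv]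
      funext x
      exact (φ a : Circ ≃ₜ Circ).symm_apply_apply x
    conv_lhs => rw [← ha]
    rw [← image_comp, h, image_id]

/-! ### Intervals, components, gaps -/

/-- Closed intervals of the circle; `cIcc a b` is the positively oriented arc from `a` to `b`. -/
def IsArc (I : Set Circ) : Prop := ∃ a b : Circ, a ≠ b ∧ I = cIcc a b

/-- `C` is a connected component of the subset `X`. -/
def IsComponent (C X : Set Circ) : Prop := ∃ x ∈ X, C = connectedComponentIn X x

/-- The union of the closures of the components of the complement of `X`. -/
def sharp (X : Set Circ) : Set Circ := ⋃₀ {J | ∃ C, IsComponent C Xᶜ ∧ J = closure C}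

/-- The points of `X` on the boundary of its complementary intervals. -/
def boundaryPart (X : Set Circ) : Set Circ := X ∩ sharp X

/-- The interval `I` is adjacent to the interval `J` on its right side: the final point of `J` is
the initial point of `I`. -/
def RightAdjacent (J I : Set Circ) : Prop :=
  ∃ a b c : Circ, a ≠ b ∧ b ≠ c ∧ J = cIcc a b ∧ I = cIcc b c

/-- `y` is the point of `A` that follows `x` in the positive direction. -/
def IsNext (A : Set Circ) (x y : Circ) : Prop :=
  x ∈ A ∧ y ∈ A ∧ x ≠ y ∧ ∀ z ∈ A, z ∉ cIoo x y

/-! ### Basic partitions -/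

/-- The image `f I` is the union of `l` distinct components of `P` and of `l - 1` distinct
components of `sharp P`, for some `l ≥ 2`. (Below, `l = m + 2`.) -/
def Expands (P : Set Circ) (f : HomeoPlus) (I : Set Circ) : Prop :=
  ∃ (m : ℕ) (A : Fin (m + 2) → Set Circ) (B : Fin (m + 1) → Set Circ),
    Function.Injective A ∧ Function.Injective B ∧
    (∀ i, IsComponent (A i) P) ∧ (∀ i, IsComponent (B i) (sharp P)) ∧
    f '' I = (⋃ i, A i) ∪ ⋃ i, B i

/-- `P` is a basic partition for `φ` with respect to the set `S` of generators. -/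
structure IsBP {Γ : Type*} [Group Γ] (S : Set Γ) (φ : Γ →* HomeoPlus) (P : Set Circ) :
    Prop where
  finite_union : ∃ F : Set (Set Circ), F.Finite ∧ (∀ I ∈ F, IsArc I) ∧
    F.PairwiseDisjoint id ∧ P = ⋃₀ F
  expand : ∀ I, IsComponent I P → ∃! s, s ∈ S ∧ Expands P (φ s) I
  contract : ∀ I, IsComponent I P → ∀ s ∈ S, ¬ Expands P (φ s) I →
    ∃ I', IsComponent I' P ∧ φ s '' I ⊂ I'
  gap : ∀ J, IsComponent J (sharp P) → ∀ s ∈ S,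
    IsComponent (φ s '' J) (sharp P) ∨ φ s '' J ⊆ interior P

/-- The directed graph on the components of `sharp P`: there is an edge from `J₁` to `J₂` with
label `s` if `s` is the generator expanding the component of `P` right adjacent to `J₁`, and
`φ s` maps `J₁` onto `J₂`. -/
def GapEdge {Γ : Type*} [Group Γ] (S : Set Γ) (φ : Γ →* HomeoPlus) (P : Set Circ)
    (s : Γ) (J₁ J₂ : Set Circ) : Prop :=
  IsComponent J₁ (sharp P) ∧ IsComponent J₂ (sharp P) ∧
  ∃ I, IsComponent I P ∧ RightAdjacent J₁ I ∧ s ∈ S ∧ Expands P (φ s) I ∧ φ s '' J₁ = J₂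

/-- A basic partition is pure if its (finite) directed graph of gaps is a disjoint union of cycles,
that is, if exactly one edge leaves, and exactly one edge arrives at, each vertex. -/
structure IsPureBP {Γ : Type*} [Group Γ] (S : Set Γ) (φ : Γ →* HomeoPlus) (P : Set Circ) :
    Prop extends IsBP S φ P where
  out_edge : ∀ J, IsComponent J (sharp P) → ∃! e : Γ × Set Circ, GapEdge S φ P e.1 J e.2
  in_edge : ∀ J, IsComponent J (sharp P) → ∃! e : Γ × Set Circ, GapEdge S φ P e.1 e.2 J

/-- The derived partitions: `derived S φ P n` is the set usually denoted `P ^ (n + 1)`, where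
`P ^ 1 = P` and `P ^ l` is the intersection of the images of `P ^ (l - 1)` under `S ∪ {1}`. -/
def derived {Γ : Type*} [Group Γ] (S : Set Γ) (φ : Γ →* HomeoPlus) (P : Set Circ) : ℕ → Set Circ
  | 0 => P
  | n + 1 => ⋂ s ∈ insert 1 S, φ s '' derived S φ P n

/-- The entrance of the subgroup `L` to `X`: the union of the components of `sharp X` whose
stabilizer is nontrivial and contained in `L`. -/
def entrance {Γ : Type*} [Group Γ] (φ : Γ →* HomeoPlus) (L : Subgroup Γ) (X : Set Circ) :
    Set Circ :=
  ⋃₀ {J | IsComponent J (sharp X) ∧ stab φ J ≠ ⊥ ∧ stab φ J ≤ L}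

/-! ### Trees of groups -/

/-- A finite tree of groups. -/
structure TreeOfGroups where
  V : Type*
  finite_V : Finite V
  graph : SimpleGraph V
  isTree : graph.IsTree
  Γ : V → Type*
  Λ : graph.edgeSet → Type*
  groupΓ : ∀ v, Group (Γ v)
  groupΛ : ∀ e, Group (Λ e)
  ι : ∀ (e : graph.edgeSet) (v : V), v ∈ (e : Sym2 V) → (Λ e →* Γ v)
  ι_injective : ∀ e v hv, Function.Injective (ι e v hv)

attribute [instance] TreeOfGroups.groupΓ TreeOfGroups.groupΛ

namespace TreeOfGroups

variable (𝒯 : TreeOfGroups)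

/-- The free product of all the vertex groups and all the edge groups. -/
abbrev FreeProd : Type _ := Monoid.Coprod (Monoid.CoprodI 𝒯.Γ) (Monoid.CoprodI 𝒯.Λ)

/-- The words that express the relations identifying each edge group with a subgroup of the
vertex groups at its ends. -/
def relators : Set 𝒯.FreeProd :=
  {r | ∃ (e : 𝒯.graph.edgeSet) (v : 𝒯.V) (hv : v ∈ (e : Sym2 𝒯.V)) (a : 𝒯.Λ e),
    r = Monoid.Coprod.inr (Monoid.CoprodI.of a) *
      (Monoid.Coprod.inl (Monoid.CoprodI.of (𝒯.ι e v hv a)))⁻¹}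

/-- The fundamental group of a tree of groups. -/
abbrev FundamentalGroup : Type _ := 𝒯.FreeProd ⧸ Subgroup.normalClosure 𝒯.relators

/-- The canonical map of a vertex group into the fundamental group. -/
def vertexMap (v : 𝒯.V) : 𝒯.Γ v →* 𝒯.FundamentalGroup :=
  (QuotientGroup.mk' (Subgroup.normalClosure 𝒯.relators)).comp
    (Monoid.Coprod.inl.comp Monoid.CoprodI.of)

/-- The restriction of a homomorphism to a vertex group. -/
def restrict (φ : 𝒯.FundamentalGroup →* HomeoPlus) (v : 𝒯.V) : 𝒯.Γ v →* HomeoPlus :=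
  φ.comp (𝒯.vertexMap v)

/-- An edge group as a subgroup of a vertex group at one of its ends. -/
def edgeSubgroup (e : 𝒯.graph.edgeSet) (v : 𝒯.V) (hv : v ∈ (e : Sym2 𝒯.V)) :
    Subgroup (𝒯.Γ v) :=
  (𝒯.ι e v hv).range

end TreeOfGroups

/-! ### Basic configurations -/

/-- The data of a basic configuration for a homomorphism `φ` of the fundamental group of a tree of
groups: generating sets `S v` and pure basic partitions `P v` for the vertex groups, such that the
entrances of each edge group at the two ends of the edge alternate on the circle. -/
structure BasicConfiguration (𝒯 : TreeOfGroups) (φ : 𝒯.FundamentalGroup →* HomeoPlus) where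
  S : ∀ v, Set (𝒯.Γ v)
  S_finite : ∀ v, (S v).Finite
  S_symm : ∀ v, ∀ s ∈ S v, s⁻¹ ∈ S v
  S_generates : ∀ v, Subgroup.closure (S v) = ⊤
  edge_cyclic : ∀ e, IsCyclic (𝒯.Λ e)
  edge_infinite : ∀ e, Infinite (𝒯.Λ e)
  edge_transverse : ∀ (v : 𝒯.V) (e e' : 𝒯.graph.edgeSet) (hv : v ∈ (e : Sym2 𝒯.V))
    (hv' : v ∈ (e' : Sym2 𝒯.V)), e ≠ e' → ∀ γ : 𝒯.Γ v,
      𝒯.edgeSubgroup e v hv ⊓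
        (𝒯.edgeSubgroup e' v hv').map (MulAut.conj γ).toMonoidHom = ⊥
  P : ∀ _ : 𝒯.V, Set Circ
  pure : ∀ v, IsPureBP (S v) (𝒯.restrict φ v) (P v)
  entrance_nonempty : ∀ (e : 𝒯.graph.edgeSet) (v : 𝒯.V) (hv : v ∈ (e : Sym2 𝒯.V)),
    (entrance (𝒯.restrict φ v) (𝒯.edgeSubgroup e v hv) (P v)).Nonempty
  /-- The stabilizer of the entrance of an edge group is the edge group. -/
  stab_entrance : ∀ (e : 𝒯.graph.edgeSet) (v : 𝒯.V) (hv : v ∈ (e : Sym2 𝒯.V)),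
    stab (𝒯.restrict φ v) (entrance (𝒯.restrict φ v) (𝒯.edgeSubgroup e v hv) (P v)) =
      𝒯.edgeSubgroup e v hv
  combinable : ∀ (e : 𝒯.graph.edgeSet) (v w : 𝒯.V) (hv : v ∈ (e : Sym2 𝒯.V))
    (hw : w ∈ (e : Sym2 𝒯.V)), v ≠ w →
      entrance (𝒯.restrict φ v) (𝒯.edgeSubgroup e v hv) (P v) ∪
        entrance (𝒯.restrict φ w) (𝒯.edgeSubgroup e w hw) (P w) = univ ∧
      interior (entrance (𝒯.restrict φ v) (𝒯.edgeSubgroup e v hv) (P v)) ∩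
        interior (entrance (𝒯.restrict φ w) (𝒯.edgeSubgroup e w hw) (P w)) = ∅

namespace BasicConfiguration

variable {𝒯 : TreeOfGroups} {φ : 𝒯.FundamentalGroup →* HomeoPlus}

/-- The finite set of points of the configuration, the union over the vertices `v` of the
`boundaryPart (P v)`. -/
def points (B : BasicConfiguration 𝒯 φ) : Set Circ := ⋃ v, boundaryPart (B.P v)

/-- The union of the boundary points of the derived partitions `derived _ _ (P v) l`. -/
def derivedPoints (B : BasicConfiguration 𝒯 φ) (l : ℕ) : Set Circ :=
  ⋃ v, boundaryPart (derived (B.S v) (𝒯.restrict φ v) (B.P v) l)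

/-- The configuration is robust: for any big `l`, if `x⁻` and `x⁺` denote the points of
`derivedPoints l` adjacent to the point `x` of the configuration on the left and on the right,
then one of the generators of the image of the stabilizer of `x` maps `[x⁻, x⁺]` into a proper
subinterval of it, and more precisely it attracts towards `x` in the following sense: it maps a
closed interval `K x ⊆ [x⁻, x⁺]`, which is a neighbourhood of `x`, into the interior of `K x`.
Here the intervals `K x` are disjoint for distinct points `x` of the configuration. -/
def IsRobust (B : BasicConfiguration 𝒯 φ) : Prop :=
  ∃ l₀ : ℕ, ∀ l ≥ l₀, ∃ K : Circ → Set Circ, B.points.PairwiseDisjoint K ∧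
    ∀ x ∈ B.points, ∃ u w : Circ,
      IsNext (B.derivedPoints l) u x ∧ IsNext (B.derivedPoints l) x w ∧
      IsArc (K x) ∧ x ∈ interior (K x) ∧ K x ⊆ cIcc u w ∧
      ∃ f : HomeoPlus, Subgroup.zpowers f = (stab φ {x}).map φ ∧
        f '' cIcc u w ⊂ cIcc u w ∧ f '' K x ⊆ interior (K x)

end BasicConfiguration

end BasicPartition

end

noncomputable section

namespace BasicPartition

/-! ### The circle and the line -/

/-! Conjugating a lift of `ψ g` to the line by the multiplication by `k` gives a lift of `φ g`
(`IsScaledLift.isLift`). So the partitions of `φ`, repeated periodically along the line, describe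
the action of `ψ`, while a homomorphism `ω` near `ψ` gives nearby maps of the line that commute with
the translation by `k` only. The aim is a bound, uniform over all words in the generators of the
vertex groups, for the distance between the images of `0` under the two actions
(`Setup.eventually_dist_bounded`). Translation numbers then agree for all words, and a theorem of
Ghys provides a monotone degree one map intertwining the two actions. A group with a pure basic
partition has no global fixed point, so neither `ψ` nor, by the intertwining map, `ω` has one.

At a vertex the basic partition is a ping-pong table. Nonempty reduced words act nontrivially, so
the only relations between generators are cancellations, and their lifts are eventually the same
translations for both actions (`Setup.kernel`). The symbolic dynamics in `Coding` shows that a word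
carrying a gap to a gap follows a cycle of gaps, so that the stabilizer of a gap is commensurable
with one loop. By robustness the loop attracts or repels at the end points of the gap; these end
points therefore persist as fixed points of the perturbed loop, and `exists_equivariant` transports
them along the orbit. This gives perturbed partitions of the line with the same combinatorics
(`Perturbed`).

At an edge the end points of the two entrances coincide, and they must be perturbed in the same way
at both ends (`Setup.exists_edge_gaps`). This is possible because only elements of the edge group
carry a gap of its entrance to another one (`BasicConfiguration.ent_unique`), and these elements act
through both vertex groups. Finally, a ping-pong argument along the tree (`Tracking`) shows that
every product of vertex elements carries some component into a component or a gap with the same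
number in both actions. Corresponding intervals have bounded length and bounded distance, hence the
bound. -/

theorem coe_eq_coe_iff {s t : ℝ} : (s : Circ) = t ↔ ∃ n : ℤ, t = s + n := by
  rw [eq_comm, ← sub_eq_zero, ← AddCircle.coe_sub, AddCircle.coe_eq_zero_iff]
  constructor
  · rintro ⟨n, hn⟩
    exact ⟨n, by simp at hn; linarith⟩
  · rintro ⟨n, hn⟩
    exact ⟨n, by simp [hn]⟩

@[simp] theorem coe_add_int (t : ℝ) (n : ℤ) : ((t + n : ℝ) : Circ) = t :=
  (coe_eq_coe_iff.2 ⟨n, rfl⟩).symm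

theorem coe_surj (x : Circ) : ∃ t : ℝ, (t : Circ) = x := QuotientAddGroup.mk_surjective x

theorem coe_surj_Ico (x : Circ) (a : ℝ) : ∃ t : ℝ, a ≤ t ∧ t < a + 1 ∧ (t : Circ) = x := by
  obtain ⟨s, rfl⟩ := coe_surj x
  refine ⟨s + ((-⌊s - a⌋ : ℤ) : ℝ), ?_, ?_, coe_add_int _ _⟩
  · have := Int.floor_le (s - a); push_cast; linarith
  · have := Int.lt_floor_add_one (s - a); push_cast; linarith

theorem coe_mem_image {t : ℝ} {A : Set ℝ} :
    (t : Circ) ∈ ((↑) : ℝ → Circ) '' A ↔ ∃ n : ℤ, t + n ∈ A := by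
  constructor
  · rintro ⟨s, hs, h⟩
    obtain ⟨n, hn⟩ := coe_eq_coe_iff.1 h
    exact ⟨-n, by rw [hn]; push_cast; simpa using hs⟩
  · rintro ⟨n, hn⟩
    exact ⟨_, hn, coe_add_int _ _⟩

theorem continuous_coe : Continuous ((↑) : ℝ → Circ) := AddCircle.continuous_mk' 1

theorem isOpenMap_coe : IsOpenMap ((↑) : ℝ → Circ) := QuotientAddGroup.isOpenMap_coe

theorem coe_injOn {a b : ℝ} (h : b < a + 1) {s t : ℝ} (hs : s ∈ Icc a b) (ht : t ∈ Icc a b)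
    (hst : (s : Circ) = t) : s = t :=
  (AddCircle.coe_eq_coe_iff_of_mem_Ico (p := (1 : ℝ)) (a := a) ⟨hs.1, by linarith [hs.2]⟩
    ⟨ht.1, by linarith [ht.2]⟩).1 hst

theorem int_eq_zero_of_abs_lt {n : ℤ} (h1 : (n : ℝ) < 1) (h2 : (-1 : ℝ) < n) : n = 0 := by
  have h1' : n < 1 := by exact_mod_cast h1
  have h2' : -1 < n := by exact_mod_cast h2
  omega

/-- A preconnected set of reals lying over an arc and meeting an interval over this arc lies in
the interval. -/
theorem subset_Icc_of_coe {C : Set ℝ} (hC : C.OrdConnected) {a b c : ℝ} (hb : b < a + 1)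
    (hc : c ∈ C) (hcab : c ∈ Icc a b)
    (h : ∀ t ∈ C, (t : Circ) ∈ ((↑) : ℝ → Circ) '' Icc a b) : C ⊆ Icc a b := by
  intro d hd
  by_contra hdn
  -- As `b < a + 1`, on both sides `[a, b]` is bordered by intervals without points over the arc; an
  -- order connected set leaving `[a, b]` would have to cross one of them.
  have key : ∀ s, (b < s ∧ s < a + 1 ∨ b - 1 < s ∧ s < a) → s ∉ C := by
    intro s hs hsC
    obtain ⟨n, hn1, hn2⟩ := coe_mem_image.1 (h s hsC)
    rcases hs with hs | hs
    · have : n = 0 := int_eq_zero_of_abs_lt (by linarith) (by linarith)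
      subst this; simp at hn2; linarith
    · have : n = 0 := int_eq_zero_of_abs_lt (by linarith) (by linarith)
      subst this; simp at hn1; linarith
  rcases lt_or_ge d a with hda | hda
  · obtain ⟨s, hs1, hs2⟩ := exists_between (max_lt (hda) (by linarith : b - 1 < a))
    rw [max_lt_iff] at hs1
    exact key s (Or.inr ⟨hs1.2, hs2⟩) (hC.out hd hc ⟨hs1.1.le, by linarith [hcab.1]⟩)
  · have hdb : b < d := by
      by_contra hh; exact hdn ⟨hda, not_lt.1 hh⟩
    obtain ⟨s, hs1, hs2⟩ := exists_between (lt_min hdb hb)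
    rw [lt_min_iff] at hs2
    exact key s (Or.inl ⟨hs1, hs2.2⟩) (hC.out hc hd ⟨by linarith [hcab.2], hs2.1.le⟩)

theorem btw_coe {a x b : ℝ} (hx : a ≤ x) (hx' : x < a + 1) (hb : a < b) (hb' : b ≤ a + 1) :
    btw (a : Circ) x b ↔ x ≤ b := by
  have := @QuotientAddGroup.btw_coe_iff ℝ _ _ _ _ 1 ⟨one_pos⟩ a x b
  rw [(toIcoMod_eq_self _).2 ⟨hx, hx'⟩, (toIocMod_eq_self _).2 ⟨hb, hb'⟩] at this
  exact this

theorem cIcc_coe {a b : ℝ} (hab : a < b) (hb : b < a + 1) :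
    cIcc (a : Circ) b = ((↑) : ℝ → Circ) '' Icc a b := by
  ext x
  obtain ⟨t, h1, h2, rfl⟩ := coe_surj_Ico x a
  rw [mem_cIcc, btw_coe h1 h2 hab hb.le]
  constructor
  · intro h; exact ⟨t, ⟨h1, h⟩, rfl⟩
  · intro h
    obtain ⟨n, hn1, hn2⟩ := coe_mem_image.1 h
    have : n = 0 := int_eq_zero_of_abs_lt (by linarith) (by linarith)
    subst this; simpa using hn2

/-- This degenerate arc occurs when the two neighbours of a point coincide, a case that
`exists_next_lift` has to exclude. -/
theorem cIcc_coe_self (a : ℝ) : cIcc (a : Circ) a = univ := by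
  ext x
  obtain ⟨t, h1, h2, rfl⟩ := coe_surj_Ico x a
  have : (a : Circ) = ((a + 1 : ℝ) : Circ) := by simp
  simp only [mem_cIcc, mem_univ, iff_true]
  have h := (btw_coe h1 h2 (by linarith : a < a + 1) le_rfl).2 h2.le
  rwa [← this] at h

theorem coe_mem_cIoo {a b t : ℝ} (hb : b < a + 1) (h1 : a < t) (h2 : t < b) :
    (t : Circ) ∈ cIoo (a : Circ) b := by
  rw [← compl_cIcc, mem_compl_iff]
  intro h
  have e : (a : Circ) = ((a + 1 : ℝ) : Circ) := by simp
  have e2 : (t : Circ) = ((t + 1 : ℝ) : Circ) := by simp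
  rw [e, e2, mem_cIcc, btw_coe (by linarith) (by linarith) hb (by linarith)] at h
  linarith

theorem exists_lift_arc {I : Set Circ} (h : IsArc I) (x : ℝ) (hx : (x : Circ) ∈ I) :
    ∃ a b : ℝ, a < b ∧ b < a + 1 ∧ I = ((↑) : ℝ → Circ) '' Icc a b ∧ a ≤ x ∧ x ≤ b := by
  obtain ⟨p, q, hpq, rfl⟩ := h
  obtain ⟨a, h1, h2, rfl⟩ := coe_surj_Ico p (x - 1)
  obtain ⟨b, h3, h4, rfl⟩ := coe_surj_Ico q a
  have h5 : a < b := lt_of_le_of_ne h3 (by rintro rfl; exact hpq rfl)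
  rw [cIcc_coe h5 h4] at hx ⊢
  obtain ⟨n, hn1, hn2⟩ := coe_mem_image.1 hx
  refine ⟨a - n, b - n, by linarith, by linarith, ?_, by linarith, by linarith⟩
  ext y
  obtain ⟨t, rfl⟩ := coe_surj y
  rw [coe_mem_image, coe_mem_image]
  constructor
  · rintro ⟨m, hm1, hm2⟩
    exact ⟨m - n, by push_cast; constructor <;> linarith⟩
  · rintro ⟨m, hm1, hm2⟩
    exact ⟨m + n, by push_cast; constructor <;> linarith⟩

/-- An end point is not interior, because points beyond it by less than the length `a + 1 - b` of
the complementary arc have no representative in `[a, b]`. -/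
theorem coe_mem_interior {a b t : ℝ} (hb : b < a + 1)
    (h : (t : Circ) ∈ interior (((↑) : ℝ → Circ) '' Icc a b)) : ∃ n : ℤ, t + n ∈ Ioo a b := by
  obtain ⟨n, hn⟩ := coe_mem_image.1 (interior_subset h)
  have hopen : IsOpen (((↑) : ℝ → Circ) ⁻¹' interior (((↑) : ℝ → Circ) '' Icc a b)) :=
    isOpen_interior.preimage continuous_coe
  have hmem : t + n ∈ (((↑) : ℝ → Circ) ⁻¹' interior (((↑) : ℝ → Circ) '' Icc a b)) := by
    simpa using h
  obtain ⟨ε, hε, hball⟩ := Metric.isOpen_iff.1 hopen _ hmem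
  have key : ∀ s, |s - (t + n)| < ε → ∃ m : ℤ, s + m ∈ Icc a b := by
    intro s hs
    exact coe_mem_image.1 (interior_subset (hball (by rwa [Metric.mem_ball, Real.dist_eq])))
  refine ⟨n, lt_of_le_of_ne hn.1 ?_, lt_of_le_of_ne hn.2 ?_⟩
  · intro he
    have hpos : 0 < min ε (a + 1 - b) := lt_min hε (by linarith)
    have m1 := min_le_left ε (a + 1 - b)
    have m2 := min_le_right ε (a + 1 - b)
    obtain ⟨m, hm1, hm2⟩ := key (a - min ε (a + 1 - b) / 2) (by
      rw [← he, abs_lt]; constructor <;> linarith)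
    have hm3 : (1 : ℝ) ≤ m := by
      have : (0 : ℝ) < m := by linarith
      exact_mod_cast (by exact_mod_cast this : (0 : ℤ) < m)
    linarith
  · intro he
    have hpos : 0 < min ε (a + 1 - b) := lt_min hε (by linarith)
    have m1 := min_le_left ε (a + 1 - b)
    have m2 := min_le_right ε (a + 1 - b)
    obtain ⟨m, hm1, hm2⟩ := key (b + min ε (a + 1 - b) / 2) (by
      rw [he, abs_lt]; constructor <;> linarith)
    have hm3 : (m : ℝ) ≤ -1 := by
      have : (m : ℝ) < 0 := by linarith
      have h3 : m < 0 := by exact_mod_cast this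
      have h4 : m ≤ -1 := by omega
      exact_mod_cast h4
    linarith

theorem coe_image_Ioo_subset_interior (a b : ℝ) :
    ((↑) : ℝ → Circ) '' Ioo a b ⊆ interior (((↑) : ℝ → Circ) '' Icc a b) :=
  interior_maximal (image_mono Ioo_subset_Icc_self) (isOpenMap_coe _ isOpen_Ioo)

theorem isClosed_coe_Icc (a b : ℝ) : IsClosed (((↑) : ℝ → Circ) '' Icc a b) :=
  (isCompact_Icc.image continuous_coe).isClosed

theorem closure_coe_Ioo {a b : ℝ} (h : a < b) :
    closure (((↑) : ℝ → Circ) '' Ioo a b) = ((↑) : ℝ → Circ) '' Icc a b := by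
  apply Subset.antisymm
  · exact closure_minimal (image_mono Ioo_subset_Icc_self) (isClosed_coe_Icc a b)
  · rw [← closure_Ioo h.ne]
    exact image_closure_subset_closure_image continuous_coe

/-! ### Lifts of homeomorphisms -/

/-- The increasing homeomorphism `F` of the line is a lift of `f`. -/
def IsLift (F : ℝ ≃o ℝ) (f : HomeoPlus) : Prop := ∀ t : ℝ, f (t : Circ) = ((F t : ℝ) : Circ)

theorem exists_isLift (f : HomeoPlus) : ∃ F, IsLift F f := by
  obtain ⟨F, hF⟩ := f.2
  exact ⟨CircleDeg1Lift.toOrderIso F, fun t => hF t⟩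

theorem IsLift.one : IsLift 1 1 := fun _ => rfl

theorem IsLift.mul {F H : ℝ ≃o ℝ} {f h : HomeoPlus} (hF : IsLift F f) (hH : IsLift H h) :
    IsLift (F * H) (f * h) := by
  intro t
  change f (h t) = _
  rw [hH, hF]
  rfl

theorem IsLift.inv {F : ℝ ≃o ℝ} {f : HomeoPlus} (hF : IsLift F f) : IsLift F⁻¹ f⁻¹ := by
  intro t
  change (f : Circ ≃ₜ Circ).symm t = _
  rw [Homeomorph.symm_apply_eq]
  rw [hF]
  congr 1
  exact (F.apply_symm_apply t).symm

/-- Two lifts differ by an integer. -/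
theorem IsLift.unique {F H : ℝ ≃o ℝ} {f : HomeoPlus} (hF : IsLift F f) (hH : IsLift H f) :
    ∃ n : ℤ, ∀ t, H t = F t + n := by
  have h : ∀ t, ∃ n : ℤ, H t - F t = n := by
    intro t
    obtain ⟨n, hn⟩ := coe_eq_coe_iff.1 ((hF t).symm.trans (hH t))
    exact ⟨n, by rw [hn]; ring⟩
  choose n hn using h
  have hc : Continuous fun t => H t - F t := H.continuous.sub F.continuous
  -- A continuous integer valued function that is not constant would also take a half-integer value.
  have hconst : ∀ s t, s < t → n s = n t := by
    intro s t hst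
    by_contra hne
    have hpre := (isPreconnected_univ.image _ hc.continuousOn)
    have hs : (n s : ℝ) ∈ (fun t => H t - F t) '' univ := ⟨s, trivial, hn s⟩
    have ht : (n t : ℝ) ∈ (fun t => H t - F t) '' univ := ⟨t, trivial, hn t⟩
    rcases lt_or_gt_of_ne hne with h | h
    · have h' : (n s : ℝ) + 1 ≤ n t := by exact_mod_cast h
      obtain ⟨u, -, hu⟩ := hpre.ordConnected.out hs ht
        (⟨by linarith, by linarith⟩ : (n s : ℝ) + 1 / 2 ∈ Icc _ _)
      simp only [hn u] at hu
      have h1 : (2 * n u : ℝ) = 2 * n s + 1 := by linarith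
      have h2 : 2 * n u = 2 * n s + 1 := by exact_mod_cast h1
      omega
    · have h' : (n t : ℝ) + 1 ≤ n s := by exact_mod_cast h
      obtain ⟨u, -, hu⟩ := hpre.ordConnected.out ht hs
        (⟨by linarith, by linarith⟩ : (n t : ℝ) + 1 / 2 ∈ Icc _ _)
      simp only [hn u] at hu
      have h1 : (2 * n u : ℝ) = 2 * n t + 1 := by linarith
      have h2 : 2 * n u = 2 * n t + 1 := by exact_mod_cast h1
      omega
  refine ⟨n 0, fun t => ?_⟩
  have : n t = n 0 := by
    rcases lt_trichotomy t 0 with h | h | h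
    · exact hconst _ _ h
    · rw [h]
    · exact (hconst _ _ h).symm
  rw [← this, ← hn t]; ring

/-- The translation by `c`. -/
abbrev shift (c : ℝ) : ℝ ≃o ℝ := OrderIso.addRight c

theorem shift_mul (c d : ℝ) : shift c * shift d = shift (c + d) := by
  ext t; change t + d + c = t + (c + d); ring

theorem shift_zpow (c : ℝ) (n : ℤ) : shift c ^ n = shift (n * c) := by
  have h1 : ∀ m : ℕ, shift c ^ m = shift (m * c) := by
    intro m
    induction m with
    | zero => ext t; simp
    | succ m ih => rw [pow_succ, ih, shift_mul]; congr 1; push_cast; ring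
  have h0 : shift 0 = 1 := by ext t; simp
  obtain ⟨m, rfl | rfl⟩ := n.eq_nat_or_neg
  · rw [zpow_natCast, h1]; simp
  · rw [zpow_neg, zpow_natCast, h1, inv_eq_iff_mul_eq_one, shift_mul, ← h0]
    congr 1; push_cast; ring

theorem IsLift.shift_mul {F : ℝ ≃o ℝ} {f : HomeoPlus} (hF : IsLift F f) (n : ℤ) :
    IsLift (shift n * F) f := by
  intro t
  rw [hF t]
  exact (coe_add_int _ _).symm

/-- Commutation with integer translations is not part of `IsLift`; it is inherited from the
`CircleDeg1Lift` contained in `HomeoPlus`, from which `F` differs by a constant. -/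
theorem IsLift.add_int {F : ℝ ≃o ℝ} {f : HomeoPlus} (hF : IsLift F f) (t : ℝ) (n : ℤ) :
    F (t + n) = F t + n := by
  obtain ⟨F₀, h₀⟩ := f.2
  have h₁ : IsLift (CircleDeg1Lift.toOrderIso F₀) f := h₀
  obtain ⟨m, hm⟩ := h₁.unique hF
  rw [hm, hm]
  have : CircleDeg1Lift.toOrderIso F₀ (t + n) = CircleDeg1Lift.toOrderIso F₀ t + n :=
    (F₀ : CircleDeg1Lift).map_add_int t n
  rw [this]; ring

theorem IsLift.add_one {F : ℝ ≃o ℝ} {f : HomeoPlus} (hF : IsLift F f) (t : ℝ) :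
    F (t + 1) = F t + 1 := by simpa using hF.add_int t 1

theorem IsLift.image {F : ℝ ≃o ℝ} {f : HomeoPlus} (hF : IsLift F f) (A : Set ℝ) :
    f '' (((↑) : ℝ → Circ) '' A) = ((↑) : ℝ → Circ) '' (F '' A) := by
  rw [image_image, image_image]
  exact image_congr fun t _ => hF t

/-! ### Components of finite unions -/

/-- By finiteness the union of the other members is closed, so a connected subset of the whole union
that meets `I` stays in `I`. -/
theorem isComponent_sUnion_iff {X : Type*} [TopologicalSpace X] {F : Set (Set X)} (hF : F.Finite)
    (hcl : ∀ I ∈ F, IsClosed I) (hpre : ∀ I ∈ F, IsPreconnected I) (hne : ∀ I ∈ F, I.Nonempty)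
    (hd : F.PairwiseDisjoint id) (C : Set X) :
    (∃ x ∈ ⋃₀ F, C = connectedComponentIn (⋃₀ F) x) ↔ C ∈ F := by
  have key : ∀ I ∈ F, ∀ x ∈ I, connectedComponentIn (⋃₀ F) x = I := by
    intro I hI x hx
    apply Subset.antisymm
    · have h1 : IsClosed (⋃₀ (F \ {I})) := by
        rw [sUnion_eq_biUnion]
        exact (hF.subset sdiff_subset).isClosed_biUnion fun J hJ => hcl J hJ.1
      have hpc : IsPreconnected (connectedComponentIn (⋃₀ F) x) := isPreconnected_connectedComponentIn
      have hxF : x ∈ ⋃₀ F := ⟨I, hI, hx⟩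
      have hcov : connectedComponentIn (⋃₀ F) x ⊆ I ∪ ⋃₀ (F \ {I}) := by
        refine (connectedComponentIn_subset _ _).trans ?_
        rintro y ⟨J, hJ, hy⟩
        by_cases h : J = I
        · left; rwa [← h]
        · right; exact ⟨J, ⟨hJ, h⟩, hy⟩
      have hdisj : I ∩ ⋃₀ (F \ {I}) = ∅ := by
        rw [eq_empty_iff_forall_notMem]
        rintro y ⟨hy, J, hJ, hyJ⟩
        exact (disjoint_left.1 (hd hI hJ.1 (fun h => hJ.2 h.symm)) hy) hyJ
      have := isPreconnected_closed_iff.1 hpc I _ (hcl I hI) h1 hcov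
        ⟨x, mem_connectedComponentIn hxF, hx⟩
      intro y hy
      by_contra hyI
      obtain ⟨z, -, hz⟩ := this ⟨y, hy, (hcov hy).resolve_left hyI⟩
      rw [hdisj] at hz
      exact hz
    · exact (hpre I hI).subset_connectedComponentIn hx (subset_sUnion_of_mem hI)
  constructor
  · rintro ⟨x, ⟨I, hI, hx⟩, rfl⟩
    rwa [key I hI x hx]
  · intro hC
    obtain ⟨x, hx⟩ := hne C hC
    exact ⟨x, ⟨C, hC, hx⟩, (key C hC x hx).symm⟩

/-- For open members the union of the others is open without any finiteness. -/
theorem isComponent_sUnion_open_iff {X : Type*} [TopologicalSpace X] {F : Set (Set X)}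
    (hcl : ∀ I ∈ F, IsOpen I) (hpre : ∀ I ∈ F, IsPreconnected I) (hne : ∀ I ∈ F, I.Nonempty)
    (hd : F.PairwiseDisjoint id) (C : Set X) :
    (∃ x ∈ ⋃₀ F, C = connectedComponentIn (⋃₀ F) x) ↔ C ∈ F := by
  have key : ∀ I ∈ F, ∀ x ∈ I, connectedComponentIn (⋃₀ F) x = I := by
    intro I hI x hx
    apply Subset.antisymm
    · have h1 : IsOpen (⋃₀ (F \ {I})) := isOpen_sUnion fun J hJ => hcl J hJ.1
      have hpc : IsPreconnected (connectedComponentIn (⋃₀ F) x) := isPreconnected_connectedComponentIn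
      have hxF : x ∈ ⋃₀ F := ⟨I, hI, hx⟩
      have hcov : connectedComponentIn (⋃₀ F) x ⊆ I ∪ ⋃₀ (F \ {I}) := by
        refine (connectedComponentIn_subset _ _).trans ?_
        rintro y ⟨J, hJ, hy⟩
        by_cases h : J = I
        · left; rwa [← h]
        · right; exact ⟨J, ⟨hJ, h⟩, hy⟩
      have hdisj : I ∩ ⋃₀ (F \ {I}) = ∅ := by
        rw [eq_empty_iff_forall_notMem]
        rintro y ⟨hy, J, hJ, hyJ⟩
        exact (disjoint_left.1 (hd hI hJ.1 (fun h => hJ.2 h.symm)) hy) hyJ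
      intro y hy
      by_contra hyI
      obtain ⟨z, -, hz⟩ := hpc I _ (hcl I hI) h1 hcov ⟨x, mem_connectedComponentIn hxF, hx⟩
        ⟨y, hy, (hcov hy).resolve_left hyI⟩
      rw [hdisj] at hz
      exact hz
    · exact (hpre I hI).subset_connectedComponentIn hx (subset_sUnion_of_mem hI)
  constructor
  · rintro ⟨x, ⟨I, hI, hx⟩, rfl⟩
    rwa [key I hI x hx]
  · intro hC
    obtain ⟨x, hx⟩ := hne C hC
    exact ⟨x, ⟨C, hC, hx⟩, (key C hC x hx).symm⟩

section

/-! ### Enumeration of the components of a finite union of arcs -/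

/-- An enumeration, along the line, of the components `[a i, b i]` of the preimage of `P`. -/
structure Enum (P : Set Circ) where
  a : ℤ → ℝ
  b : ℤ → ℝ
  N : ℕ
  N_pos : 0 < N
  a_lt_b : ∀ i, a i < b i
  b_lt_a : ∀ i, b i < a (i + 1)
  a_add : ∀ i, a (i + N) = a i + 1
  b_add : ∀ i, b (i + N) = b i + 1
  mem_iff : ∀ t : ℝ, (t : Circ) ∈ P ↔ ∃ i, a i ≤ t ∧ t ≤ b i

theorem int_orderIso_apply (h : ℤ ≃o ℤ) (i : ℤ) : h i = h 0 + i := by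
  have hs : ∀ i, h (i + 1) = h i + 1 := fun i => h.map_succ i
  induction i using Int.induction_on with
  | zero => simp
  | succ n ih => rw [hs, ih]; ring
  | pred n ih => have := hs (-n - 1); rw [sub_add_cancel, ih] at this; linarith

/-- A locally finite subset of the line that is unbounded on both sides is order isomorphic to ℤ.
The translation by one becomes an order automorphism of ℤ, which is a shift, and `N` is its amount.
-/
theorem exists_int_enumeration (A : Set ℝ) (hne : A.Nonempty) (hA : ∀ t, t ∈ A → t + 1 ∈ A)
    (hA' : ∀ t, t ∈ A → t - 1 ∈ A) (hfin : ∀ x y, (A ∩ Icc x y).Finite) :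
    ∃ (g : ℤ → ℝ) (N : ℕ), 0 < N ∧ (∀ i, g i < g (i + 1)) ∧ (∀ i, g (i + N) = g i + 1) ∧
      range g = A := by
  let _ : LocallyFiniteOrder A := LocallyFiniteOrder.ofFiniteIcc (by
    intro x y
    refine Finite.of_injOn (f := Subtype.val) (t := A ∩ Icc (x : ℝ) y) ?_
      Subtype.val_injective.injOn (hfin x y)
    intro z hz
    exact ⟨z.2, hz⟩)
  let _ : SuccOrder A := LinearLocallyFiniteOrder.succOrder A
  let _ : PredOrder A := LinearLocallyFiniteOrder.predOrder A
  have : NoMaxOrder A := ⟨fun x => ⟨⟨x + 1, hA _ x.2⟩, by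
    rw [← Subtype.coe_lt_coe]; simp⟩⟩
  have : NoMinOrder A := ⟨fun x => ⟨⟨x - 1, hA' _ x.2⟩, by
    rw [← Subtype.coe_lt_coe]; simp⟩⟩
  have : Nonempty A := hne.to_subtype
  let e : A ≃o ℤ := orderIsoIntOfLinearSuccPredArch
  let T : A ≃o A :=
    { toFun := fun x => ⟨x + 1, hA _ x.2⟩
      invFun := fun x => ⟨x - 1, hA' _ x.2⟩
      left_inv := fun x => by ext; simp
      right_inv := fun x => by ext; simp
      map_rel_iff' := by
        intro x y
        simp only [Equiv.coe_fn_mk, ← Subtype.coe_le_coe, add_le_add_iff_right] }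
  let h : ℤ ≃o ℤ := (e.symm.trans T).trans e
  have hg : ∀ i, e.symm (h i) = T (e.symm i) := by
    intro i; simp [h]
  have hpos : 0 < h 0 := by
    rw [← e.symm.lt_iff_lt, hg, ← Subtype.coe_lt_coe]
    simp [T]
  refine ⟨fun i => e.symm i, (h 0).toNat, by omega, ?_, ?_, ?_⟩
  · intro i
    rw [Subtype.coe_lt_coe, e.symm.lt_iff_lt]; omega
  · intro i
    have : i + ((h 0).toNat : ℤ) = h i := by rw [int_orderIso_apply h i]; omega
    change (e.symm _ : ℝ) = e.symm i + 1
    rw [this, hg]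
    rfl
  · ext t
    constructor
    · rintro ⟨i, rfl⟩; exact (e.symm i).2
    · intro ht
      exact ⟨e ⟨t, ht⟩, by simp⟩

/-- The left end points of all lifts of the arcs are enumerated; `Ia i` is the arc starting at `a i`
and `na i` the integer translation involved. By disjointness an arc is determined by any of its
points, which gives the periodicity and the order of the end points. -/
theorem exists_enum {P : Set Circ} {F : Set (Set Circ)} (hF : F.Finite) (hne : F.Nonempty)
    (harc : ∀ I ∈ F, IsArc I) (hd : F.PairwiseDisjoint id) (hP : P = ⋃₀ F) :
    Nonempty (Enum P) := by
  have h1 : ∀ I ∈ F, ∃ l r : ℝ, l < r ∧ r < l + 1 ∧ I = ((↑) : ℝ → Circ) '' Icc l r := by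
    intro I hI
    obtain ⟨p, q, hpq, hI'⟩ := harc I hI
    obtain ⟨t, rfl⟩ := coe_surj p
    obtain ⟨l, r, h1, h2, h3, -⟩ := exists_lift_arc (harc I hI) t
      (by rw [hI']; exact left_mem_cIcc _ _)
    exact ⟨l, r, h1, h2, h3⟩
  choose! l r hlr hrl hI using h1
  let A : Set ℝ := {t | ∃ I ∈ F, ∃ n : ℤ, t = l I + n}
  have hAne : A.Nonempty := by
    obtain ⟨I, hIF⟩ := hne
    exact ⟨l I, I, hIF, 0, by simp⟩
  have hfin : ∀ x y, (A ∩ Icc x y).Finite := by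
    intro x y
    have : A ∩ Icc x y ⊆ ⋃ I ∈ F, (fun n : ℤ => l I + n) '' Icc ⌈x - l I⌉ ⌊y - l I⌋ := by
      rintro t ⟨⟨I, hIF, n, rfl⟩, hx, hy⟩
      refine mem_biUnion hIF ⟨n, ⟨?_, ?_⟩, rfl⟩
      · rw [Int.ceil_le]; linarith
      · rw [Int.le_floor]; linarith
    exact (hF.biUnion fun I _ => (finite_Icc _ _).image _).subset this
  obtain ⟨a, N, hN, hmono, hadd, hrange⟩ := exists_int_enumeration A hAne
    (by rintro t ⟨I, hIF, n, rfl⟩; exact ⟨I, hIF, n + 1, by push_cast; ring⟩)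
    (by rintro t ⟨I, hIF, n, rfl⟩; exact ⟨I, hIF, n - 1, by push_cast; ring⟩) hfin
  have hamem : ∀ i, a i ∈ A := fun i => hrange ▸ mem_range_self i
  choose Ia hIa na hna using hamem
  have hamono : StrictMono a := strictMono_int_of_lt_succ hmono
  have hinj : ∀ I ∈ F, ∀ I' ∈ F, ∀ x, x ∈ I → x ∈ I' → I = I' := by
    intro I hIF I' hIF' x hx hx'
    by_contra hne
    exact disjoint_left.1 (hd hIF hIF' hne) hx hx'
  have hmemI : ∀ I ∈ F, ∀ t : ℝ, (t : Circ) ∈ I ↔ ∃ n : ℤ, l I + n ≤ t ∧ t ≤ r I + n := by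
    intro I hIF t
    conv_lhs => rw [hI I hIF]
    rw [coe_mem_image]
    constructor
    · rintro ⟨n, h1, h2⟩; exact ⟨-n, by push_cast; constructor <;> linarith⟩
    · rintro ⟨n, h1, h2⟩; exact ⟨-n, by push_cast; constructor <;> linarith⟩
  have hper : ∀ i, Ia (i + N) = Ia i := by
    intro i
    refine hinj _ (hIa _) _ (hIa _) (a i : Circ) ?_ ?_
    · rw [hmemI _ (hIa _)]
      refine ⟨na (i + N) - 1, ?_⟩
      have := hna (i + N); rw [hadd] at this
      have h3 := hlr _ (hIa (i + N))
      push_cast; constructor <;> linarith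
    · rw [hmemI _ (hIa _)]
      have h3 := hlr _ (hIa i)
      exact ⟨na i, by constructor <;> linarith [hna i]⟩
  refine ⟨⟨a, fun i => r (Ia i) + na i, N, hN, ?_, ?_, hadd, ?_, ?_⟩⟩
  · intro i
    have := hlr _ (hIa i); have := hna i; linarith
  · intro i
    -- Otherwise `a i` and `a (i + 1)` start lifts of the same arc, so they differ by a positive
    -- integer, which exceeds the length of the arc.
    by_contra hcon
    rw [not_lt] at hcon
    have h1 : Ia i = Ia (i + 1) := by
      refine hinj _ (hIa _) _ (hIa _) (a (i + 1) : Circ) ?_ ?_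
      · rw [hmemI _ (hIa _)]
        exact ⟨na i, by constructor <;> linarith [hmono i, hna i]⟩
      · rw [hmemI _ (hIa _)]
        have h3 := hlr _ (hIa (i + 1))
        exact ⟨na (i + 1), by constructor <;> linarith [hna (i + 1)]⟩
    have h2 := hmono i
    have h3 := hrl _ (hIa i)
    have h4 := hna (i + 1)
    rw [← h1] at h4
    have h5 := hna i
    have h6 : (na i : ℝ) < na (i + 1) := by linarith
    have h7 : (na i : ℝ) + 1 ≤ na (i + 1) := by exact_mod_cast h6
    linarith
  · intro i
    have h1 := hna (i + N); rw [hadd, hper] at h1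
    have h2 := hna i
    simp only [hper]; linarith
  · intro t
    rw [hP]
    constructor
    · rintro ⟨I, hIF, ht⟩
      obtain ⟨n, h1, h2⟩ := (hmemI I hIF t).1 ht
      have : l I + n ∈ range a := by rw [hrange]; exact ⟨I, hIF, n, rfl⟩
      obtain ⟨i, hi⟩ := this
      have hII : Ia i = I := by
        refine hinj _ (hIa _) _ hIF (a i : Circ) ?_ ?_
        · rw [hmemI _ (hIa _)]
          have h3 := hlr _ (hIa i)
          exact ⟨na i, by constructor <;> linarith [hna i]⟩
        · rw [hmemI _ hIF]
          have h3 := hlr _ hIF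
          exact ⟨n, by constructor <;> linarith⟩
      have h3 := hna i
      rw [hII] at h3
      have h4 : (na i : ℝ) = n := by linarith
      exact ⟨i, by linarith, by rw [hII, h4]; exact h2⟩
    · rintro ⟨i, h1, h2⟩
      refine ⟨Ia i, hIa i, ?_⟩
      rw [hmemI _ (hIa _)]
      exact ⟨na i, by linarith [hna i], h2⟩

namespace Enum

variable {P : Set Circ} (E : Enum P)

/-- The component of `P` with number `i`. -/
def comp (i : ℤ) : Set Circ := ((↑) : ℝ → Circ) '' Icc (E.a i) (E.b i)

/-- The closed gap of `P` following the component with number `i`. -/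
def gap (i : ℤ) : Set Circ := ((↑) : ℝ → Circ) '' Icc (E.b i) (E.a (i + 1))

theorem a_strictMono : StrictMono E.a :=
  strictMono_int_of_lt_succ fun i => (E.a_lt_b i).trans (E.b_lt_a i)

theorem b_strictMono : StrictMono E.b :=
  strictMono_int_of_lt_succ fun i => (E.b_lt_a i).trans (E.a_lt_b (i + 1))

theorem a_add_mul (i m : ℤ) : E.a (i + E.N * m) = E.a i + m := by
  induction m using Int.induction_on with
  | zero => simp
  | succ n ih =>
    have := E.a_add (i + E.N * n)
    rw [ih] at this
    rw [show i + E.N * ((n : ℤ) + 1) = i + E.N * n + E.N by ring, this]; push_cast; ring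
  | pred n ih =>
    have := E.a_add (i + E.N * (-n - 1))
    rw [show i + E.N * (-(n : ℤ) - 1) + E.N = i + E.N * (-n) by ring, ih] at this
    push_cast at this ⊢; linarith

theorem b_add_mul (i m : ℤ) : E.b (i + E.N * m) = E.b i + m := by
  induction m using Int.induction_on with
  | zero => simp
  | succ n ih =>
    have := E.b_add (i + E.N * n)
    rw [ih] at this
    rw [show i + E.N * ((n : ℤ) + 1) = i + E.N * n + E.N by ring, this]; push_cast; ring
  | pred n ih =>
    have := E.b_add (i + E.N * (-n - 1))
    rw [show i + E.N * (-(n : ℤ) - 1) + E.N = i + E.N * (-n) by ring, ih] at this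
    push_cast at this ⊢; linarith

theorem a_succ_le (i : ℤ) : E.a (i + 1) ≤ E.a i + 1 := by
  rw [← E.a_add i]
  exact E.a_strictMono.monotone (by have := E.N_pos; omega)

theorem b_lt (i : ℤ) : E.b i < E.a i + 1 := (E.b_lt_a i).trans_le (E.a_succ_le i)

theorem a_succ_lt (i : ℤ) : E.a (i + 1) < E.b i + 1 := by
  have := E.a_succ_le i; have := E.a_lt_b i; linarith

theorem le_of_a_le_b {i j : ℤ} (h : E.a i ≤ E.b j) : i ≤ j := by
  have := E.a_strictMono.lt_iff_lt.1 (h.trans_lt (E.b_lt_a j)); omega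

theorem lt_of_b_le_a {i j : ℤ} (h : E.b i ≤ E.a j) : i < j :=
  E.b_strictMono.lt_iff_lt.1 (h.trans_lt (E.a_lt_b j))

theorem b_lt_a' {i j : ℤ} (h : i < j) : E.b i < E.a j :=
  (E.b_lt_a i).trans_le (E.a_strictMono.monotone (by omega))

theorem cover (t : ℝ) : ∃ i, E.a i ≤ t ∧ t < E.a (i + 1) := by
  have hbd : ∃ c : ℤ, ∀ z : ℤ, E.a z ≤ t → z ≤ c := by
    refine ⟨0 + E.N * (⌊t - E.a 0⌋ + 1), fun z hz => ?_⟩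
    have h1 : t < E.a (0 + E.N * (⌊t - E.a 0⌋ + 1)) := by
      rw [E.a_add_mul]; push_cast
      have := Int.lt_floor_add_one (t - E.a 0); linarith
    exact (E.a_strictMono.lt_iff_lt.1 (hz.trans_lt h1)).le
  have hex : ∃ z : ℤ, E.a z ≤ t := by
    refine ⟨0 + E.N * ⌊t - E.a 0⌋, ?_⟩
    rw [E.a_add_mul]
    have := Int.floor_le (t - E.a 0); linarith
  obtain ⟨i, hi, hmax⟩ := Int.exists_greatest_of_bdd hbd hex
  refine ⟨i, hi, ?_⟩
  by_contra hcon
  have := hmax (i + 1) (not_lt.1 hcon); omega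

theorem cover' (t : ℝ) : (∃ i, E.a i ≤ t ∧ t ≤ E.b i) ∨ ∃ i, E.b i < t ∧ t < E.a (i + 1) := by
  obtain ⟨i, h1, h2⟩ := E.cover t
  rcases le_or_gt t (E.b i) with h | h
  · exact Or.inl ⟨i, h1, h⟩
  · exact Or.inr ⟨i, h, h2⟩

theorem gap_notMem {t : ℝ} {i : ℤ} (h1 : E.b i < t) (h2 : t < E.a (i + 1)) : (t : Circ) ∉ P := by
  rw [E.mem_iff]
  rintro ⟨j, h3, h4⟩
  have := E.a_strictMono.lt_iff_lt.1 (h3.trans_lt h2)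
  have := E.b_strictMono.lt_iff_lt.1 (h1.trans_le h4)
  omega

theorem exists_mod (i : ℤ) (k : ℕ) (hk : 0 < k) :
    ∃ j m : ℤ, 0 ≤ j ∧ j < k * E.N ∧ i = j + E.N * (k * m) := by
  have : (0 : ℤ) < k * E.N := by have := E.N_pos; positivity
  refine ⟨i % (k * E.N), i / (k * E.N), Int.emod_nonneg _ this.ne', Int.emod_lt_of_pos _ this, ?_⟩
  have := Int.emod_add_mul_ediv i (k * E.N)
  linarith

theorem comp_add (i m : ℤ) : E.comp (i + E.N * m) = E.comp i := by
  ext x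
  obtain ⟨t, rfl⟩ := coe_surj x
  rw [comp, comp, coe_mem_image, coe_mem_image, E.a_add_mul, E.b_add_mul]
  constructor
  · rintro ⟨n, h1, h2⟩; exact ⟨n - m, by push_cast; constructor <;> linarith⟩
  · rintro ⟨n, h1, h2⟩; exact ⟨n + m, by push_cast; constructor <;> linarith⟩

theorem gap_add (i m : ℤ) : E.gap (i + E.N * m) = E.gap i := by
  ext x
  obtain ⟨t, rfl⟩ := coe_surj x
  rw [gap, gap, coe_mem_image, coe_mem_image, show i + E.N * m + 1 = i + 1 + E.N * m by ring,
    E.a_add_mul, E.b_add_mul]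
  constructor
  · rintro ⟨n, h1, h2⟩; exact ⟨n - m, by push_cast; constructor <;> linarith⟩
  · rintro ⟨n, h1, h2⟩; exact ⟨n + m, by push_cast; constructor <;> linarith⟩

/-- If components with two numbers meet, then the numbers are congruent. -/
theorem mod_of_mem {i j : ℤ} {t : ℝ} (h1 : E.a i ≤ t) (h2 : t ≤ E.b i) {n : ℤ}
    (h3 : E.a j ≤ t + n) (h4 : t + n ≤ E.b j) : j = i + E.N * n := by
  have e1 := E.a_add_mul i n
  have e2 := E.b_add_mul i n
  have := E.le_of_a_le_b (i := i + E.N * n) (j := j) (by linarith)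
  have := E.le_of_a_le_b (i := j) (j := i + E.N * n) (by linarith)
  omega

theorem comp_eq_of_mem {i j : ℤ} {x : Circ} (h1 : x ∈ E.comp i) (h2 : x ∈ E.comp j) :
    ∃ n : ℤ, j = i + E.N * n := by
  obtain ⟨t, ht, rfl⟩ := h1
  obtain ⟨n, hn⟩ := coe_mem_image.1 h2
  exact ⟨n, E.mod_of_mem ht.1 ht.2 hn.1 hn.2⟩

theorem gap_mod_of_mem {i j : ℤ} {t : ℝ} (h1 : E.b i ≤ t) (h2 : t ≤ E.a (i + 1)) {n : ℤ}
    (h3 : E.b j ≤ t + n) (h4 : t + n ≤ E.a (j + 1)) : j = i + E.N * n := by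
  have e1 := E.a_add_mul (i + 1) n
  have e2 := E.b_add_mul i n
  have := E.lt_of_b_le_a (i := i + E.N * n) (j := j + 1) (by linarith)
  have := E.lt_of_b_le_a (i := j) (j := i + 1 + E.N * n) (by linarith)
  omega

theorem gap_eq_of_mem {i j : ℤ} {x : Circ} (h1 : x ∈ E.gap i) (h2 : x ∈ E.gap j) :
    ∃ n : ℤ, j = i + E.N * n := by
  obtain ⟨t, ht, rfl⟩ := h1
  obtain ⟨n, hn⟩ := coe_mem_image.1 h2
  exact ⟨n, E.gap_mod_of_mem ht.1 ht.2 hn.1 hn.2⟩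

theorem range_finite_of_periodic {α : Type*} (f : ℤ → α) (hf : ∀ i m : ℤ, f (i + E.N * m) = f i) :
    (range f).Finite := by
  refine ((finite_Ico (0 : ℤ) (1 * E.N)).image f).subset ?_
  rintro _ ⟨i, rfl⟩
  obtain ⟨j, m, h1, h2, rfl⟩ := E.exists_mod i 1 one_pos
  exact ⟨j, ⟨h1, by simpa using h2⟩, by rw [hf]⟩

theorem isComponent_iff (C : Set Circ) : IsComponent C P ↔ ∃ i, C = E.comp i := by
  have hP : P = ⋃₀ range E.comp := by
    ext x
    obtain ⟨t, rfl⟩ := coe_surj x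
    rw [E.mem_iff]
    constructor
    · rintro ⟨i, h1, h2⟩; exact ⟨_, ⟨i, rfl⟩, t, ⟨h1, h2⟩, rfl⟩
    · rintro ⟨_, ⟨i, rfl⟩, h⟩
      obtain ⟨n, h1, h2⟩ := coe_mem_image.1 h
      refine ⟨i + E.N * (-n), ?_⟩
      rw [E.a_add_mul, E.b_add_mul]; push_cast; constructor <;> linarith
  have := isComponent_sUnion_iff (E.range_finite_of_periodic _ E.comp_add)
    (by rintro _ ⟨i, rfl⟩; exact isClosed_coe_Icc _ _)
    (by rintro _ ⟨i, rfl⟩; exact isPreconnected_Icc.image _ continuous_coe.continuousOn)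
    (by rintro _ ⟨i, rfl⟩; exact (nonempty_Icc.2 (E.a_lt_b i).le).image _)
    (by
      rintro _ ⟨i, rfl⟩ _ ⟨j, rfl⟩ hne
      refine disjoint_left.2 fun x hx hx' => hne ?_
      obtain ⟨n, rfl⟩ := E.comp_eq_of_mem hx hx'
      exact (E.comp_add i n).symm) C
  rw [← hP] at this
  exact this.trans ⟨fun ⟨i, h⟩ => ⟨i, h.symm⟩, fun ⟨i, h⟩ => ⟨i, h.symm⟩⟩

/-- The open gap of `P` following the component with number `i`. -/
def openGap (i : ℤ) : Set Circ := ((↑) : ℝ → Circ) '' Ioo (E.b i) (E.a (i + 1))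

theorem compl_eq : Pᶜ = ⋃₀ range E.openGap := by
  ext x
  obtain ⟨t, rfl⟩ := coe_surj x
  constructor
  · intro h
    rcases E.cover' t with h' | ⟨i, h1, h2⟩
    · exact absurd ((E.mem_iff t).2 h') h
    · exact ⟨_, ⟨i, rfl⟩, t, ⟨h1, h2⟩, rfl⟩
  · rintro ⟨_, ⟨i, rfl⟩, t', ⟨h1, h2⟩, h⟩
    rw [← h]
    exact E.gap_notMem h1 h2

theorem isComponent_compl_iff (C : Set Circ) : IsComponent C Pᶜ ↔ ∃ i, C = E.openGap i := by
  have hadd : ∀ i m : ℤ, E.openGap (i + E.N * m) = E.openGap i := by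
    intro i m
    ext x
    obtain ⟨t, rfl⟩ := coe_surj x
    rw [openGap, openGap, coe_mem_image, coe_mem_image,
      show i + E.N * m + 1 = i + 1 + E.N * m by ring, E.a_add_mul, E.b_add_mul]
    constructor
    · rintro ⟨n, h1, h2⟩; exact ⟨n - m, by push_cast; constructor <;> linarith⟩
    · rintro ⟨n, h1, h2⟩; exact ⟨n + m, by push_cast; constructor <;> linarith⟩
  have := isComponent_sUnion_open_iff (F := range E.openGap)
    (by rintro _ ⟨i, rfl⟩; exact isOpenMap_coe _ isOpen_Ioo)
    (by rintro _ ⟨i, rfl⟩; exact isPreconnected_Ioo.image _ continuous_coe.continuousOn)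
    (by rintro _ ⟨i, rfl⟩; exact (nonempty_Ioo.2 (E.b_lt_a i)).image _)
    (by
      rintro _ ⟨i, rfl⟩ _ ⟨j, rfl⟩ hne
      refine disjoint_left.2 fun x hx hx' => hne ?_
      obtain ⟨n, rfl⟩ := E.gap_eq_of_mem (image_mono Ioo_subset_Icc_self hx)
        (image_mono Ioo_subset_Icc_self hx')
      exact (hadd i n).symm) C
  rw [← E.compl_eq] at this
  exact this.trans ⟨fun ⟨i, h⟩ => ⟨i, h.symm⟩, fun ⟨i, h⟩ => ⟨i, h.symm⟩⟩

theorem sharp_eq : sharp P = ⋃₀ range E.gap := by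
  unfold sharp
  congr 1
  ext J
  constructor
  · rintro ⟨C, hC, rfl⟩
    obtain ⟨i, rfl⟩ := (E.isComponent_compl_iff C).1 hC
    exact ⟨i, (closure_coe_Ioo (E.b_lt_a i)).symm⟩
  · rintro ⟨i, rfl⟩
    exact ⟨E.openGap i, (E.isComponent_compl_iff _).2 ⟨i, rfl⟩,
      (closure_coe_Ioo (E.b_lt_a i)).symm⟩

theorem isComponent_sharp_iff (C : Set Circ) : IsComponent C (sharp P) ↔ ∃ i, C = E.gap i := by
  have := isComponent_sUnion_iff (E.range_finite_of_periodic _ E.gap_add)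
    (by rintro _ ⟨i, rfl⟩; exact isClosed_coe_Icc _ _)
    (by rintro _ ⟨i, rfl⟩; exact isPreconnected_Icc.image _ continuous_coe.continuousOn)
    (by rintro _ ⟨i, rfl⟩; exact (nonempty_Icc.2 (E.b_lt_a i).le).image _)
    (by
      rintro _ ⟨i, rfl⟩ _ ⟨j, rfl⟩ hne
      refine disjoint_left.2 fun x hx hx' => hne ?_
      obtain ⟨n, rfl⟩ := E.gap_eq_of_mem hx hx'
      exact (E.gap_add i n).symm) C
  rw [← E.sharp_eq] at this
  exact this.trans ⟨fun ⟨i, h⟩ => ⟨i, h.symm⟩, fun ⟨i, h⟩ => ⟨i, h.symm⟩⟩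

theorem mem_sharp_iff (t : ℝ) :
    (t : Circ) ∈ sharp P ↔ ∃ i, E.b i ≤ t ∧ t ≤ E.a (i + 1) := by
  rw [E.sharp_eq]
  constructor
  · rintro ⟨_, ⟨i, rfl⟩, h⟩
    obtain ⟨n, h1, h2⟩ := coe_mem_image.1 h
    refine ⟨i + E.N * (-n), ?_⟩
    rw [show i + E.N * (-n) + 1 = i + 1 + E.N * (-n) by ring, E.a_add_mul, E.b_add_mul]
    push_cast; constructor <;> linarith
  · rintro ⟨i, h1, h2⟩; exact ⟨_, ⟨i, rfl⟩, t, ⟨h1, h2⟩, rfl⟩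

theorem mem_boundaryPart_iff (t : ℝ) :
    (t : Circ) ∈ boundaryPart P ↔ ∃ i, t = E.a i ∨ t = E.b i := by
  rw [boundaryPart, mem_inter_iff, E.mem_iff, E.mem_sharp_iff]
  constructor
  · rintro ⟨⟨i, h1, h2⟩, j, h3, h4⟩
    have := E.b_strictMono.le_iff_le.1 (h3.trans h2)
    have := E.a_strictMono.le_iff_le.1 (h1.trans h4)
    rcases (by omega : j = i ∨ i = j + 1) with rfl | rfl
    · exact ⟨j, Or.inr (le_antisymm h2 h3)⟩
    · exact ⟨j + 1, Or.inl (le_antisymm h4 h1)⟩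
  · rintro ⟨i, rfl | rfl⟩
    · exact ⟨⟨i, le_rfl, (E.a_lt_b i).le⟩, i - 1, by
        have := E.b_lt_a (i - 1); rw [sub_add_cancel] at this ⊢; exact ⟨this.le, le_rfl⟩⟩
    · exact ⟨⟨i, (E.a_lt_b i).le, le_rfl⟩, i, le_rfl, (E.b_lt_a i).le⟩

/-- Order connected sets of reals lying over `P` are contained in one component. -/
theorem subset_comp {C : Set ℝ} (hC : C.OrdConnected) {i : ℤ} {c : ℝ} (hc : c ∈ C)
    (hci : c ∈ Icc (E.a i) (E.b i)) (h : ∀ t ∈ C, (t : Circ) ∈ P) : C ⊆ Icc (E.a i) (E.b i) := by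
  intro d hd
  obtain ⟨j, h1, h2⟩ := (E.mem_iff d).1 (h d hd)
  rcases lt_trichotomy i j with hij | rfl | hij
  · exfalso
    obtain ⟨s, hs1, hs2⟩ := exists_between (E.b_lt_a i)
    have := E.a_strictMono.monotone (show i + 1 ≤ j by omega)
    exact E.gap_notMem hs1 hs2 (h s (hC.out hc hd ⟨by linarith [hci.2], by linarith⟩))
  · exact ⟨h1, h2⟩
  · exfalso
    obtain ⟨s, hs1, hs2⟩ := exists_between (E.b_lt_a j)
    have := E.a_strictMono.monotone (show j + 1 ≤ i by omega)
    exact E.gap_notMem hs1 hs2 (h s (hC.out hd hc ⟨by linarith, by linarith [hci.1]⟩))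

theorem coe_mem_interior_iff (t : ℝ) :
    (t : Circ) ∈ interior P ↔ ∃ i, E.a i < t ∧ t < E.b i := by
  constructor
  · intro h
    obtain ⟨i, h1, h2⟩ := (E.mem_iff t).1 (interior_subset h)
    have hopen : IsOpen (((↑) : ℝ → Circ) ⁻¹' interior P) :=
      isOpen_interior.preimage continuous_coe
    obtain ⟨ε, hε, hball⟩ := Metric.isOpen_iff.1 hopen t h
    have hC : (Ioo (t - ε) (t + ε)) ⊆ Icc (E.a i) (E.b i) := by
      refine E.subset_comp ordConnected_Ioo (c := t) ⟨by linarith, by linarith⟩ ⟨h1, h2⟩ ?_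
      intro s hs
      exact interior_subset (hball (by rw [Real.ball_eq_Ioo]; exact hs))
    have h3 := (hC (⟨by linarith, by linarith⟩ : t - ε / 2 ∈ Ioo _ _)).1
    have h4 := (hC (⟨by linarith, by linarith⟩ : t + ε / 2 ∈ Ioo _ _)).2
    exact ⟨i, by linarith, by linarith⟩
  · rintro ⟨i, h1, h2⟩
    have : ((↑) : ℝ → Circ) '' Ioo (E.a i) (E.b i) ⊆ interior P := by
      refine interior_maximal ?_ (isOpenMap_coe _ isOpen_Ioo)
      rintro _ ⟨s, hs, rfl⟩
      exact (E.mem_iff s).2 ⟨i, hs.1.le, hs.2.le⟩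
    exact this ⟨t, ⟨h1, h2⟩, rfl⟩

end Enum

end

section

/-- The empty partition must be excluded: for `P = ∅` the whole circle is a gap, and no edge leaves
it since there is no component to its right. This contradicts purity. -/
theorem IsPureBP.exists_enum {Γ : Type*} [Group Γ] {S : Set Γ} {φ : Γ →* HomeoPlus} {P : Set Circ}
    (h : IsPureBP S φ P) : Nonempty (Enum P) := by
  obtain ⟨F, hF, harc, hd, hP⟩ := h.finite_union
  rcases F.eq_empty_or_nonempty with rfl | hne
  · exfalso
    have hP' : P = ∅ := by simpa using hP
    subst hP'
    have h0 : (0 : Circ) ∈ sharp (∅ : Set Circ) :=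
      ⟨_, ⟨_, ⟨0, by simp, rfl⟩, rfl⟩, subset_closure (mem_connectedComponentIn (by simp))⟩
    obtain ⟨e, ⟨-, -, I, ⟨x, hx, -⟩, -⟩, -⟩ := h.out_edge _ ⟨0, h0, rfl⟩
    exact hx
  · exact BasicPartition.exists_enum hF hne harc hd hP

/-! ### Action of the generators on the components and the gaps -/

section Generators

variable {Γ : Type*} [Group Γ] {S : Set Γ} {φ : Γ →* HomeoPlus} {P : Set Circ}
  (h : IsPureBP S φ P) (E : Enum P)

include h in
theorem existsUnique_label (i : ℤ) : ∃! s, s ∈ S ∧ Expands P (φ s) (E.comp i) :=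
  h.expand _ ((E.isComponent_iff _).2 ⟨i, rfl⟩)

/-- The generator expanding the component with number `i`. -/
def label (i : ℤ) : Γ := (existsUnique_label h E i).choose

theorem label_mem (i : ℤ) : label h E i ∈ S := (existsUnique_label h E i).choose_spec.1.1

theorem label_expands (i : ℤ) : Expands P (φ (label h E i)) (E.comp i) :=
  (existsUnique_label h E i).choose_spec.1.2

theorem eq_label {i : ℤ} {s : Γ} (hs : s ∈ S) (hx : Expands P (φ s) (E.comp i)) :
    s = label h E i :=
  (existsUnique_label h E i).choose_spec.2 s ⟨hs, hx⟩

theorem label_add (i m : ℤ) : label h E (i + E.N * m) = label h E i := by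
  refine eq_label h E (label_mem h E _) ?_
  have := label_expands h E (i + E.N * m)
  rwa [E.comp_add] at this

include h in
-- A connected set of reals over one gap, or over the interior of `P`, stays in one lifted interval;
-- in the first case equality of the arcs on the circle then forces equality of the end points.
theorem lift_gap {s : Γ} (hs : s ∈ S) {F : ℝ ≃o ℝ} (hF : IsLift F (φ s)) (i : ℤ) :
    (∃ j, F (E.b i) = E.b j ∧ F (E.a (i + 1)) = E.a (j + 1)) ∨
      ∃ j, E.a j < F (E.b i) ∧ F (E.a (i + 1)) < E.b j := by
  have himg : φ s '' E.gap i = ((↑) : ℝ → Circ) '' Icc (F (E.b i)) (F (E.a (i + 1))) := by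
    rw [Enum.gap, hF.image, F.image_Icc]
  have hlt : F (E.b i) < F (E.a (i + 1)) := F.strictMono (E.b_lt_a i)
  have hlen : F (E.a (i + 1)) < F (E.b i) + 1 := by
    rw [← hF.add_one]; exact F.strictMono (E.a_succ_lt i)
  rcases h.gap _ ((E.isComponent_sharp_iff _).2 ⟨i, rfl⟩) s hs with h1 | h1
  · left
    obtain ⟨j, hj⟩ := (E.isComponent_sharp_iff _).1 h1
    rw [himg] at hj
    have hm : ((F (E.b i) : ℝ) : Circ) ∈ E.gap j := by
      rw [← hj]; exact ⟨_, ⟨le_rfl, hlt.le⟩, rfl⟩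
    obtain ⟨n, hn⟩ := coe_mem_image.1 hm
    refine ⟨j + E.N * (-n), ?_⟩
    have ea : E.a (j + E.N * (-n) + 1) = E.a (j + 1) - n := by
      rw [show j + E.N * (-n) + 1 = j + 1 + E.N * (-n) by ring, E.a_add_mul]; push_cast; ring
    have eb : E.b (j + E.N * (-n)) = E.b j - n := by rw [E.b_add_mul]; push_cast; ring
    set m := j + E.N * (-n)
    have hj' : ((↑) : ℝ → Circ) '' Icc (F (E.b i)) (F (E.a (i + 1))) = E.gap m := by
      rw [hj, E.gap_add]
    have hsub : Icc (F (E.b i)) (F (E.a (i + 1))) ⊆ Icc (E.b m) (E.a (m + 1)) := by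
      refine subset_Icc_of_coe ordConnected_Icc (E.a_succ_lt m) (c := F (E.b i))
        ⟨le_rfl, hlt.le⟩ ⟨by linarith [hn.1], by linarith [hn.2]⟩ ?_
      intro t ht
      change (t : Circ) ∈ E.gap m
      rw [← hj']; exact ⟨t, ht, rfl⟩
    have h2 : E.b m ∈ Icc (F (E.b i)) (F (E.a (i + 1))) ∧
        E.a (m + 1) ∈ Icc (F (E.b i)) (F (E.a (i + 1))) := by
      have key : ∀ t ∈ Icc (E.b m) (E.a (m + 1)), t ∈ Icc (F (E.b i)) (F (E.a (i + 1))) := by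
        intro t ht
        have : (t : Circ) ∈ E.gap m := ⟨t, ht, rfl⟩
        rw [← hj'] at this
        obtain ⟨t', ht', he⟩ := this
        rwa [← coe_injOn (E.a_succ_lt m) (hsub ht') ht he]
      exact ⟨key _ ⟨le_rfl, (E.b_lt_a m).le⟩, key _ ⟨(E.b_lt_a m).le, le_rfl⟩⟩
    have h3 := hsub ⟨le_rfl, hlt.le⟩
    have h4 := hsub ⟨hlt.le, le_rfl⟩
    exact ⟨le_antisymm h2.1.1 h3.1, le_antisymm h4.2 h2.2.2⟩
  · right
    rw [himg] at h1
    have hint : ∀ t ∈ Icc (F (E.b i)) (F (E.a (i + 1))), ∃ j, E.a j < t ∧ t < E.b j :=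
      fun t ht => (E.coe_mem_interior_iff t).1 (h1 ⟨t, ht, rfl⟩)
    obtain ⟨j, hj1, hj2⟩ := hint _ ⟨le_rfl, hlt.le⟩
    have hsub : Icc (F (E.b i)) (F (E.a (i + 1))) ⊆ Icc (E.a j) (E.b j) := by
      refine E.subset_comp ordConnected_Icc (c := F (E.b i)) ⟨le_rfl, hlt.le⟩ ⟨hj1.le, hj2.le⟩ ?_
      intro t ht
      exact interior_subset (h1 ⟨t, ht, rfl⟩)
    refine ⟨j, hj1, ?_⟩
    obtain ⟨m, hm1, hm2⟩ := hint _ ⟨hlt.le, le_rfl⟩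
    have h5 := hsub ⟨hlt.le, le_rfl⟩
    have h6 := E.le_of_a_le_b (hm1.le.trans h5.2)
    have h7 := E.le_of_a_le_b (h5.1.trans hm2.le)
    have : m = j := le_antisymm h6 h7
    rwa [this] at hm2

theorem lift_comp' {s : Γ} (hs : s ∈ S) {F : ℝ ≃o ℝ} (hF : IsLift F (φ s)) {i : ℤ}
    (hi : s ≠ label h E i) :
    ∃ j, E.a j ≤ F (E.a i) ∧ F (E.b i) ≤ E.b j ∧ (E.a j < F (E.a i) ∨ F (E.b i) < E.b j) := by
  have hnot : ¬ Expands P (φ s) (E.comp i) := fun hx => hi (eq_label h E hs hx)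
  obtain ⟨I', hI', hsub⟩ := h.contract _ ((E.isComponent_iff _).2 ⟨i, rfl⟩) s hs hnot
  obtain ⟨j, rfl⟩ := (E.isComponent_iff _).1 hI'
  have himg : φ s '' E.comp i = ((↑) : ℝ → Circ) '' Icc (F (E.a i)) (F (E.b i)) := by
    rw [Enum.comp, hF.image, F.image_Icc]
  rw [himg] at hsub
  have hlt : F (E.a i) < F (E.b i) := F.strictMono (E.a_lt_b i)
  have hm : ((F (E.a i) : ℝ) : Circ) ∈ E.comp j := hsub.1 ⟨_, ⟨le_rfl, hlt.le⟩, rfl⟩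
  obtain ⟨n, hn⟩ := coe_mem_image.1 hm
  have ea : E.a (j + E.N * (-n)) = E.a j - n := by rw [E.a_add_mul]; push_cast; ring
  have eb : E.b (j + E.N * (-n)) = E.b j - n := by rw [E.b_add_mul]; push_cast; ring
  refine ⟨j + E.N * (-n), ?_⟩
  rw [← E.comp_add j (-n)] at hsub
  set m := j + E.N * (-n)
  have hsub' : Icc (F (E.a i)) (F (E.b i)) ⊆ Icc (E.a m) (E.b m) := by
    refine subset_Icc_of_coe ordConnected_Icc (E.b_lt m) (c := F (E.a i))
        ⟨le_rfl, hlt.le⟩ ⟨by linarith [hn.1], by linarith [hn.2]⟩ ?_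
    intro t ht
    exact hsub.1 ⟨t, ht, rfl⟩
  have h1 := (hsub' ⟨le_rfl, hlt.le⟩).1
  have h2 := (hsub' ⟨hlt.le, le_rfl⟩).2
  refine ⟨h1, h2, ?_⟩
  by_contra hcon
  rw [not_or, not_lt, not_lt] at hcon
  refine hsub.2 ?_
  rw [le_antisymm hcon.1 h1, le_antisymm h2 hcon.2]
  exact Subset.rfl

variable (hS : ∀ s ∈ S, s⁻¹ ∈ S)

include hS in
-- If `s⁻¹` did not expand the component `j`, it would map it into a single component, necessarily
-- `i`; this contradicts the strictness of the inclusion of the image of `i` in `j`.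
theorem lift_comp {s : Γ} (hs : s ∈ S) {F : ℝ ≃o ℝ} (hF : IsLift F (φ s)) {i : ℤ}
    (hi : s ≠ label h E i) :
    ∃ j, label h E j = s⁻¹ ∧ E.a j ≤ F (E.a i) ∧ F (E.b i) ≤ E.b j ∧
      (E.a j < F (E.a i) ∨ F (E.b i) < E.b j) := by
  obtain ⟨j, h1, h2, h3⟩ := lift_comp' h E hs hF hi
  refine ⟨j, ?_, h1, h2, h3⟩
  by_contra hcon
  have hF' : IsLift F⁻¹ (φ s⁻¹) := by rw [map_inv]; exact hF.inv
  obtain ⟨m, h4, h5, h6⟩ := lift_comp' h E (hS s hs) hF' (Ne.symm hcon)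
  have e1 : F⁻¹ (E.a j) ≤ E.a i := by
    have := (F⁻¹).monotone h1; rwa [RelIso.inv_apply_self] at this
  have e2 : E.b i ≤ F⁻¹ (E.b j) := by
    have := (F⁻¹).monotone h2; rwa [RelIso.inv_apply_self] at this
  have := E.le_of_a_le_b (i := m) (j := i) (by have := E.a_lt_b i; linarith)
  have := E.le_of_a_le_b (i := i) (j := m) (by have := E.a_lt_b i; linarith)
  have hmi : m = i := by omega
  subst hmi
  rcases h3 with h3 | h3
  · have := (F⁻¹).strictMono h3; rw [RelIso.inv_apply_self] at this; linarith
  · have := (F⁻¹).strictMono h3; rw [RelIso.inv_apply_self] at this; linarith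

include hS in
-- If `s⁻¹` did not expand the component `j`, it would map it into a single component, yet the image
-- of `j` under `F⁻¹` contains a whole gap.
theorem lift_gap_label {s : Γ} (hs : s ∈ S) {F : ℝ ≃o ℝ} (hF : IsLift F (φ s)) (i : ℤ) :
    (∃ j, F (E.b i) = E.b j ∧ F (E.a (i + 1)) = E.a (j + 1)) ∨
      ∃ j, label h E j = s⁻¹ ∧ E.a j < F (E.b i) ∧ F (E.a (i + 1)) < E.b j := by
  rcases lift_gap h E hs hF i with h1 | ⟨j, h1, h2⟩
  · exact Or.inl h1
  · right
    refine ⟨j, ?_, h1, h2⟩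
    by_contra hcon
    have hF' : IsLift F⁻¹ (φ s⁻¹) := by rw [map_inv]; exact hF.inv
    obtain ⟨m, h4, h5, -⟩ := lift_comp' h E (hS s hs) hF' (Ne.symm hcon)
    have e1 := (F⁻¹).strictMono h1
    have e2 := (F⁻¹).strictMono h2
    rw [RelIso.inv_apply_self] at e1 e2
    have e3 := E.b_lt_a i
    have := E.a_strictMono.lt_iff_lt.1 (show E.a m < E.a (i + 1) by linarith)
    have := E.b_strictMono.lt_iff_lt.1 (show E.b i < E.b m by linarith)
    omega

/-- Each gap adjacent to the component `i` goes either to a gap, as wanted, or into the interior of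
a component `n`. In the latter case the image of `i` ends inside `n`; being a union of whole
components and gaps it contains all of `n`, in particular points beyond its own end, which is
impossible for an arc shorter than a period. Finally `j ≠ j'`, since at least two distinct
components occur. -/
theorem lift_expand_ends {F : ℝ ≃o ℝ} {i : ℤ} (hF : IsLift F (φ (label h E i))) :
    ∃ j j', j < j' ∧ F (E.a i) = E.a j ∧ F (E.b i) = E.b j' := by
  obtain ⟨m, A, B, hA, -, hAc, hBc, himg⟩ := label_expands h E i
  have himg' : φ (label h E i) '' E.comp i =
      ((↑) : ℝ → Circ) '' Icc (F (E.a i)) (F (E.b i)) := by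
    rw [Enum.comp, hF.image, F.image_Icc]
  rw [himg'] at himg
  have hlt : F (E.a i) < F (E.b i) := F.strictMono (E.a_lt_b i)
  have hlen : F (E.b i) < F (E.a i) + 1 := by
    rw [← hF.add_one]; exact F.strictMono (E.b_lt i)
  have hcompsub : ∀ t ∈ Icc (F (E.a i)) (F (E.b i)), ∀ n, E.a n < t → t < E.b n →
      E.comp n ⊆ ((↑) : ℝ → Circ) '' Icc (F (E.a i)) (F (E.b i)) := by
    intro t ht n h1 h2
    have ht' : (t : Circ) ∈ ((↑) : ℝ → Circ) '' Icc (F (E.a i)) (F (E.b i)) := ⟨t, ht, rfl⟩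
    have hmem : (t : Circ) ∈ E.comp n := ⟨t, ⟨h1.le, h2.le⟩, rfl⟩
    rw [himg] at ht'
    rcases ht' with ht' | ht'
    · obtain ⟨r, hr⟩ := mem_iUnion.1 ht'
      obtain ⟨p, hp⟩ := (E.isComponent_iff _).1 (hAc r)
      rw [hp] at hr
      obtain ⟨q, hq⟩ := E.comp_eq_of_mem hr hmem
      rw [himg, hq, E.comp_add, ← hp]
      exact (subset_iUnion A r).trans subset_union_left
    · obtain ⟨r, hr⟩ := mem_iUnion.1 ht'
      have : (t : Circ) ∈ sharp P := by
        obtain ⟨p, hp⟩ := (E.isComponent_sharp_iff _).1 (hBc r)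
        rw [E.sharp_eq]
        exact ⟨_, ⟨p, rfl⟩, hp ▸ hr⟩
      obtain ⟨p, h3, h4⟩ := (E.mem_sharp_iff t).1 this
      have := E.a_strictMono.lt_iff_lt.1 (h1.trans_le h4)
      have := E.b_strictMono.lt_iff_lt.1 (h3.trans_lt h2)
      omega
  have hleft : ∃ j, F (E.a i) = E.a j := by
    have hg := lift_gap h E (label_mem h E i) hF (i - 1)
    rw [sub_add_cancel] at hg
    rcases hg with ⟨j, -, hj⟩ | ⟨n, hn1, hn2⟩
    · exact ⟨_, hj⟩
    · exfalso
      have hbi : F (E.b (i - 1)) < F (E.a i) := by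
        apply F.strictMono; have := E.b_lt_a (i - 1); rwa [sub_add_cancel] at this
      obtain ⟨t, ht1, ht2⟩ := exists_between (max_lt (hn1.trans hbi)
        (by linarith : F (E.b i) - 1 < F (E.a i)))
      rw [max_lt_iff] at ht1
      have : (t : Circ) ∈ E.comp n := ⟨t, ⟨ht1.1.le, by linarith⟩, rfl⟩
      obtain ⟨q, hq1, hq2⟩ := coe_mem_image.1
        (hcompsub _ ⟨le_rfl, hlt.le⟩ n (hn1.trans hbi) hn2 this)
      have : q = 0 := int_eq_zero_of_abs_lt (by linarith) (by linarith)
      subst this; simp at hq1; linarith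
  have hright : ∃ j, F (E.b i) = E.b j := by
    rcases lift_gap h E (label_mem h E i) hF i with ⟨j, hj, -⟩ | ⟨n, hn1, hn2⟩
    · exact ⟨_, hj⟩
    · exfalso
      have hbi : F (E.b i) < F (E.a (i + 1)) := F.strictMono (E.b_lt_a i)
      obtain ⟨t, ht1, ht2⟩ := exists_between (lt_min (hbi.trans hn2)
        (by linarith : F (E.b i) < F (E.a i) + 1))
      rw [lt_min_iff] at ht2
      have : (t : Circ) ∈ E.comp n := ⟨t, ⟨by linarith, ht2.1.le⟩, rfl⟩
      obtain ⟨q, hq1, hq2⟩ := coe_mem_image.1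
        (hcompsub _ ⟨hlt.le, le_rfl⟩ n hn1 (hbi.trans hn2) this)
      have : q = 0 := int_eq_zero_of_abs_lt (by linarith) (by linarith)
      subst this; simp at hq2; linarith
  obtain ⟨j, hj⟩ := hleft
  obtain ⟨j', hj'⟩ := hright
  have hle : j ≤ j' := E.le_of_a_le_b (by rw [← hj, ← hj']; exact hlt.le)
  refine ⟨j, j', lt_of_le_of_ne hle ?_, hj, hj'⟩
  rintro rfl
  rw [hj, hj'] at himg
  have key : ∀ r, A r = E.comp j := by
    intro r
    obtain ⟨p, hp⟩ := (E.isComponent_iff _).1 (hAc r)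
    have hmem : (E.a p : Circ) ∈ A r := by rw [hp]; exact ⟨_, ⟨le_rfl, (E.a_lt_b p).le⟩, rfl⟩
    have : (E.a p : Circ) ∈ E.comp j := by
      rw [Enum.comp, himg]; exact Or.inl (mem_iUnion.2 ⟨r, hmem⟩)
    rw [hp] at hmem
    obtain ⟨q, hq⟩ := E.comp_eq_of_mem hmem this
    rw [hp, hq, E.comp_add]
  have := hA ((key 0).trans (key 1).symm)
  simp at this

/-- If a component `m` in the image of `i` had the inverse label, then `F⁻¹` would map `m` onto an
interval containing at least two components and lying in the component `i`. -/
theorem lift_expand {F : ℝ ≃o ℝ} {i : ℤ} (hF : IsLift F (φ (label h E i))) :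
    ∃ j j', j < j' ∧ F (E.a i) = E.a j ∧ F (E.b i) = E.b j' ∧
      ∀ m, j ≤ m → m ≤ j' → label h E m ≠ (label h E i)⁻¹ := by
  obtain ⟨j, j', h1, h2, h3⟩ := lift_expand_ends h E hF
  refine ⟨j, j', h1, h2, h3, ?_⟩
  intro m hm1 hm2 hcon
  have hF' : IsLift F⁻¹ (φ (label h E m)) := by rw [hcon, map_inv]; exact hF.inv
  obtain ⟨p, p', h4, h5, h6⟩ := lift_expand_ends h E hF'
  have e1 : E.a i ≤ E.a p := by
    rw [← h5, ← RelIso.inv_apply_self F (E.a i), h2]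
    exact (F⁻¹).monotone (E.a_strictMono.monotone hm1)
  have e2 : E.b p' ≤ E.b i := by
    rw [← h6, ← RelIso.inv_apply_self F (E.b i), h3]
    exact (F⁻¹).monotone (E.b_strictMono.monotone hm2)
  have := E.a_strictMono.le_iff_le.1 e1
  have := E.b_strictMono.le_iff_le.1 e2
  omega

/-- If `s` expanded every component, its lift would advance the number by at least two for each
component, contrary to degree one: over a period of `N` components it advances by exactly `N`. -/
theorem exists_label_ne (s : Γ) : ∃ i, label h E i ≠ s := by
  by_contra hcon
  push Not at hcon
  obtain ⟨F, hF⟩ := exists_isLift (φ s)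
  have key : ∀ i, ∃ j, F (E.a i) = E.a j ∧ E.a (j + 1) < F (E.a (i + 1)) := by
    intro i
    obtain ⟨j, j', h1, h2, h3⟩ := lift_expand_ends h E (i := i) (by rw [hcon]; exact hF)
    refine ⟨j, h2, ?_⟩
    have h4 : F (E.b i) < F (E.a (i + 1)) := F.strictMono (E.b_lt_a i)
    rw [h3] at h4
    exact ((E.a_strictMono.monotone (show j + 1 ≤ j' by omega)).trans_lt (E.a_lt_b j')).trans h4
  choose g hg1 hg2 using key
  have hstep : ∀ i, g i + 2 ≤ g (i + 1) := by
    intro i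
    have := hg2 i
    rw [hg1 (i + 1)] at this
    have := E.a_strictMono.lt_iff_lt.1 this
    omega
  have hn : ∀ n : ℕ, g 0 + 2 * n ≤ g n := by
    intro n
    induction n with
    | zero => simp
    | succ n ih => have := hstep n; push_cast; linarith
  have h1 := hn E.N
  have h2 : g (0 + E.N) = g 0 + E.N := by
    apply E.a_strictMono.injective
    rw [← hg1, E.a_add, E.a_add, hF.add_one, hg1]
  rw [zero_add] at h2
  have := E.N_pos
  omega

end Generators

end

section

/-! ### Symbolic dynamics of gaps -/

/-- Words in the letters `S` without cancellation. -/
def Reduced {Γ : Type*} [Group Γ] (S : Set Γ) (l : List Γ) : Prop :=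
  (∀ s ∈ l, s ∈ S) ∧ l.IsChain fun x y => x * y ≠ 1

theorem Reduced.tail {Γ : Type*} [Group Γ] {S : Set Γ} {s : Γ} {l : List Γ}
    (h : Reduced S (s :: l)) : Reduced S l :=
  ⟨fun x hx => h.1 x (List.mem_cons_of_mem _ hx), h.2.tail⟩

theorem Reduced.inv {Γ : Type*} [Group Γ] {S : Set Γ} (hS : ∀ s ∈ S, s⁻¹ ∈ S) {l : List Γ}
    (h : Reduced S l) : Reduced S (l.map (·⁻¹)).reverse := by
  refine ⟨?_, ?_⟩
  · intro s hs
    rw [List.mem_reverse, List.mem_map] at hs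
    obtain ⟨t, ht, rfl⟩ := hs
    exact hS t (h.1 t ht)
  · rw [List.isChain_reverse, List.isChain_map]
    refine h.2.imp ?_
    intro a b hab hcon
    exact hab (by rw [← inv_inj, mul_inv_rev, hcon, inv_one])

theorem exists_reduced {Γ : Type*} [Group Γ] {S : Set Γ} (hS : ∀ s ∈ S, s⁻¹ ∈ S)
    (hgen : Subgroup.closure S = ⊤) (γ : Γ) : ∃ l, Reduced S l ∧ l.prod = γ := by
  have step : ∀ s ∈ S, ∀ γ, (∃ l, Reduced S l ∧ l.prod = γ) →
      ∃ l, Reduced S l ∧ l.prod = s * γ := by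
    rintro s hs γ ⟨l, hl, rfl⟩
    rcases l with _ | ⟨t, l⟩
    · exact ⟨[s], ⟨by simpa using hs, by simp⟩, by simp⟩
    · by_cases hst : s * t = 1
      · exact ⟨l, hl.tail, by rw [List.prod_cons, ← mul_assoc, hst, one_mul]⟩
      · refine ⟨s :: t :: l, ⟨?_, ?_⟩, by simp⟩
        · intro x hx
          rcases List.mem_cons.1 hx with rfl | hx
          · exact hs
          · exact hl.1 x hx
        · exact List.isChain_cons_cons.2 ⟨hst, hl.2⟩
  have hγ : γ ∈ Subgroup.closure S := by rw [hgen]; trivial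
  induction hγ using Subgroup.closure_induction_left with
  | one => exact ⟨[], ⟨by simp, by simp⟩, rfl⟩
  | mul_left x hx y hy ih => exact step x hx y ih
  | inv_mul_cancel x hx y hy ih => exact step _ (hS x hx) y ih

/-- An action of a group coded by reduced words: `gaps` is a finite set of intervals permuted by
the first-return letters `o`, and `R K t` says that `K` is contained in the region expanded by the
letter `t`. -/
structure Coding (Γ Ω : Type*) [Group Γ] where
  S : Set Γ
  act : Γ → Ω → Ω
  gaps : Set Ω
  R : Ω → Γ → Prop
  o : Ω → Γ
  symm : ∀ s ∈ S, s⁻¹ ∈ S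
  gen : Subgroup.closure S = ⊤
  act_one : ∀ K, act 1 K = K
  act_mul : ∀ g h K, act (g * h) K = act g (act h K)
  finite : gaps.Finite
  step_gap : ∀ J ∈ gaps, ∀ s ∈ S, act s J ∈ gaps ∨ R (act s J) s⁻¹
  step_region : ∀ K t, R K t → ∀ s ∈ S, s ≠ t → R (act s K) s⁻¹
  notMem : ∀ K t, R K t → K ∉ gaps
  o_mem : ∀ J ∈ gaps, o J ∈ S
  o_gap : ∀ J ∈ gaps, act (o J) J ∈ gaps
  eq_o : ∀ J ∈ gaps, ∀ s ∈ S, act s J ∈ gaps → s = o J ∨ o (act s J) = s⁻¹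
  o_inj : ∀ J ∈ gaps, ∀ J' ∈ gaps, act (o J) J = act (o J') J' → J = J'
  o_next : ∀ J ∈ gaps, o (act (o J) J) * o J ≠ 1
  free : ∀ l, Reduced S l → l ≠ [] → l.prod ≠ 1

namespace Coding

variable {Γ Ω : Type*} [Group Γ] (D : Coding Γ Ω)

theorem act_inv_act (g : Γ) (K : Ω) : D.act g⁻¹ (D.act g K) = K := by
  rw [← D.act_mul, inv_mul_cancel, D.act_one]

theorem act_act_inv (g : Γ) (K : Ω) : D.act g (D.act g⁻¹ K) = K := by
  rw [← D.act_mul, mul_inv_cancel, D.act_one]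

/-! ### Itineraries of gaps -/

/-- The map of gaps defined by their letters. -/
def T (J : Ω) : Ω := D.act (D.o J) J

/-- The word of the first `n` letters of a gap. -/
def wl : ℕ → Ω → List Γ
  | 0, _ => []
  | n + 1, J => D.o (D.T^[n] J) :: wl n J

/-- The product of the first `n` letters of a gap. -/
def w (n : ℕ) (J : Ω) : Γ := (D.wl n J).prod

theorem w_zero (J : Ω) : D.w 0 J = 1 := rfl

theorem w_succ (n : ℕ) (J : Ω) : D.w (n + 1) J = D.o (D.T^[n] J) * D.w n J := by
  simp [w, wl]

theorem w_add (m n : ℕ) (J : Ω) : D.w (m + n) J = D.w m (D.T^[n] J) * D.w n J := by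
  induction m with
  | zero => simp [w_zero]
  | succ m ih =>
    rw [show m + 1 + n = m + n + 1 by ring, w_succ, ih, w_succ, mul_assoc,
      Function.iterate_add_apply]

theorem act_w (n : ℕ) (J : Ω) : D.act (D.w n J) J = D.T^[n] J := by
  induction n with
  | zero => simp [w_zero, D.act_one]
  | succ n ih => rw [w_succ, D.act_mul, ih, Function.iterate_succ_apply']; rfl

theorem T_mem {J : Ω} (hJ : J ∈ D.gaps) (n : ℕ) : D.T^[n] J ∈ D.gaps := by
  induction n with
  | zero => exact hJ
  | succ n ih => rw [Function.iterate_succ_apply']; exact D.o_gap _ ih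

theorem T_inj {J J' : Ω} (hJ : J ∈ D.gaps) (hJ' : J' ∈ D.gaps) (n : ℕ)
    (h : D.T^[n] J = D.T^[n] J') : J = J' := by
  induction n with
  | zero => exact h
  | succ n ih =>
    rw [Function.iterate_succ_apply', Function.iterate_succ_apply'] at h
    exact ih (D.o_inj _ (D.T_mem hJ n) _ (D.T_mem hJ' n) h)

theorem length_wl (n : ℕ) (J : Ω) : (D.wl n J).length = n := by
  induction n with
  | zero => rfl
  | succ n ih => simp [wl, ih]

theorem reduced_wl {J : Ω} (hJ : J ∈ D.gaps) (n : ℕ) : Reduced D.S (D.wl n J) := by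
  induction n with
  | zero => exact ⟨by simp [wl], by simp [wl]⟩
  | succ n ih =>
    refine ⟨?_, ?_⟩
    · intro s hs
      rcases List.mem_cons.1 hs with rfl | hs
      · exact D.o_mem _ (D.T_mem hJ n)
      · exact ih.1 s hs
    · cases n with
      | zero => simp [wl]
      | succ n =>
        refine List.isChain_cons_cons.2 ⟨?_, ih.2⟩
        rw [Function.iterate_succ_apply']
        exact D.o_next _ (D.T_mem hJ n)

theorem w_ne_one {J : Ω} (hJ : J ∈ D.gaps) {n : ℕ} (hn : n ≠ 0) : D.w n J ≠ 1 := by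
  refine D.free _ (D.reduced_wl hJ n) fun h => hn ?_
  rw [← D.length_wl n J, h]; rfl

/-- After removal of the common first letters, the inverse of one word followed by the other is a
nonempty reduced word, to which `free` applies. -/
theorem reduced_unique {l l' : List Γ} (hl : Reduced D.S l) (hl' : Reduced D.S l')
    (h : l.prod = l'.prod) : l = l' := by
  induction l generalizing l' with
  | nil =>
    by_contra hne
    exact D.free l' hl' (Ne.symm hne) h.symm
  | cons s l ih =>
    rcases l' with _ | ⟨t, l'⟩
    · exact absurd h (D.free _ hl (by simp))
    · by_cases hst : s = t
      · subst hst
        rw [ih hl.tail hl'.tail (by simpa using h)]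
      · exfalso
        have hr : Reduced D.S (((t :: l').map (·⁻¹)).reverse ++ s :: l) := by
          refine ⟨?_, ?_⟩
          · intro x hx
            rcases List.mem_append.1 hx with hx | hx
            · exact (hl'.inv D.symm).1 x hx
            · exact hl.1 x hx
          · rw [List.isChain_append]
            refine ⟨(hl'.inv D.symm).2, hl.2, ?_⟩
            intro x hx y hy
            simp at hx hy
            subst hx hy
            intro hcon
            exact hst (by rw [inv_mul_eq_one] at hcon; exact hcon.symm)
        refine D.free _ hr (by simp) ?_
        rw [List.prod_append, ← List.prod_inv_reverse, h, inv_mul_cancel]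

theorem w_injective {J J' : Ω} (hJ : J ∈ D.gaps) (hJ' : J' ∈ D.gaps) {n n' : ℕ}
    (h : D.w n J = D.w n' J') : n = n' := by
  have := congrArg List.length (D.reduced_unique (D.reduced_wl hJ n) (D.reduced_wl hJ' n') h)
  rwa [length_wl, length_wl] at this

theorem w_inv_injective {J J' : Ω} (hJ : J ∈ D.gaps) (hJ' : J' ∈ D.gaps) {n n' : ℕ}
    (h : (D.w n J)⁻¹ = D.w n' J') : n = n' := by
  rw [w, List.prod_inv_reverse] at h
  have := congrArg List.length
    (D.reduced_unique ((D.reduced_wl hJ n).inv D.symm) (D.reduced_wl hJ' n') h)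
  simpa [length_wl] using this

/-- Ping-pong: once a gap has entered a region, every further letter of a reduced word differs from
the letter expanding that region, so the image moves on to the region of the inverse of the new
letter. -/
theorem position {l : List Γ} (hl : Reduced D.S l) {J : Ω} (hJ : J ∈ D.gaps) :
    D.act l.prod J ∈ D.gaps ∨ ∃ s l', l = s :: l' ∧ D.R (D.act l.prod J) s⁻¹ := by
  induction l with
  | nil => left; simpa [D.act_one] using hJ
  | cons s l ih =>
    have hs : s ∈ D.S := hl.1 s (by simp)
    rw [List.prod_cons, D.act_mul]
    rcases ih hl.tail with h | ⟨t, l', rfl, h⟩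
    · rcases D.step_gap _ h s hs with h' | h'
      · exact Or.inl h'
      · exact Or.inr ⟨s, l, rfl, h'⟩
    · refine Or.inr ⟨s, _, rfl, D.step_region _ _ h s hs ?_⟩
      have := (List.isChain_cons_cons.1 hl.2).1
      intro hcon
      exact this (by rw [hcon, inv_mul_cancel])

theorem position' (g : Γ) {J : Ω} (hJ : J ∈ D.gaps) :
    D.act g J ∈ D.gaps ∨ ∃ t, D.R (D.act g J) t := by
  obtain ⟨l, hl, rfl⟩ := exists_reduced D.symm D.gen g
  rcases D.position hl hJ with h | ⟨s, l', -, h⟩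
  · exact Or.inl h
  · exact Or.inr ⟨_, h⟩

/-- All intermediate images are gaps, since regions are never left. The path of gaps follows `T`
either always forward or always backward: a turn from backward to forward cancels at once, and a
turn from forward to backward cancels because `T` is injective on gaps. -/
theorem path_list {l : List Γ} (hl : Reduced D.S l) {J : Ω} (hJ : J ∈ D.gaps)
    (hlJ : D.act l.prod J ∈ D.gaps) :
    l = D.wl l.length J ∨ (l.prod⁻¹ = D.w l.length (D.act l.prod J) ∧
      ∃ s l', l = s :: l' ∧ D.o (D.act l.prod J) = s⁻¹) := by
  induction l with
  | nil => left; rfl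
  | cons s l ih =>
    have hs : s ∈ D.S := hl.1 s (by simp)
    have hprev : D.act l.prod J ∈ D.gaps := by
      rcases D.position hl.tail hJ with h | ⟨t, l', rfl, h⟩
      · exact h
      · exfalso
        rw [List.prod_cons (a := s), D.act_mul] at hlJ
        refine D.notMem _ _ (D.step_region _ _ h s hs ?_) hlJ
        have := (List.isChain_cons_cons.1 hl.2).1
        intro hcon
        exact this (by rw [hcon, inv_mul_cancel])
    have hlJ' : D.act s (D.act l.prod J) ∈ D.gaps := by
      rwa [List.prod_cons, D.act_mul] at hlJ
    have hbwd : D.o (D.act s (D.act l.prod J)) = s⁻¹ →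
        D.T (D.act s (D.act l.prod J)) = D.act l.prod J := by
      intro h; rw [T, h, D.act_inv_act]
    rcases ih hl.tail hprev with h1 | ⟨h1, t, l', rfl, h2⟩
    · have hJ' : D.act l.prod J = D.T^[l.length] J := by
        conv_lhs => rw [h1]
        exact D.act_w _ _
      rcases D.eq_o _ hprev s hs hlJ' with h3 | h3
      · left
        rw [List.length_cons, wl, ← h1, ← hJ', ← h3]
      · rcases l with _ | ⟨t, l⟩
        · right
          refine ⟨?_, s, [], rfl, ?_⟩
          · simp only [List.prod_cons, List.prod_nil, mul_one, List.length_cons,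
              List.length_nil, zero_add, w_succ, w_zero, Function.iterate_zero, id]
            simp only [List.prod_nil, D.act_one] at h3
            exact h3.symm
          · rw [List.prod_cons, D.act_mul]; exact h3
        · exfalso
          have h4 := hbwd h3
          rw [hJ', List.length_cons, Function.iterate_succ_apply'] at h4
          rw [hJ', List.length_cons, Function.iterate_succ_apply'] at hlJ' h3
          have h5 := D.o_inj _ hlJ' _ (D.T_mem hJ l.length) h4
          rw [h5] at h3
          have h6 : t = D.o (D.T^[l.length] J) := by
            rw [List.length_cons, wl] at h1
            exact (List.cons.inj h1).1
          exact (List.isChain_cons_cons.1 hl.2).1 (by rw [h6, h3, mul_inv_cancel])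
    · right
      have hst := (List.isChain_cons_cons.1 hl.2).1
      rcases D.eq_o _ hprev s hs hlJ' with h3 | h3
      · exact absurd (by rw [h3, h2, inv_mul_cancel]) hst
      · refine ⟨?_, s, _, rfl, ?_⟩
        · rw [List.prod_cons (a := s), mul_inv_rev, h1, D.act_mul, List.length_cons (a := s), D.w_add _ 1,
            w_succ, w_zero, mul_one]
          simp only [Function.iterate_one, Function.iterate_zero, id]
          rw [hbwd h3, h3]
        · rw [List.prod_cons (a := s), D.act_mul]; exact h3

theorem path {g : Γ} {J : Ω} (hJ : J ∈ D.gaps) (hg : D.act g J ∈ D.gaps) :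
    ∃ n, g = D.w n J ∨ g⁻¹ = D.w n (D.act g J) := by
  obtain ⟨l, hl, rfl⟩ := exists_reduced D.symm D.gen g
  rcases D.path_list hl hJ hg with h | ⟨h, -⟩
  · exact ⟨l.length, Or.inl (congrArg List.prod h)⟩
  · exact ⟨l.length, Or.inr h⟩

/-! ### Cycles of gaps and their loops -/

theorem exists_period {J : Ω} (hJ : J ∈ D.gaps) : ∃ p, 0 < p ∧ D.T^[p] J = J := by
  have hm : MapsTo (fun n => D.T^[n] J) univ D.gaps := fun n _ => D.T_mem hJ n
  obtain ⟨a, -, b, -, hne, hab⟩ := infinite_univ.exists_ne_map_eq_of_mapsTo hm D.finite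
  wlog hlt : a < b generalizing a b
  · exact this b a hne.symm hab.symm (lt_of_le_of_ne (not_lt.1 hlt) hne.symm)
  refine ⟨b - a, by omega, ?_⟩
  refine D.T_inj (D.T_mem hJ _) hJ a ?_
  rw [← Function.iterate_add_apply, show a + (b - a) = b by omega]
  exact hab.symm

theorem iterate_mul {p : ℕ} {J : Ω} (h : D.T^[p] J = J) (q : ℕ) : D.T^[p * q] J = J := by
  induction q with
  | zero => rfl
  | succ q ih => rw [Nat.mul_succ, Function.iterate_add_apply, h, ih]

theorem w_pow {n : ℕ} {J : Ω} (h : D.T^[n] J = J) (q : ℕ) : D.w n J ^ q = D.w (n * q) J := by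
  induction q with
  | zero => simp [w_zero]
  | succ q ih => rw [Nat.mul_succ, w_add, h, pow_succ, ih]

/-- By `path`, the gaps `J` and `gJ` lie on the same cycle of `T`, so both loops read this cycle,
only from different starting points. -/
theorem conj_loop {J : Ω} (hJ : J ∈ D.gaps) {p : ℕ} (hp : D.T^[p] J = J) {g : Γ}
    (hg : D.act g J ∈ D.gaps) :
    D.T^[p] (D.act g J) = D.act g J ∧ D.w p (D.act g J) = g * D.w p J * g⁻¹ := by
  obtain ⟨n, h | h⟩ := D.path hJ hg
  · have e : D.act g J = D.T^[n] J := by rw [h, act_w]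
    rw [e]
    refine ⟨by rw [← Function.iterate_add_apply, add_comm, Function.iterate_add_apply, hp], ?_⟩
    rw [eq_mul_inv_iff_mul_eq, h, ← w_add, add_comm, w_add, hp]
  · set K := D.act g J with hK
    have e : D.T^[n] K = J := by rw [← act_w, ← h, hK, act_inv_act]
    have hpK : D.T^[p] K = K := by
      refine D.T_inj (D.T_mem hg _) hg n ?_
      rw [← Function.iterate_add_apply, add_comm, Function.iterate_add_apply, e, hp]
    refine ⟨hpK, ?_⟩
    have h1 : D.w p J * D.w n K = D.w n K * D.w p K := by
      conv_lhs => rw [← e]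
      rw [← w_add, add_comm, w_add, hpK]
    rw [← h] at h1
    rw [mul_assoc, h1, mul_inv_cancel_left]

theorem region_list {l : List Γ} {K : Ω} {t : Γ} (hK : D.R K t) (hl : Reduced D.S l)
    (hlt : (l ++ [t⁻¹]).IsChain fun x y => x * y ≠ 1) :
    ∃ s l', l ++ [t⁻¹] = s :: l' ∧ D.R (D.act l.prod K) s⁻¹ := by
  induction l with
  | nil => exact ⟨t⁻¹, [], rfl, by simpa [D.act_one] using hK⟩
  | cons s l ih =>
    refine ⟨s, _, rfl, ?_⟩
    have hs : s ∈ D.S := hl.1 s (by simp)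
    obtain ⟨r, l', h1, h2⟩ := ih hl.tail hlt.tail
    rw [List.prod_cons, D.act_mul]
    refine D.step_region _ _ h2 s hs ?_
    rw [List.cons_append, h1] at hlt
    have := (List.isChain_cons_cons.1 hlt).1
    intro hcon
    exact this (by rw [hcon, inv_mul_cancel])

/-- An interval whose expanding orbit never leaves the regions. -/
def Recurrent (K : Ω) : Prop :=
  ∃ Q : Set Ω, K ∈ Q ∧ ∀ K' ∈ Q, ∃ t, D.R K' t ∧ D.act t K' ∈ Q

/-- Recurrence is preserved by every letter: the expanding letter moves on inside `Q`, and any other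
letter prepends one step, undone by its inverse. A recurrent interval lies in a region, hence is not
a gap. -/
theorem Recurrent.notMem_gaps {K : Ω} (hK : D.Recurrent K) (g : Γ) : D.act g K ∉ D.gaps := by
  have step : ∀ s ∈ D.S, ∀ K, D.Recurrent K → D.Recurrent (D.act s K) := by
    rintro s hs K ⟨Q, hKQ, hQ⟩
    obtain ⟨t, ht, htQ⟩ := hQ K hKQ
    by_cases hst : s = t
    · subst hst; exact ⟨Q, htQ, hQ⟩
    · refine ⟨insert (D.act s K) Q, mem_insert _ _, ?_⟩
      rintro K' (rfl | hK')
      · exact ⟨s⁻¹, D.step_region _ _ ht s hs hst, by rw [act_inv_act]; exact mem_insert_of_mem _ hKQ⟩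
      · obtain ⟨t', h1, h2⟩ := hQ K' hK'
        exact ⟨t', h1, mem_insert_of_mem _ h2⟩
  have hall : D.Recurrent (D.act g K) := by
    have hg : g ∈ Subgroup.closure D.S := by rw [D.gen]; trivial
    induction hg using Subgroup.closure_induction_left with
    | one => rwa [D.act_one]
    | mul_left x hx y hy ih => rw [D.act_mul]; exact step x hx _ ih
    | inv_mul_cancel x hx y hy ih => rw [D.act_mul]; exact step _ (D.symm x hx) _ ih
  obtain ⟨Q, hKQ, hQ⟩ := hall
  obtain ⟨t, ht, -⟩ := hQ _ hKQ
  exact D.notMem _ _ ht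

/-- The images of `K` under the suffixes of `l` form the set `Q`. The image under a nonempty suffix
lies in the region expanded by the inverse of its first letter, and this letter leads back to the
next shorter suffix; the empty suffix is identified with `l` itself by `hfix`. -/
theorem recurrent_of_periodic {l : List Γ} (hl : Reduced D.S l) (hne : l ≠ []) {K : Ω} {t : Γ}
    (hK : D.R K t) (hlt : (l ++ [t⁻¹]).IsChain fun x y => x * y ≠ 1)
    (hfix : D.act l.prod K = K) : D.Recurrent K := by
  refine ⟨{K' | ∃ l', l' <:+ l ∧ K' = D.act l'.prod K}, ⟨[], List.nil_suffix, by simp [D.act_one]⟩,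
    ?_⟩
  have main : ∀ s l', (s :: l') <:+ l → ∃ t, D.R (D.act (s :: l').prod K) t ∧
      ∃ l'', l'' <:+ l ∧ D.act t (D.act (s :: l').prod K) = D.act l''.prod K := by
    intro s l' hsuf
    obtain ⟨l₁, hl₁⟩ := hsuf
    have hr : Reduced D.S (s :: l') := by
      refine ⟨fun x hx => hl.1 x (by rw [← hl₁]; exact List.mem_append_right _ hx), ?_⟩
      have := hl.2; rw [← hl₁, List.isChain_append] at this
      exact this.2.1
    obtain ⟨r, l₂, h1, h2⟩ := D.region_list hK hr (by
      rw [← hl₁, List.append_assoc, List.isChain_append] at hlt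
      exact hlt.2.1)
    have : r = s := (List.cons.inj h1).1.symm
    subst this
    refine ⟨r⁻¹, h2, l', ⟨l₁ ++ [r], by simp [hl₁]⟩, ?_⟩
    rw [List.prod_cons, D.act_mul, act_inv_act]
  rintro _ ⟨l', hsuf, rfl⟩
  rcases l' with _ | ⟨s, l'⟩
  · rcases l with _ | ⟨s, l⟩
    · exact absurd rfl hne
    · obtain ⟨t', h1, l'', h2, h3⟩ := main s l List.suffix_rfl
      rw [hfix] at h1 h3
      simp only [List.prod_nil, D.act_one]
      exact ⟨t', h1, l'', h2, h3⟩
  · obtain ⟨t', h1, l'', h2, h3⟩ := main s l' hsuf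
    exact ⟨t', h1, l'', h2, h3⟩

theorem wl_getLast (n : ℕ) (J : Ω) : ∃ l, D.wl (n + 1) J = l ++ [D.o J] := by
  induction n with
  | zero => exact ⟨[], rfl⟩
  | succ n ih =>
    obtain ⟨l, hl⟩ := ih
    exact ⟨D.o (D.T^[n + 1] J) :: l, by rw [wl, hl]; rfl⟩

theorem isChain_append_singleton {l : List Γ} {x y : Γ}
    (h : (l ++ [x]).IsChain fun x y => x * y ≠ 1) (hxy : x * y ≠ 1) :
    (l ++ [x] ++ [y]).IsChain fun x y => x * y ≠ 1 := by
  rw [List.isChain_append]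
  refine ⟨h, by simp, ?_⟩
  intro a ha b hb
  simp at ha hb
  subst ha hb
  exact hxy

/-- A translate of a gap that is invariant under the loop of a gap is a gap. -/
theorem mem_gaps_of_loop {J : Ω} (hJ : J ∈ D.gaps) {p : ℕ} (hp0 : 0 < p) (hp : D.T^[p] J = J)
    {J₃ : Ω} (hJ₃ : J₃ ∈ D.gaps) {g : Γ}
    (hfix : D.act (D.w p J) (D.act g J₃) = D.act g J₃) : D.act g J₃ ∈ D.gaps := by
  rcases D.position' g hJ₃ with h | ⟨t, ht⟩
  · exact h
  exfalso
  have hrec : D.Recurrent (D.act g J₃) := by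
    obtain ⟨n, rfl⟩ : ∃ n, p = n + 1 := ⟨p - 1, by omega⟩
    have hred := D.reduced_wl hJ (n + 1)
    -- The loop starts with the letter `o J`. If this letter expands the region of `gJ₃`, the
    -- inverse loop is used instead: its starting letter is not `o J`, because there is no
    -- cancellation around the cycle.
    by_cases hot : D.o J = t
    · have hlist : ((D.wl (n + 1) J).map (·⁻¹)).reverse =
          ((D.wl n J).map (·⁻¹)).reverse ++ [(D.o (D.T^[n] J))⁻¹] := by simp [wl]
      refine D.recurrent_of_periodic (hred.inv D.symm) (by simp [wl]) ht ?_ ?_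
      · rw [hlist]
        refine isChain_append_singleton ?_ ?_
        · rw [← hlist]; exact (hred.inv D.symm).2
        · rw [← hot]
          have := D.o_next _ (D.T_mem hJ n)
          rw [← T, ← Function.iterate_succ_apply' D.T n J, hp] at this
          intro hcon
          rw [← mul_inv_rev, inv_eq_one] at hcon
          exact this hcon
      · rw [← List.prod_inv_reverse]
        conv_lhs => rw [← hfix]
        exact D.act_inv_act _ _
    · refine D.recurrent_of_periodic hred (by simp [wl]) ht ?_ hfix
      obtain ⟨l, hl⟩ := D.wl_getLast n J
      rw [hl] at hred ⊢
      refine isChain_append_singleton hred.2 fun hcon => hot ?_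
      rwa [mul_inv_eq_one] at hcon
  -- No translate of a recurrent interval is a gap, but `g⁻¹` leads back to the gap `J₃`.
  exact hrec.notMem_gaps D g⁻¹ (by rwa [act_inv_act])

/-- Equal loops have equal reduced words by `reduced_unique`, and the whole itinerary repeats the
word of the loop. -/
theorem wl_eq_of_w_eq {J K : Ω} (hJ : J ∈ D.gaps) (hK : K ∈ D.gaps) {p : ℕ} (hp0 : 0 < p)
    (hp : D.T^[p] J = J) (hpK : D.T^[p] K = K) (h : D.w p K = D.w p J) (n : ℕ) :
    D.w n K = D.w n J := by
  have h1 := D.reduced_unique (D.reduced_wl hK p) (D.reduced_wl hJ p) h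
  have h2 : ∀ i ≤ p, D.wl i K = D.wl i J := by
    intro i hi
    induction hi using Nat.decreasingInduction with
    | self => exact h1
    | of_succ i hi ih => exact (List.cons.inj ih).2
  have h3 : ∀ i, D.o (D.T^[i] K) = D.o (D.T^[i] J) := by
    intro i
    have hmod : ∀ L, D.T^[p] L = L → D.T^[i] L = D.T^[i % p] L := by
      intro L hL
      conv_lhs => rw [← Nat.mod_add_div i p, Function.iterate_add_apply, D.iterate_mul hL]
    rw [hmod K hpK, hmod J hp]
    have := h2 (i % p + 1) (Nat.mod_lt _ hp0)
    exact (List.cons.inj this).1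
  induction n with
  | zero => rfl
  | succ n ih => rw [w_succ, w_succ, ih, h3]

/-- The elements commuting with the loop of a gap `J` are, up to inversion, the words `w n J`. -/
theorem centralizer {J : Ω} (hJ : J ∈ D.gaps) {p : ℕ} (hp0 : 0 < p) (hp : D.T^[p] J = J) {x : Γ}
    (hx : x * D.w p J = D.w p J * x) :
    ∃ n, (x = D.w n J ∨ x⁻¹ = D.w n J) ∧ ∀ m, D.w m (D.T^[n] J) = D.w m J := by
  -- An element commuting with the loop moves `J` to an interval invariant under the loop, which is
  -- a gap by `mem_gaps_of_loop`; its loop is the conjugate of the given one, so it is the same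
  -- word.
  have shift : ∀ x : Γ, x * D.w p J = D.w p J * x →
      D.act x J ∈ D.gaps ∧ ∀ m, D.w m (D.act x J) = D.w m J := by
    intro x hx
    have hmem : D.act x J ∈ D.gaps := by
      refine D.mem_gaps_of_loop hJ hp0 hp hJ ?_
      rw [← D.act_mul, ← hx, D.act_mul, act_w, hp]
    refine ⟨hmem, ?_⟩
    obtain ⟨h1, h2⟩ := D.conj_loop hJ hp hmem
    exact D.wl_eq_of_w_eq hJ hmem hp0 hp h1 (by rw [h2, hx, mul_inv_cancel_right])
  obtain ⟨hmem, hs⟩ := shift x hx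
  obtain ⟨n, h | h⟩ := D.path hJ hmem
  · exact ⟨n, Or.inl h, by rw [← act_w, ← h]; exact hs⟩
  · rw [hs] at h
    refine ⟨n, Or.inr h, ?_⟩
    rw [← act_w, ← h]
    refine (shift x⁻¹ ?_).2
    rw [inv_mul_eq_iff_eq_mul, ← mul_assoc, hx, mul_inv_cancel_right]

/-- The element `w n J` need not fix `J`: it suffices that `J` and `T^[n] J` have the same
itinerary. -/
theorem w_pow' {J : Ω} {n : ℕ} (h : ∀ m, D.w m (D.T^[n] J) = D.w m J) (q m : ℕ) :
    D.w m J * D.w n J ^ q = D.w (m + n * q) J := by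
  induction q with
  | zero => simp
  | succ q ih =>
    rw [pow_succ, ← mul_assoc, ih, Nat.mul_succ, ← add_assoc, D.w_add _ n, h]

/-- Roots are unique in the centralizer of a loop. -/
theorem eq_of_pow_eq {J : Ω} (hJ : J ∈ D.gaps) {p : ℕ} (hp0 : 0 < p) (hp : D.T^[p] J = J)
    {x y : Γ} (hx : x * D.w p J = D.w p J * x) (hy : y * D.w p J = D.w p J * y) {q : ℕ}
    (hq : q ≠ 0) (h : x ^ q = y ^ q) : x = y := by
  obtain ⟨a, ha, ha'⟩ := D.centralizer hJ hp0 hp hx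
  obtain ⟨b, hb, hb'⟩ := D.centralizer hJ hp0 hp hy
  have ea := D.w_pow' ha' q 0
  have eb := D.w_pow' hb' q 0
  rw [w_zero, one_mul, zero_add] at ea eb
  have mixed : D.w a J ^ q * D.w b J ^ q = 1 → D.w a J = 1 ∧ D.w b J = 1 := by
    intro h1
    rw [ea, D.w_pow' hb' q] at h1
    have : a * q + b * q = 0 := by
      by_contra hne; exact D.w_ne_one hJ hne h1
    have ha0 : a = 0 := by
      rcases Nat.mul_eq_zero.1 (by omega : a * q = 0) with h | h
      · exact h
      · exact absurd h hq
    have hb0 : b = 0 := by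
      rcases Nat.mul_eq_zero.1 (by omega : b * q = 0) with h | h
      · exact h
      · exact absurd h hq
    exact ⟨by rw [ha0, w_zero], by rw [hb0, w_zero]⟩
  have same : D.w a J ^ q = D.w b J ^ q → D.w a J = D.w b J := by
    intro h1
    rw [ea, eb] at h1
    rw [Nat.eq_of_mul_eq_mul_right (Nat.pos_of_ne_zero hq) (D.w_injective hJ hJ h1)]
  rcases ha with ha | ha <;> rcases hb with hb | hb
  · rw [ha, hb]; rw [ha, hb] at h; exact same h
  · rw [← ha, ← hb, inv_pow, ← h, mul_inv_cancel] at mixed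
    obtain ⟨h1, h2⟩ := mixed rfl
    rw [h1, inv_eq_one.1 h2]
  · rw [← ha, ← hb, inv_pow, h, inv_mul_cancel] at mixed
    obtain ⟨h1, h2⟩ := mixed rfl
    rw [h2, inv_eq_one.1 h1]
  · rw [← inv_inj, ha, hb]
    apply same
    rw [← ha, ← hb, inv_pow, inv_pow, h]

/-- The gaps whose stabilizer is nontrivial and contained in `L`. -/
def entranceGaps (L : Subgroup Γ) : Set Ω :=
  {J | J ∈ D.gaps ∧ (∃ g, g ≠ 1 ∧ D.act g J = J) ∧ ∀ g, D.act g J = J → g ∈ L}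

/-- An element mapping one gap of the entrance of a cyclic group to another one preserves the
entrance. -/
theorem entranceGaps_invariant {L : Subgroup Γ} {z : Γ} (hL : L = Subgroup.zpowers z) {J : Ω}
    (hJ : J ∈ D.entranceGaps L) {g : Γ} (hg : D.act g J ∈ D.entranceGaps L) {J₃ : Ω}
    (hJ₃ : J₃ ∈ D.entranceGaps L) : D.act g J₃ ∈ D.entranceGaps L := by
  obtain ⟨hJg, -, hJL⟩ := hJ
  obtain ⟨hgg, -, hgL⟩ := hg
  obtain ⟨hJ₃g, ⟨g₃, hg₃, hfix₃⟩, hL₃⟩ := hJ₃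
  obtain ⟨p, hp0, hp⟩ := D.exists_period hJg
  have hc := hJL (D.w p J) (by rw [act_w, hp])
  obtain ⟨hp2, hc2⟩ := D.conj_loop hJg hp hgg
  have hc2L := hgL (D.w p (D.act g J)) (by rw [act_w, hp2])
  rw [hL, Subgroup.mem_zpowers_iff] at hc hc2L
  obtain ⟨m, hm⟩ := hc
  obtain ⟨m₂, hm₂⟩ := hc2L
  have hm0 : m ≠ 0 := by
    rintro rfl
    exact D.w_ne_one hJg hp0.ne' (by rw [← hm, zpow_zero])
  -- Both loops are powers of `z` and both are words of length `p`; comparing the lengths of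
  -- suitable powers shows that the exponents agree up to sign.
  have habs : m.natAbs = m₂.natAbs := by
    have e1 := D.w_pow hp m₂.natAbs
    have e2 := D.w_pow hp2 m.natAbs
    have key : D.w p J ^ m₂.natAbs = D.w p (D.act g J) ^ m.natAbs ∨
        (D.w p J ^ m₂.natAbs)⁻¹ = D.w p (D.act g J) ^ m.natAbs := by
      rw [← hm, ← hm₂, ← zpow_natCast, ← zpow_natCast, ← zpow_mul, ← zpow_mul, ← zpow_neg]
      have : m * (m₂.natAbs : ℤ) = m₂ * (m.natAbs : ℤ) ∨
          -(m * (m₂.natAbs : ℤ)) = m₂ * (m.natAbs : ℤ) := by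
        rcases Int.natAbs_eq m with h1 | h1 <;> rcases Int.natAbs_eq m₂ with h2 | h2 <;>
          · generalize m.natAbs = x at *
            generalize m₂.natAbs = y at *
            subst h1 h2
            first
              | (left; ring1)
              | (right; ring1)
      rcases this with h | h
      · left; rw [h]
      · right; rw [h]
    rw [e1, e2] at key
    have : p * m₂.natAbs = p * m.natAbs := by
      rcases key with h | h
      · exact D.w_injective hJg hgg h
      · exact D.w_inv_injective hJg hgg h
    exact (Nat.eq_of_mul_eq_mul_left hp0 this).symm
  obtain ⟨ε, hε, hεm⟩ : ∃ ε : ℤ, (ε = 1 ∨ ε = -1) ∧ m₂ = ε * m := by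
    rcases Int.natAbs_eq_natAbs_iff.1 habs with h | h
    · exact ⟨1, Or.inl rfl, by omega⟩
    · exact ⟨-1, Or.inr rfl, by omega⟩
  have hε2 : ε * ε = 1 := by rcases hε with rfl | rfl <;> rfl
  have hgc : g * z ^ m * g⁻¹ = z ^ (ε * m) := by rw [hm, ← hc2, ← hm₂, hεm]
  have hconj : ∀ r : ℤ, (g * z ^ ε * g⁻¹) ^ r = g * z ^ (ε * r) * g⁻¹ := by
    intro r; rw [conj_zpow, ← zpow_mul]
  have hym : (g * z ^ ε * g⁻¹) ^ m = z ^ m := by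
    rw [hconj, mul_comm ε m, zpow_mul, ← conj_zpow, hgc, ← zpow_mul]
    congr 1
    calc ε * m * ε = ε * ε * m := by ring
      _ = m := by rw [hε2, one_mul]
  -- Both sides have the same `m`-th power, the loop of `J`, and so commute with it. Uniqueness of
  -- roots shows that `g` normalizes the cyclic group `L`.
  have hyz : g * z ^ ε * g⁻¹ = z := by
    refine D.eq_of_pow_eq hJg hp0 hp ?_ ?_ (q := m.natAbs) (by omega) ?_
    · rw [← hm, ← hym]; exact (Commute.self_zpow _ _).eq
    · rw [← hm]; exact (Commute.self_zpow _ _).eq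
    · rcases Int.natAbs_eq m with h | h
      · rw [h] at hym; exact_mod_cast hym
      · rw [h, zpow_neg, zpow_neg, inv_inj] at hym; exact_mod_cast hym
  have hgz : g * z * g⁻¹ = z ^ ε := by
    rcases hε with rfl | rfl
    · simpa using hyz
    · rw [zpow_neg, zpow_one] at hyz ⊢
      rw [← inv_inj, inv_inv, mul_inv_rev, mul_inv_rev, inv_inv, ← mul_assoc]
      exact hyz
  have hgzr : ∀ r : ℤ, g * z ^ r * g⁻¹ = z ^ (ε * r) := by
    intro r; rw [← conj_zpow, hgz, ← zpow_mul]
  have hstab : ∀ x, D.act x (D.act g J₃) = D.act g J₃ ↔ D.act (g⁻¹ * x * g) J₃ = J₃ := by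
    intro x
    rw [D.act_mul, D.act_mul]
    constructor
    · intro h; rw [h, act_inv_act]
    · intro h
      have := congrArg (D.act g) h
      rwa [act_act_inv] at this
  obtain ⟨m₃, hm₃⟩ : ∃ m₃ : ℤ, z ^ m₃ = g₃ := by
    have := hL₃ g₃ hfix₃
    rwa [hL, Subgroup.mem_zpowers_iff] at this
  have hfixz : ∀ r : ℤ, D.act (z ^ (m₃ * r)) J₃ = J₃ := by
    have hn : ∀ n : ℕ, D.act (g₃ ^ n) J₃ = J₃ := by
      intro n
      induction n with
      | zero => simp [D.act_one]
      | succ n ih => rw [pow_succ, D.act_mul, hfix₃, ih]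
    intro r
    rw [zpow_mul, hm₃]
    obtain ⟨n, rfl | rfl⟩ := r.eq_nat_or_neg
    · rw [zpow_natCast]; exact hn n
    · rw [zpow_neg, zpow_natCast]
      conv_lhs => rw [← hn n]
      exact D.act_inv_act _ _
  refine ⟨?_, ?_, ?_⟩
  · have hm₃0 : m₃ ≠ 0 := by rintro rfl; exact hg₃ (by rw [← hm₃, zpow_zero])
    -- Some power of the loop of `J`, conjugated by `g`, fixes `J₃`; thus a multiple of the loop of
    -- `J` fixes `gJ₃`.
    refine D.mem_gaps_of_loop hJg (p := p * m₃.natAbs)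
      (Nat.mul_pos hp0 (by omega)) (D.iterate_mul hp _) hJ₃g ?_
    rw [← D.w_pow hp, ← hm, hstab, ← zpow_natCast, ← zpow_mul]
    have h1 : g⁻¹ * z ^ (m * (m₃.natAbs : ℤ)) * g = z ^ (ε * (m * (m₃.natAbs : ℤ))) := by
      have := hgzr (ε * (m * (m₃.natAbs : ℤ)))
      rw [show ε * (ε * (m * (m₃.natAbs : ℤ))) = ε * ε * (m * (m₃.natAbs : ℤ)) by ring, hε2,
        one_mul] at this
      rw [← this]; group
    rw [h1]
    obtain ⟨r, hr⟩ : ∃ r : ℤ, ε * (m * (m₃.natAbs : ℤ)) = m₃ * r := by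
      rcases Int.natAbs_eq m₃ with h | h
      · exact ⟨ε * m, by rw [← h]; ring⟩
      · refine ⟨-(ε * m), ?_⟩
        have : (m₃.natAbs : ℤ) = -m₃ := by omega
        rw [this]; ring
    rw [hr]; exact hfixz r
  · refine ⟨g * g₃ * g⁻¹, ?_, ?_⟩
    · intro h; exact hg₃ (by simpa using h)
    · rw [hstab]; convert hfix₃ using 2; group
  · intro x hx
    have h1 := hL₃ _ ((hstab x).1 hx)
    rw [hL, Subgroup.mem_zpowers_iff] at h1 ⊢
    obtain ⟨r, hr⟩ := h1
    refine ⟨ε * r, ?_⟩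
    rw [← hgzr, hr]; group

/-- The stabilizer of a gap is, up to finite index, generated by its loop. -/
theorem stabilizer_pow {J : Ω} (hJ : J ∈ D.gaps) {p : ℕ} (hp : D.T^[p] J = J) {g : Γ}
    (hg : D.act g J = J) : ∃ n : ℤ, g ^ p = D.w p J ^ n := by
  have key : ∀ n, D.T^[n] J = J → D.w n J ^ p = D.w p J ^ n := by
    intro n hn; rw [D.w_pow hn, D.w_pow hp, mul_comm]
  obtain ⟨n, h | h⟩ := D.path hJ (by rwa [hg] : D.act g J ∈ D.gaps)
  · refine ⟨n, ?_⟩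
    rw [h, key n (by rw [← act_w, ← h, hg]), zpow_natCast]
  · rw [hg] at h
    refine ⟨-n, ?_⟩
    have hg' : D.act g⁻¹ J = J := by
      conv_lhs => rw [← hg]
      exact D.act_inv_act _ _
    rw [zpow_neg, zpow_natCast, ← key n (by rw [← act_w, ← h, hg']), ← h, inv_pow, inv_inv]

end Coding

end

section

/-! ### The coding of a basic partition -/

section CodingOfPartition

variable {Γ : Type*} [Group Γ] {S : Set Γ} {φ : Γ →* HomeoPlus} {P : Set Circ}
  (h : IsPureBP S φ P) (E : Enum P) (hS : ∀ s ∈ S, s⁻¹ ∈ S)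

include hS in
/-- A reduced word whose first letter does not expand the component `i` maps it into a
component. -/
theorem reduced_comp {l : List Γ} (hl : Reduced S l) {i : ℤ}
    (hli : (l ++ [(label h E i)⁻¹]).IsChain fun x y => x * y ≠ 1) {F : ℝ ≃o ℝ}
    (hF : IsLift F (φ l.prod)) :
    ∃ j, E.a j ≤ F (E.a i) ∧ F (E.b i) ≤ E.b j ∧
      (∃ s l', l ++ [(label h E i)⁻¹] = s :: l' ∧ label h E j = s⁻¹) ∧
      (l ≠ [] → E.a j < F (E.a i) ∨ F (E.b i) < E.b j) := by
  induction l generalizing F with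
  | nil =>
    rw [List.prod_nil, map_one] at hF
    obtain ⟨n, hn⟩ := IsLift.one.unique hF
    refine ⟨i + E.N * n, ?_, ?_, ⟨_, [], rfl, ?_⟩, fun h => absurd rfl h⟩
    · rw [E.a_add_mul, hn]; exact le_rfl
    · rw [E.b_add_mul, hn]; exact le_rfl
    · rw [label_add, inv_inv]
  | cons s l ih =>
    have hs : s ∈ S := hl.1 s (by simp)
    obtain ⟨Fs, hFs⟩ := exists_isLift (φ s)
    have hF0 : IsLift (Fs⁻¹ * F) (φ l.prod) := by
      have := hFs.inv.mul hF
      rwa [List.prod_cons, map_mul, inv_mul_cancel_left] at this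
    obtain ⟨j, h1, h2, ⟨r, l', h3, h4⟩, -⟩ := ih hl.tail hli.tail hF0
    have hsj : s ≠ label h E j := by
      rw [List.cons_append, h3] at hli
      have := (List.isChain_cons_cons.1 hli).1
      rw [h4]
      intro hcon
      exact this (by rw [hcon, inv_mul_cancel])
    have e : ∀ t, Fs ((Fs⁻¹ * F) t) = F t := fun t => by
      rw [RelIso.mul_apply]; exact RelIso.apply_inv_self _ _
    obtain ⟨m, h5, h6, h7, h8⟩ := lift_comp h E hS hs hFs hsj
    have h1' := Fs.monotone h1
    have h2' := Fs.monotone h2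
    rw [e] at h1' h2'
    refine ⟨m, h6.trans h1', h2'.trans h7, ⟨s, _, rfl, h5⟩, fun _ => ?_⟩
    rcases h8 with h8 | h8
    · exact Or.inl (h8.trans_le h1')
    · exact Or.inr (h2'.trans_lt h8)

include h E hS in
/-- Nonempty reduced words act nontrivially. -/
theorem reduced_ne_one {l : List Γ} (hl : Reduced S l) (hne : l ≠ []) : φ l.prod ≠ 1 := by
  intro hone
  obtain ⟨l', s, rfl⟩ : ∃ l' s, l = l' ++ [s] :=
    ⟨l.dropLast, l.getLast hne, (List.dropLast_append_getLast hne).symm⟩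
  -- The component `i` is not expanded by the letter acting first, so the word maps it strictly into
  -- a component; the identity cannot do this.
  obtain ⟨i, hi⟩ := exists_label_ne h E s
  have hli : (l' ++ [s] ++ [(label h E i)⁻¹]).IsChain fun x y => x * y ≠ 1 := by
    rw [List.isChain_append]
    refine ⟨hl.2, by simp, ?_⟩
    intro a ha b hb
    simp at ha hb
    subst ha hb
    intro hcon
    rw [mul_inv_eq_one] at hcon
    exact hi hcon.symm
  obtain ⟨j, h1, h2, -, h3⟩ := reduced_comp h E hS hl hli (F := 1) (by rw [hone]; exact IsLift.one)
  have h1 : E.a j ≤ E.a i := h1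
  have h2 : E.b i ≤ E.b j := h2
  have h3 : E.a j < E.a i ∨ E.b i < E.b j := h3 hne
  have := E.a_strictMono.le_iff_le.1 h1
  have := E.b_strictMono.le_iff_le.1 h2
  have hij : j = i := by omega
  subst hij
  rcases h3 with h3 | h3 <;> exact lt_irrefl _ h3

theorem image_gap {f : HomeoPlus} {F : ℝ ≃o ℝ} (hF : IsLift F f) {i j : ℤ}
    (h1 : F (E.b i) = E.b j) (h2 : F (E.a (i + 1)) = E.a (j + 1)) :
    f '' E.gap i = E.gap j := by
  rw [Enum.gap, hF.image, F.image_Icc, h1, h2, Enum.gap]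

/-- If the image of a gap is a gap, then so it is for the lifts. -/
theorem lift_of_image_gap {f : HomeoPlus} {F : ℝ ≃o ℝ} (hF : IsLift F f) {i j : ℤ}
    (h : f '' E.gap i = E.gap j) :
    ∃ n : ℤ, F (E.b i) = E.b (j + E.N * n) ∧ F (E.a (i + 1)) = E.a (j + E.N * n + 1) := by
  rw [Enum.gap, hF.image, F.image_Icc] at h
  have hlt : F (E.b i) < F (E.a (i + 1)) := F.strictMono (E.b_lt_a i)
  have hmem : ((F (E.b i) : ℝ) : Circ) ∈ E.gap j := by rw [← h]; exact ⟨_, ⟨le_rfl, hlt.le⟩, rfl⟩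
  obtain ⟨n, hn⟩ := coe_mem_image.1 hmem
  refine ⟨-n, ?_⟩
  have ea : E.a (j + E.N * (-n) + 1) = E.a (j + 1) - n := by
    rw [show j + E.N * (-n) + 1 = j + 1 + E.N * (-n) by ring, E.a_add_mul]; push_cast; ring
  have eb : E.b (j + E.N * (-n)) = E.b j - n := by rw [E.b_add_mul]; push_cast; ring
  rw [← E.gap_add j (-n)] at h
  set m := j + E.N * (-n)
  have hsub : Icc (F (E.b i)) (F (E.a (i + 1))) ⊆ Icc (E.b m) (E.a (m + 1)) := by
    refine subset_Icc_of_coe ordConnected_Icc (E.a_succ_lt m) (c := F (E.b i))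
      ⟨le_rfl, hlt.le⟩ ⟨by linarith [hn.1], by linarith [hn.2]⟩ ?_
    intro t ht
    change (t : Circ) ∈ E.gap m
    rw [← h]; exact ⟨t, ht, rfl⟩
  have key : ∀ t ∈ Icc (E.b m) (E.a (m + 1)), t ∈ Icc (F (E.b i)) (F (E.a (i + 1))) := by
    intro t ht
    have : (t : Circ) ∈ E.gap m := ⟨t, ht, rfl⟩
    rw [← h] at this
    obtain ⟨t', ht', he⟩ := this
    rwa [← coe_injOn (E.a_succ_lt m) (hsub ht') ht he]
  have h1 := key _ ⟨le_rfl, (E.b_lt_a m).le⟩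
  have h2 := key _ ⟨(E.b_lt_a m).le, le_rfl⟩
  have h3 := hsub ⟨le_rfl, hlt.le⟩
  have h4 := hsub ⟨hlt.le, le_rfl⟩
  exact ⟨le_antisymm h1.1 h3.1, le_antisymm h4.2 h2.2⟩

open Classical in
/-- The letter of a gap: the generator expanding the component on its right. -/
def gapLetter (K : Set Circ) : Γ := if hK : ∃ i, K = E.gap i then label h E (hK.choose + 1) else 1

theorem gapLetter_gap (i : ℤ) : gapLetter h E (E.gap i) = label h E (i + 1) := by
  have hex : ∃ j, E.gap i = E.gap j := ⟨i, rfl⟩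
  rw [gapLetter, dif_pos hex]
  have hspec := hex.choose_spec
  have hmem : (E.b i : Circ) ∈ E.gap i := ⟨_, ⟨le_rfl, (E.b_lt_a i).le⟩, rfl⟩
  obtain ⟨n, hn⟩ := E.gap_eq_of_mem hmem (hspec ▸ hmem)
  rw [hn, show i + E.N * n + 1 = i + 1 + E.N * n by ring, label_add]

/-- The gap `i` abuts on the component `i + 1`, whose image starts at a left end point; therefore
the image of the gap does not lie inside a component. The last clause says that consecutive letters
of an itinerary do not cancel. -/
theorem lift_right_gap (i : ℤ) {F : ℝ ≃o ℝ} (hF : IsLift F (φ (label h E (i + 1)))) :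
    ∃ j, F (E.b i) = E.b j ∧ F (E.a (i + 1)) = E.a (j + 1) ∧
      label h E (j + 1) ≠ (label h E (i + 1))⁻¹ := by
  obtain ⟨m, m', h1, h2, h3, h4⟩ := lift_expand h E hF
  rcases lift_gap h E (label_mem h E (i + 1)) hF i with ⟨j, h5, h6⟩ | ⟨j, h5, h6⟩
  · refine ⟨j, h5, h6, ?_⟩
    have : j + 1 = m := E.a_strictMono.injective (by rw [← h6, h2])
    rw [this]
    exact h4 m le_rfl h1.le
  · exfalso
    have h7 : F (E.b i) < F (E.a (i + 1)) := F.strictMono (E.b_lt_a i)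
    rw [h2] at h6 h7
    have := E.a_strictMono.lt_iff_lt.1 (h5.trans h7)
    have := E.le_of_a_le_b h6.le
    omega

variable (hgen : Subgroup.closure S = ⊤)

/-- The coding of the action by a pure basic partition. -/
def codingOf : Coding Γ (Set Circ) where
  S := S
  act γ K := φ γ '' K
  gaps := range E.gap
  R K t := K.Nonempty ∧ ∃ j, K ⊆ ((↑) : ℝ → Circ) '' Ioo (E.a j) (E.b j) ∧ t = label h E j
  o := gapLetter h E
  symm := hS
  gen := hgen
  act_one K := by
    rw [map_one]; exact image_id K
  act_mul g g' K := by
    rw [map_mul, ← image_comp]; rfl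
  finite := E.range_finite_of_periodic _ E.gap_add
  step_gap := by
    rintro _ ⟨i, rfl⟩ s hs
    obtain ⟨F, hF⟩ := exists_isLift (φ s)
    rcases lift_gap_label h E hS hs hF i with ⟨j, h1, h2⟩ | ⟨j, h1, h2, h3⟩
    · exact Or.inl ⟨j, (image_gap E hF h1 h2).symm⟩
    · right
      refine ⟨⟨_, _, ⟨E.b i, ⟨le_rfl, (E.b_lt_a i).le⟩, rfl⟩, rfl⟩, j, ?_, h1.symm⟩
      rw [Enum.gap, hF.image, F.image_Icc]
      exact image_mono (Icc_subset_Ioo h2 h3)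
  step_region := by
    rintro K t ⟨hne, j, hK, rfl⟩ s hs hst
    obtain ⟨F, hF⟩ := exists_isLift (φ s)
    obtain ⟨m, h1, h2, h3, -⟩ := lift_comp h E hS hs hF hst
    refine ⟨hne.image _, m, (image_mono hK).trans ?_, h1.symm⟩
    rw [hF.image, F.image_Ioo]
    exact image_mono (Ioo_subset_Ioo h2 h3)
  notMem := by
    rintro _ t ⟨-, j, hK, -⟩ ⟨i, rfl⟩
    obtain ⟨n, h1, h2⟩ := coe_mem_image.1 (hK ⟨E.b i, ⟨le_rfl, (E.b_lt_a i).le⟩, rfl⟩)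
    rw [← E.b_add_mul] at h1 h2
    have := E.le_of_a_le_b h1.le
    have := E.b_strictMono.lt_iff_lt.1 h2
    omega
  o_mem := by
    rintro _ ⟨i, rfl⟩
    rw [gapLetter_gap]
    exact label_mem h E _
  o_gap := by
    rintro _ ⟨i, rfl⟩
    rw [gapLetter_gap]
    obtain ⟨F, hF⟩ := exists_isLift (φ (label h E (i + 1)))
    obtain ⟨j, h1, h2, -⟩ := lift_right_gap h E i hF
    exact ⟨j, (image_gap E hF h1 h2).symm⟩
  eq_o := by
    rintro _ ⟨i, rfl⟩ s hs ⟨j, hj⟩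
    rw [gapLetter_gap, ← hj, gapLetter_gap]
    by_cases hsi : s = label h E (i + 1)
    · exact Or.inl hsi
    · right
      obtain ⟨F, hF⟩ := exists_isLift (φ s)
      obtain ⟨n, -, h2⟩ := lift_of_image_gap E hF hj.symm
      obtain ⟨m, h3, h4, h5, -⟩ := lift_comp h E hS hs hF hsi
      have h6 : F (E.a (i + 1)) < F (E.b (i + 1)) := F.strictMono (E.a_lt_b _)
      rw [h2] at h4 h6
      have := E.a_strictMono.le_iff_le.1 h4
      have := E.le_of_a_le_b (h6.le.trans h5)
      rw [← h3, ← label_add h E (j + 1) n]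
      congr 1
      linarith
  -- Here purity is used: only one edge arrives at each gap.
  o_inj := by
    have edge : ∀ i, GapEdge S φ P (gapLetter h E (E.gap i)) (E.gap i)
        (φ (gapLetter h E (E.gap i)) '' E.gap i) := by
      intro i
      rw [gapLetter_gap]
      obtain ⟨F, hF⟩ := exists_isLift (φ (label h E (i + 1)))
      obtain ⟨j, h1, h2, -⟩ := lift_right_gap h E i hF
      refine ⟨(E.isComponent_sharp_iff _).2 ⟨i, rfl⟩, (E.isComponent_sharp_iff _).2
        ⟨j, image_gap E hF h1 h2⟩, E.comp (i + 1), (E.isComponent_iff _).2 ⟨_, rfl⟩, ?_,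
        label_mem h E _, label_expands h E _, rfl⟩
      refine ⟨(E.b i : Circ), (E.a (i + 1) : Circ), (E.b (i + 1) : Circ), ?_, ?_, ?_, ?_⟩
      · intro he
        exact (E.b_lt_a i).ne (coe_injOn (E.a_succ_lt i) ⟨le_rfl, (E.b_lt_a i).le⟩
          ⟨(E.b_lt_a i).le, le_rfl⟩ he)
      · intro he
        exact (E.a_lt_b _).ne (coe_injOn (E.b_lt _) ⟨le_rfl, (E.a_lt_b _).le⟩
          ⟨(E.a_lt_b _).le, le_rfl⟩ he)
      · rw [cIcc_coe (E.b_lt_a i) (E.a_succ_lt i)]; rfl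
      · rw [cIcc_coe (E.a_lt_b _) (E.b_lt _)]; rfl
    rintro _ ⟨i, rfl⟩ _ ⟨j, rfl⟩ hij
    have e1 := edge i
    have e2 := edge j
    rw [hij] at e1
    obtain ⟨e, -, huniq⟩ := h.in_edge _ e1.2.1
    have h1 := huniq (gapLetter h E (E.gap i), E.gap i) e1
    have h2 := huniq (gapLetter h E (E.gap j), E.gap j) e2
    exact congrArg Prod.snd (h1.trans h2.symm)
  o_next := by
    rintro _ ⟨i, rfl⟩
    rw [gapLetter_gap]
    obtain ⟨F, hF⟩ := exists_isLift (φ (label h E (i + 1)))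
    obtain ⟨j, h1, h2, h3⟩ := lift_right_gap h E i hF
    rw [image_gap E hF h1 h2, gapLetter_gap]
    intro hcon
    exact h3 (eq_inv_of_mul_eq_one_left hcon)
  free l hl hne hone := reduced_ne_one h E hS hl hne (by rw [hone, map_one])

end CodingOfPartition

end

section

/-! ### Comparison of two actions along a tree -/

/-- Two families of partitions of the line indexed by the vertices of a graph, together with
groups of pairs of homeomorphisms acting on them in the same combinatorial way. -/
structure Tracking (V : Type*) (G : SimpleGraph V) where
  a : V → ℤ → ℝ
  b : V → ℤ → ℝ
  a' : V → ℤ → ℝ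
  b' : V → ℤ → ℝ
  Q : V → Subgroup ((ℝ ≃o ℝ) × (ℝ ≃o ℝ))
  M : V → V → Subgroup ((ℝ ≃o ℝ) × (ℝ ≃o ℝ))
  Ent : V → V → ℤ → Prop
  gap : ∀ v, ∀ p ∈ Q v, ∀ i,
    (∃ j, p.1 (b v i) = b v j ∧ p.1 (a v (i + 1)) = a v (j + 1) ∧
      p.2 (b' v i) = b' v j ∧ p.2 (a' v (i + 1)) = a' v (j + 1)) ∨
    ∃ j, a v j ≤ p.1 (b v i) ∧ p.1 (a v (i + 1)) ≤ b v j ∧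
      a' v j ≤ p.2 (b' v i) ∧ p.2 (a' v (i + 1)) ≤ b' v j
  start : ∀ v, ∀ p ∈ Q v, ∃ i j, a v j ≤ p.1 (a v i) ∧ p.1 (b v i) ≤ b v j ∧
    a' v j ≤ p.2 (a' v i) ∧ p.2 (b' v i) ≤ b' v j
  entrance : ∀ v u u', G.Adj v u → G.Adj v u' → ∀ p ∈ Q v, ∀ i j, Ent v u i → Ent v u' j →
    p.1 (b v i) = b v j → p.1 (a v (i + 1)) = a v (j + 1) → u = u' ∧ p ∈ M v u
  link : ∀ v u, G.Adj v u → M v u ≤ Q u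
  comp_sub : ∀ v u, G.Adj v u → ∀ j, ∃ m, Ent u v m ∧ b u m ≤ a v j ∧ b v j ≤ a u (m + 1) ∧
    b' u m ≤ a' v j ∧ b' v j ≤ a' u (m + 1)
  gap_sub : ∀ v u, G.Adj v u → ∀ j, ¬ Ent v u j → ∃ m, Ent u v m ∧
    b u m ≤ b v j ∧ a v (j + 1) ≤ a u (m + 1) ∧ b' u m ≤ b' v j ∧ a' v (j + 1) ≤ a' u (m + 1)

namespace Tracking

variable {V : Type*} {G : SimpleGraph V} (D : Tracking V G)

/-- `D.Word u v x` says that `x` is a reduced product of pairs along a path of the graph that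
starts with the vertex `v`, and that the path may be preceded by `u`. -/
inductive Word : V → V → (ℝ ≃o ℝ) × (ℝ ≃o ℝ) → Prop
  | base (u v p) : G.Adj u v → p ∈ D.Q v → Word u v p
  | cons (u v w p x) : G.Adj u v → G.Adj v w → p ∈ D.Q v → (w = u → p ∉ D.M v w) →
      Word v w x → Word u v (p * x)

/-- Ping-pong on the tree, carried out for both actions at once. Inductively the word `x` puts a
component into a gap of the entrance at `v` towards `w`. The pair `p` takes this gap into a
component, or to a gap outside the entrance towards `u`, since otherwise `w = u` and `p` would
belong to the edge group. In both cases the result is covered by a gap of the opposite entrance, at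
`u`. -/
theorem Word.exists_gap {u v : V} {x : (ℝ ≃o ℝ) × (ℝ ≃o ℝ)} (h : D.Word u v x) :
    ∃ v₀ i m, D.Ent u v m ∧ D.b u m ≤ x.1 (D.a v₀ i) ∧ x.1 (D.b v₀ i) ≤ D.a u (m + 1) ∧
      D.b' u m ≤ x.2 (D.a' v₀ i) ∧ x.2 (D.b' v₀ i) ≤ D.a' u (m + 1) := by
  induction h with
  | base u v p hadj hp =>
    obtain ⟨i, j, h1, h2, h3, h4⟩ := D.start v p hp
    obtain ⟨m, h5, h6, h7, h8, h9⟩ := D.comp_sub v u hadj.symm j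
    exact ⟨v, i, m, h5, h6.trans h1, h2.trans h7, h8.trans h3, h4.trans h9⟩
  | cons u v w p x huv hvw hp hM _ ih =>
    obtain ⟨v₀, i, m, h1, h2, h3, h4, h5⟩ := ih
    have h2' := p.1.monotone h2
    have h3' := p.1.monotone h3
    have h4' := p.2.monotone h4
    have h5' := p.2.monotone h5
    refine ⟨v₀, i, ?_⟩
    change ∃ m, D.Ent u v m ∧ D.b u m ≤ p.1 (x.1 (D.a v₀ i)) ∧
      p.1 (x.1 (D.b v₀ i)) ≤ D.a u (m + 1) ∧
      D.b' u m ≤ p.2 (x.2 (D.a' v₀ i)) ∧ p.2 (x.2 (D.b' v₀ i)) ≤ D.a' u (m + 1)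
    rcases D.gap v p hp m with ⟨j, e1, e2, e3, e4⟩ | ⟨j, e1, e2, e3, e4⟩
    · have hj : ¬ D.Ent v u j := by
        intro hj
        obtain ⟨rfl, h⟩ := D.entrance v w u hvw huv.symm p hp m j h1 hj e1 e2
        exact hM rfl h
      obtain ⟨n, h6, h7, h8, h9, h10⟩ := D.gap_sub v u huv.symm j hj
      exact ⟨n, h6, by linarith, by linarith, by linarith, by linarith⟩
    · obtain ⟨n, h6, h7, h8, h9, h10⟩ := D.comp_sub v u huv.symm j
      exact ⟨n, h6, by linarith, by linarith, by linarith, by linarith⟩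

/-- The elements represented by reduced words that start with the vertex `v`. -/
def Good (v : V) (g : (ℝ ≃o ℝ) × (ℝ ≃o ℝ)) : Prop :=
  g ∈ D.Q v ∨ ∃ p ∈ D.Q v, ∃ w x, G.Adj v w ∧ D.Word v w x ∧ g = p * x

theorem Good.mul_left {v : V} {g p : (ℝ ≃o ℝ) × (ℝ ≃o ℝ)} (hp : p ∈ D.Q v) (h : D.Good v g) :
    D.Good v (p * g) := by
  rcases h with h | ⟨q, hq, w, x, hvw, hx, rfl⟩
  · exact Or.inl (mul_mem hp h)
  · exact Or.inr ⟨p * q, mul_mem hp hq, w, x, hvw, hx, (mul_assoc _ _ _).symm⟩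

theorem Word.good {u v : V} {g : (ℝ ≃o ℝ) × (ℝ ≃o ℝ)} (h : D.Word u v g) : D.Good v g := by
  cases h with
  | base _ _ _ _ h => exact Or.inl h
  | cons _ _ w p x _ h1 h2 _ h3 => exact Or.inr ⟨p, h2, w, x, h1, h3, rfl⟩

/-- The path is prolonged by the identity at `u`. If it would then backtrack through an element of
the edge group, this element is absorbed at the next vertex by `link`. -/
theorem Good.of_adj {u v : V} (huv : G.Adj u v) {g : (ℝ ≃o ℝ) × (ℝ ≃o ℝ)} (h : D.Good v g) :
    D.Good u g := by
  rcases h with h | ⟨p, hp, w, x, hvw, hx, rfl⟩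
  · exact Or.inr ⟨1, one_mem _, v, g, huv, Word.base _ _ _ huv h, (one_mul g).symm⟩
  · by_cases hM : w = u → p ∉ D.M v w
    · exact Or.inr ⟨1, one_mem _, v, _, huv, Word.cons _ _ _ _ _ huv hvw hp hM hx,
        (one_mul _).symm⟩
    · push Not at hM
      obtain ⟨rfl, hM⟩ := hM
      exact (hx.good D).mul_left D (D.link v w hvw hM)

theorem good_of_mem (hG : G.Connected) (v : V) {g : (ℝ ≃o ℝ) × (ℝ ≃o ℝ)}
    (hg : g ∈ ⨆ v, D.Q v) : D.Good v g := by
  have trans : ∀ u v g, D.Good u g → D.Good v g := by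
    intro u v g hu
    obtain ⟨p⟩ := hG.preconnected v u
    induction p with
    | nil => exact hu
    | cons h _ ih => exact (ih hu).of_adj D h
  suffices H : ∀ x, D.Good v x → D.Good v (g * x) by
    simpa using H 1 (Or.inl (one_mem _))
  refine Subgroup.iSup_induction D.Q (C := fun g => ∀ x, D.Good v x → D.Good v (g * x)) hg
    (fun u p hp x hx => trans u v _ ((trans v u _ hx).mul_left D hp))
    (fun x hx => by rwa [one_mul]) (fun p q hp hq x hx => ?_)
  rw [mul_assoc]
  exact hp _ (hq _ hx)

/-- By monotonicity `F x` lies between the values of `F` at the two multiples of `c` surrounding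
`x`. -/
theorem abs_sub_le_of_commute {F : ℝ ≃o ℝ} {c : ℝ} (hc : 0 < c) (hF : ∀ t, F (t + c) = F t + c)
    (x : ℝ) : |F x - x - F 0| ≤ c := by
  have hn : ∀ (n : ℤ) t, F (t + n * c) = F t + n * c := by
    intro n
    induction n with
    | zero => simp
    | succ n ih =>
      intro t
      rw [show t + ((n + 1 : ℤ) : ℝ) * c = t + n * c + c by push_cast; ring, hF]
      have := ih t
      push_cast at this ⊢
      rw [this]; ring
    | pred n ih =>
      intro t
      have := hF (t + ((-n - 1 : ℤ) : ℝ) * c)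
      rw [show t + ((-n - 1 : ℤ) : ℝ) * c + c = t + ((-n : ℤ) : ℝ) * c by push_cast; ring, ih] at this
      push_cast at this ⊢
      linarith
  have h1 : (⌊x / c⌋ : ℝ) * c ≤ x := by
    rw [← le_div_iff₀ hc]; exact Int.floor_le _
  have h2 : x ≤ (⌊x / c⌋ : ℝ) * c + c := by
    have := (Int.lt_floor_add_one (x / c)).le
    rw [div_le_iff₀ hc] at this
    linarith
  have e1 := hn ⌊x / c⌋ 0
  have e2 := hn ⌊x / c⌋ c
  have e3 := hF 0
  rw [zero_add] at e1 e3
  have h3 := F.monotone h1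
  have h4 := F.monotone h2
  rw [add_comm _ c, e2] at h4
  rw [abs_le]
  constructor <;> linarith

theorem Good.exists_position {v : V} {g : (ℝ ≃o ℝ) × (ℝ ≃o ℝ)} (h : D.Good v g) :
    ∃ v₀ i, (∃ j, D.a v j ≤ g.1 (D.a v₀ i) ∧ g.1 (D.b v₀ i) ≤ D.b v j ∧
        D.a' v j ≤ g.2 (D.a' v₀ i) ∧ g.2 (D.b' v₀ i) ≤ D.b' v j) ∨
      ∃ j, D.b v j ≤ g.1 (D.a v₀ i) ∧ g.1 (D.b v₀ i) ≤ D.a v (j + 1) ∧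
        D.b' v j ≤ g.2 (D.a' v₀ i) ∧ g.2 (D.b' v₀ i) ≤ D.a' v (j + 1) := by
  rcases h with h | ⟨p, hp, w, x, hvw, hx, rfl⟩
  · obtain ⟨i, h⟩ := D.start v g h
    exact ⟨v, i, Or.inl h⟩
  · obtain ⟨v₀, i, m, h1, h2, h3, h4, h5⟩ := hx.exists_gap D
    have h2' := p.1.monotone h2
    have h3' := p.1.monotone h3
    have h4' := p.2.monotone h4
    have h5' := p.2.monotone h5
    refine ⟨v₀, i, ?_⟩
    simp only [Prod.fst_mul, Prod.snd_mul, RelIso.mul_apply]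
    rcases D.gap v p hp m with ⟨j, e1, e2, e3, e4⟩ | ⟨j, e1, e2, e3, e4⟩
    · exact Or.inr ⟨j, by linarith, by linarith, by linarith, by linarith⟩
    · exact Or.inl ⟨j, by linarith, by linarith, by linarith, by linarith⟩

/-- Some component has its two images in corresponding components or gaps, so they are at distance
at most `2 * C`. Returning from its left end points to `0` costs `c` for each action, and the
distance `C` between these end points; the stated constant is not sharp. -/
theorem dist_bounded (hG : G.Connected) {C c : ℝ} (hc : 0 < c)
    (hQ : ∀ v, ∀ p ∈ D.Q v, (∀ t, p.1 (t + c) = p.1 t + c) ∧ ∀ t, p.2 (t + c) = p.2 t + c)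
    (ha : ∀ v i, |D.a' v i - D.a v i| ≤ C) (hb : ∀ v i, |D.b' v i - D.b v i| ≤ C)
    (hab : ∀ v i, D.b v i ≤ D.a v i + C) (hba : ∀ v i, D.a v (i + 1) ≤ D.b v i + C)
    (hab' : ∀ v i, D.a v i ≤ D.b v i) (hab'' : ∀ v i, D.a' v i ≤ D.b' v i)
    {p : (ℝ ≃o ℝ) × (ℝ ≃o ℝ)} (hp : p ∈ ⨆ v, D.Q v) :
    |p.1 0 - p.2 0| ≤ 4 * C + 2 * c := by
  obtain ⟨v⟩ := hG.nonempty
  have hgood := D.good_of_mem hG v hp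
  have hcomm : (∀ t, p.1 (t + c) = p.1 t + c) ∧ ∀ t, p.2 (t + c) = p.2 t + c := by
    refine Subgroup.iSup_induction D.Q
      (C := fun p => (∀ t, p.1 (t + c) = p.1 t + c) ∧ ∀ t, p.2 (t + c) = p.2 t + c) hp hQ
      ⟨fun _ => rfl, fun _ => rfl⟩ ?_
    intro p q h1 h2
    simp only [Prod.fst_mul, Prod.snd_mul, RelIso.mul_apply]
    exact ⟨fun t => by rw [h2.1, h1.1], fun t => by rw [h2.2, h1.2]⟩
  obtain ⟨v₀, i, h⟩ := hgood.exists_position D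
  have e1 := abs_le.1 (abs_sub_le_of_commute hc hcomm.1 (D.a v₀ i))
  have e2 := abs_le.1 (abs_sub_le_of_commute hc hcomm.2 (D.a' v₀ i))
  have e3 := abs_le.1 (ha v₀ i)
  have e4 : |p.1 (D.a v₀ i) - p.2 (D.a' v₀ i)| ≤ 2 * C := by
    have m1 := p.1.monotone (hab' v₀ i)
    have m2 := p.2.monotone (hab'' v₀ i)
    rcases h with ⟨j, h1, h2, h3, h4⟩ | ⟨j, h1, h2, h3, h4⟩
    · have f1 := abs_le.1 (ha v j)
      have f2 := abs_le.1 (hb v j)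
      have f3 := hab v j
      rw [abs_le]; constructor <;> linarith
    · have f1 := abs_le.1 (ha v (j + 1))
      have f2 := abs_le.1 (hb v j)
      have f3 := hba v j
      rw [abs_le]; constructor <;> linarith
  rw [abs_le] at e4 ⊢
  constructor <;> linarith

end Tracking

end

section

/-! ### Words in lifts of generators -/

section Words

variable {Γ : Type*} [Group Γ] {S : Set Γ}

/-- The evaluation of words in the letters `S` and a central letter in a group. -/
def letterMap (S : Set Γ) {U : Type*} [Group U] (c : U) (F : Γ → U) :
    FreeGroup (Option S) →* U :=
  FreeGroup.lift fun o => o.elim c fun s => F s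

omit [Group Γ] in
theorem letterMap_none {U : Type*} [Group U] (c : U) (F : Γ → U) :
    letterMap S c F (FreeGroup.of none) = c := by simp [letterMap]

omit [Group Γ] in
theorem letterMap_some {U : Type*} [Group U] (c : U) (F : Γ → U) (s : S) :
    letterMap S c F (FreeGroup.of (some s)) = F s := by simp [letterMap]

omit [Group Γ] in
theorem map_letterMap {U U' : Type*} [Group U] [Group U'] (g : U →* U') (c : U) (F : Γ → U)
    (w : FreeGroup (Option S)) : g (letterMap S c F w) = letterMap S (g c) (g ∘ F) w := by
  rw [← MonoidHom.comp_apply]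
  congr 1
  ext o
  cases o <;> simp [letterMap_none, letterMap_some]

/-- The evaluation of words in the group generated by `S`. -/
def wordProd (S : Set Γ) : FreeGroup (Option S) →* Γ := letterMap S 1 id

theorem wordProd_surjective (hgen : Subgroup.closure S = ⊤) :
    Function.Surjective (wordProd S) := by
  rw [← MonoidHom.range_eq_top, ← top_le_iff, ← hgen, Subgroup.closure_le]
  intro s hs
  exact ⟨FreeGroup.of (some ⟨s, hs⟩), letterMap_some _ _ _⟩

/-- Cancelling `s` against `s⁻¹` leaves a power of `c`, which can be moved to the front because it
commutes with all letters. -/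
theorem exists_reduced_word {U : Type*} [Group U] {c : U} {F : Γ → U}
    (hS : ∀ s ∈ S, s⁻¹ ∈ S) (hF : ∀ s ∈ S, Commute (F s) c)
    (hrel : ∀ s ∈ S, ∃ n : ℤ, F s * F s⁻¹ = c ^ n) (w : FreeGroup (Option S)) :
    ∃ (n : ℤ) (l : List Γ), Reduced S l ∧ wordProd S w = l.prod ∧
      letterMap S c F w = c ^ n * (l.map F).prod := by
  let T (g : Γ) (u : U) : Prop := ∃ (n : ℤ) (l : List Γ), Reduced S l ∧ g = l.prod ∧
    u = c ^ n * (l.map F).prod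
  have hc : ∀ (m : ℤ) g u, T g u → T g (c ^ m * u) := by
    rintro m g u ⟨n, l, hl, h1, rfl⟩
    exact ⟨m + n, l, hl, h1, by rw [zpow_add, mul_assoc]⟩
  have hs : ∀ s ∈ S, ∀ g u, T g u → T (s * g) (F s * u) := by
    rintro s hs g u ⟨n, l, hl, rfl, rfl⟩
    rw [← mul_assoc, ((hF s hs).zpow_right n).eq, mul_assoc]
    refine hc n _ _ ?_
    rcases l with _ | ⟨t, l⟩
    · exact ⟨0, [s], ⟨by simpa using hs, by simp⟩, by simp, by simp⟩
    · by_cases hst : s * t = 1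
      · obtain ⟨m, hm⟩ := hrel s hs
        rw [eq_inv_of_mul_eq_one_right hst] at *
        refine ⟨m, l, hl.tail, by simp, ?_⟩
        rw [List.map_cons, List.prod_cons, ← mul_assoc, hm]
      · refine ⟨0, s :: t :: l, ⟨?_, List.isChain_cons_cons.2 ⟨hst, hl.2⟩⟩, by simp, by simp⟩
        intro x hx
        rcases List.mem_cons.1 hx with rfl | hx
        · exact hs
        · exact hl.1 x hx
  change T _ _
  suffices H : ∀ g u, T g u → T (wordProd S w * g) (letterMap S c F w * u) by
    simpa using H 1 1 ⟨0, [], ⟨by simp, by simp⟩, by simp, by simp⟩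
  induction w using FreeGroup.induction_on with
  | C1 => simp
  | of o =>
    intro g u h
    cases o with
    | none =>
      rw [letterMap_none, wordProd, letterMap_none, one_mul]
      simpa using hc 1 g u h
    | some s =>
      rw [letterMap_some, wordProd, letterMap_some]
      exact hs s s.2 g u h
  | inv_of o _ =>
    intro g u h
    rw [map_inv, map_inv]
    cases o with
    | none =>
      rw [letterMap_none, wordProd, letterMap_none, inv_one, one_mul]
      simpa using hc (-1) g u h
    | some s =>
      rw [letterMap_some, wordProd, letterMap_some]
      obtain ⟨m, hm⟩ := hrel s s.2
      have : (F s)⁻¹ = c ^ (-m) * F (s : Γ)⁻¹ := by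
        rw [inv_eq_iff_mul_eq_one, ← mul_assoc, ((hF s s.2).zpow_right _).eq, mul_assoc, hm,
          zpow_neg, inv_mul_cancel]
      rw [this, mul_assoc]
      exact hc _ _ _ (hs _ (hS s s.2) g u h)
  | mul x y hx hy =>
    intro g u h
    rw [map_mul, map_mul, mul_assoc, mul_assoc]
    exact hx _ _ (hy _ _ h)

end Words

/-! ### Tracking gaps and components under a perturbed action -/

theorem Enum.shift_a {P : Set Circ} (E : Enum P) (k : ℕ) (i n : ℤ) :
    E.a (i + E.N * (k * n)) = (shift k ^ n) (E.a i) := by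
  rw [E.a_add_mul, shift_zpow]; simp [mul_comm]

theorem Enum.shift_b {P : Set Circ} (E : Enum P) (k : ℕ) (i n : ℤ) :
    E.b (i + E.N * (k * n)) = (shift k ^ n) (E.b i) := by
  rw [E.b_add_mul, shift_zpow]; simp [mul_comm]

/-- The normal form is computed in the product group, so that one exponent `n` and one reduced word
serve both actions. -/
theorem exists_reduced_pair {Γ : Type*} [Group Γ] {S : Set Γ} {k : ℕ} {F F' : Γ → ℝ ≃o ℝ}
    (hS : ∀ s ∈ S, s⁻¹ ∈ S) (hF : ∀ s ∈ S, Commute (F s) (shift k))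
    (hF' : ∀ s ∈ S, Commute (F' s) (shift k))
    (hrel : ∀ s ∈ S, ∃ n : ℤ, F s * F s⁻¹ = shift k ^ n ∧ F' s * F' s⁻¹ = shift k ^ n)
    (w : FreeGroup (Option S)) :
    ∃ (n : ℤ) (l : List Γ), Reduced S l ∧ wordProd S w = l.prod ∧
      letterMap S (shift k) F w = shift k ^ n * (l.map F).prod ∧
      letterMap S (shift k) F' w = shift k ^ n * (l.map F').prod := by
  obtain ⟨n, l, hl, h1, h2⟩ := exists_reduced_word (U := (ℝ ≃o ℝ) × (ℝ ≃o ℝ))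
    (c := ((shift k : ℝ ≃o ℝ), (shift k : ℝ ≃o ℝ))) (F := fun s => (F s, F' s)) hS
    (fun s hs => Commute.prod (hF s hs) (hF' s hs)) (fun s hs => by
      obtain ⟨n, h1, h2⟩ := hrel s hs
      exact ⟨n, Prod.ext h1 h2⟩) w
  refine ⟨n, l, hl, h1, ?_, ?_⟩
  · have := congrArg (MonoidHom.fst (ℝ ≃o ℝ) (ℝ ≃o ℝ)) h2
    rw [map_letterMap, map_mul, map_list_prod, List.map_map] at this
    exact this
  · have := congrArg (MonoidHom.snd (ℝ ≃o ℝ) (ℝ ≃o ℝ)) h2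
    rw [map_letterMap, map_mul, map_list_prod, List.map_map] at this
    exact this

/-- Lifts of the generators, their perturbations, and perturbed end points of gaps that have the
same combinatorics. -/
structure Perturbed {Γ : Type*} [Group Γ] {S : Set Γ} {φ : Γ →* HomeoPlus} {P : Set Circ}
    (h : IsPureBP S φ P) (E : Enum P) (k : ℕ) (F F' : Γ → ℝ ≃o ℝ) where
  symm : ∀ s ∈ S, s⁻¹ ∈ S
  lift : ∀ s ∈ S, IsLift (F s) (φ s)
  commute : ∀ s ∈ S, Commute (F s) (shift k)
  commute' : ∀ s ∈ S, Commute (F' s) (shift k)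
  rel : ∀ s ∈ S, ∃ n : ℤ, F s * F s⁻¹ = shift k ^ n ∧ F' s * F' s⁻¹ = shift k ^ n
  a' : ℤ → ℝ
  b' : ℤ → ℝ
  a_lt_b : ∀ i, a' i < b' i
  b_lt_a : ∀ i, b' i < a' (i + 1)
  equivariant : ∀ (w : FreeGroup (Option S)) i j, letterMap S (shift k) F w (E.b i) = E.b j →
    letterMap S (shift k) F w (E.a (i + 1)) = E.a (j + 1) →
    letterMap S (shift k) F' w (b' i) = b' j ∧ letterMap S (shift k) F' w (a' (i + 1)) = a' (j + 1)
  inside : ∀ s ∈ S, ∀ i j, E.a j < F s (E.b i) → F s (E.a (i + 1)) < E.b j →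
    a' j < F' s (b' i) ∧ F' s (a' (i + 1)) < b' j

namespace Perturbed

variable {Γ : Type*} [Group Γ] {S : Set Γ} {φ : Γ →* HomeoPlus} {P : Set Circ}
  {h : IsPureBP S φ P} {E : Enum P} {k : ℕ} {F F' : Γ → ℝ ≃o ℝ} (D : Perturbed h E k F F')

include D

theorem shift_gap (i n : ℤ) : D.b' (i + E.N * (k * n)) = (shift k ^ n) (D.b' i) ∧
    D.a' (i + E.N * (k * n) + 1) = (shift k ^ n) (D.a' (i + 1)) := by
  have e := D.equivariant (FreeGroup.of none ^ n) i (i + E.N * (k * n))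
  simp only [map_zpow, letterMap_none] at e
  obtain ⟨h1, h2⟩ := e (E.shift_b k i n).symm (by
    rw [show i + E.N * (k * n) + 1 = i + 1 + E.N * (k * n) by ring, E.shift_a k])
  exact ⟨h1.symm, h2.symm⟩

theorem shift_b' (i n : ℤ) : D.b' (i + E.N * (k * n)) = (shift k ^ n) (D.b' i) :=
  (D.shift_gap i n).1

theorem shift_a' (i n : ℤ) : D.a' (i + E.N * (k * n)) = (shift k ^ n) (D.a' i) := by
  have := (D.shift_gap (i - 1) n).2
  rwa [show i - 1 + E.N * (k * n) + 1 = i + E.N * (k * n) by ring,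
    sub_add_cancel] at this

/-- The component `i` lies between the gaps `i - 1` and `i`. The perturbed copies of these gaps
follow the original ones, by `equivariant` or by `inside`, and in each case the numbers involved are
forced to fit the same `j`. -/
theorem comp {s : Γ} (hs : s ∈ S) {i : ℤ} (hi : s ≠ label h E i) :
    ∃ j, label h E j = s⁻¹ ∧ E.a j ≤ F s (E.a i) ∧ F s (E.b i) ≤ E.b j ∧
      D.a' j ≤ F' s (D.a' i) ∧ F' s (D.b' i) ≤ D.b' j := by
  obtain ⟨j, h1, h2, h3, -⟩ := lift_comp h E D.symm hs (D.lift s hs) hi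
  have hab := (F s).strictMono (E.a_lt_b i)
  refine ⟨j, h1, h2, h3, ?_, ?_⟩
  · rcases lift_gap h E hs (D.lift s hs) (i - 1) with ⟨m, e1, e2⟩ | ⟨m, e1, e2⟩
    · have := (D.equivariant (FreeGroup.of (some ⟨s, hs⟩)) (i - 1) m
        (by rw [letterMap_some]; exact e1) (by rw [letterMap_some]; exact e2)).2
      rw [letterMap_some] at this
      rw [sub_add_cancel] at e2 this
      have e3 := E.a_strictMono.le_iff_le.1 (e2 ▸ h2)
      have e4 := E.le_of_a_le_b ((e2 ▸ hab).le.trans h3)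
      have : j = m + 1 := by omega
      subst this
      exact this.ge
    · have := D.inside s hs _ _ e1 e2
      rw [sub_add_cancel] at e2 this
      have e3 := E.le_of_a_le_b (h2.trans e2.le)
      have hba := (F s).strictMono (E.b_lt_a (i - 1))
      rw [sub_add_cancel] at hba
      have e4 := E.le_of_a_le_b ((e1.trans (hba.trans hab)).le.trans h3)
      have : j = m := by omega
      subst this
      have hba' := (F' s).strictMono (D.b_lt_a (i - 1))
      rw [sub_add_cancel] at hba'
      linarith
  · rcases lift_gap h E hs (D.lift s hs) i with ⟨m, e1, e2⟩ | ⟨m, e1, e2⟩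
    · have := (D.equivariant (FreeGroup.of (some ⟨s, hs⟩)) i m
        (by rw [letterMap_some]; exact e1) (by rw [letterMap_some]; exact e2)).1
      rw [letterMap_some] at this
      have e3 := E.b_strictMono.le_iff_le.1 (e1 ▸ h3)
      have e4 := E.le_of_a_le_b (h2.trans (e1 ▸ hab).le)
      have : j = m := by omega
      subst this
      exact this.le
    · have := D.inside s hs _ _ e1 e2
      have hba := (F s).strictMono (E.b_lt_a i)
      have e3 := E.le_of_a_le_b (h2.trans (hab.trans (hba.trans e2)).le)
      have e4 := E.le_of_a_le_b (e1.le.trans h3)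
      have : j = m := by omega
      subst this
      have hba' := (F' s).strictMono (D.b_lt_a i)
      linarith

theorem list_comp {l : List Γ} (hl : Reduced S l) {i : ℤ}
    (hli : (l ++ [(label h E i)⁻¹]).IsChain fun x y => x * y ≠ 1) :
    ∃ j, (∃ s l', l ++ [(label h E i)⁻¹] = s :: l' ∧ label h E j = s⁻¹) ∧
      E.a j ≤ (l.map F).prod (E.a i) ∧ (l.map F).prod (E.b i) ≤ E.b j ∧
      D.a' j ≤ (l.map F').prod (D.a' i) ∧ (l.map F').prod (D.b' i) ≤ D.b' j := by
  induction l with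
  | nil => exact ⟨i, ⟨_, [], rfl, (inv_inv _).symm⟩, le_rfl, le_rfl, le_rfl, le_rfl⟩
  | cons s l ih =>
    have hs : s ∈ S := hl.1 s (by simp)
    obtain ⟨j, ⟨r, l', h3, h4⟩, h5, h6, h7, h8⟩ := ih hl.tail hli.tail
    have hsj : s ≠ label h E j := by
      rw [List.cons_append, h3] at hli
      have := (List.isChain_cons_cons.1 hli).1
      rw [h4]
      intro hcon
      exact this (by rw [hcon, inv_mul_cancel])
    obtain ⟨m, e1, e2, e3, e4, e5⟩ := D.comp hs hsj
    refine ⟨m, ⟨s, _, rfl, e1⟩, ?_⟩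
    simp only [List.map_cons, List.prod_cons (a := F s), List.prod_cons (a := F' s),
      RelIso.mul_apply]
    exact ⟨e2.trans ((F s).monotone h5), ((F s).monotone h6).trans e3,
      e4.trans ((F' s).monotone h7), ((F' s).monotone h8).trans e5⟩

/-- As in `Coding.position`, a gap that has entered a component stays in components; now the
perturbed gap is followed at the same time. -/
theorem list_gap {l : List Γ} (hl : Reduced S l) (i : ℤ) :
    (∃ j, (l.map F).prod (E.b i) = E.b j ∧ (l.map F).prod (E.a (i + 1)) = E.a (j + 1) ∧
      (l.map F').prod (D.b' i) = D.b' j ∧ (l.map F').prod (D.a' (i + 1)) = D.a' (j + 1)) ∨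
    ∃ j, (∃ s l', l = s :: l' ∧ label h E j = s⁻¹) ∧
      E.a j ≤ (l.map F).prod (E.b i) ∧ (l.map F).prod (E.a (i + 1)) ≤ E.b j ∧
      D.a' j ≤ (l.map F').prod (D.b' i) ∧ (l.map F').prod (D.a' (i + 1)) ≤ D.b' j := by
  induction l with
  | nil => exact Or.inl ⟨i, rfl, rfl, rfl, rfl⟩
  | cons s l ih =>
    have hs : s ∈ S := hl.1 s (by simp)
    simp only [List.map_cons, List.prod_cons (a := F s), List.prod_cons (a := F' s),
      RelIso.mul_apply]
    rcases ih hl.tail with ⟨j, h1, h2, h3, h4⟩ | ⟨j, ⟨r, l', rfl, h3⟩, h4, h5, h6, h7⟩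
    · rw [h1, h2, h3, h4]
      rcases lift_gap_label h E D.symm hs (D.lift s hs) j with ⟨m, e1, e2⟩ | ⟨m, e0, e1, e2⟩
      · left
        have := D.equivariant (FreeGroup.of (some ⟨s, hs⟩)) j m
          (by rw [letterMap_some]; exact e1) (by rw [letterMap_some]; exact e2)
        rw [letterMap_some] at this
        exact ⟨m, e1, e2, this⟩
      · right
        have := D.inside s hs _ _ e1 e2
        exact ⟨m, ⟨s, _, rfl, e0⟩, e1.le, e2.le, this.1.le, this.2.le⟩
    · right
      have hsj : s ≠ label h E j := by
        have := (List.isChain_cons_cons.1 hl.2).1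
        rw [h3]
        intro hcon
        exact this (by rw [hcon, inv_mul_cancel])
      obtain ⟨m, e1, e2, e3, e4, e5⟩ := D.comp hs hsj
      exact ⟨m, ⟨s, _, rfl, e1⟩, e2.trans ((F s).monotone h4), ((F s).monotone h5).trans e3,
        e4.trans ((F' s).monotone h6), ((F' s).monotone h7).trans e5⟩

theorem word_gap (w : FreeGroup (Option S)) (i : ℤ) :
    (∃ j, letterMap S (shift k) F w (E.b i) = E.b j ∧
      letterMap S (shift k) F w (E.a (i + 1)) = E.a (j + 1) ∧
      letterMap S (shift k) F' w (D.b' i) = D.b' j ∧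
      letterMap S (shift k) F' w (D.a' (i + 1)) = D.a' (j + 1)) ∨
    ∃ j, E.a j ≤ letterMap S (shift k) F w (E.b i) ∧
      letterMap S (shift k) F w (E.a (i + 1)) ≤ E.b j ∧
      D.a' j ≤ letterMap S (shift k) F' w (D.b' i) ∧
      letterMap S (shift k) F' w (D.a' (i + 1)) ≤ D.b' j := by
  obtain ⟨n, l, hl, -, h1, h2⟩ := exists_reduced_pair D.symm D.commute D.commute' D.rel w
  rw [h1, h2]
  simp only [RelIso.mul_apply]
  rcases D.list_gap hl i with ⟨j, e1, e2, e3, e4⟩ | ⟨j, -, e1, e2, e3, e4⟩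
  · left
    refine ⟨j + E.N * (k * n), ?_⟩
    rw [show j + E.N * (k * n) + 1 = j + 1 + E.N * (k * n) by ring, E.shift_a k,
      E.shift_b k, D.shift_a', D.shift_b', e1, e2, e3, e4]
    exact ⟨rfl, rfl, rfl, rfl⟩
  · right
    refine ⟨j + E.N * (k * n), ?_⟩
    rw [E.shift_a k, E.shift_b k, D.shift_a', D.shift_b']
    simp only [OrderIso.le_iff_le]
    exact ⟨e1, e2, e3, e4⟩

theorem word_comp (w : FreeGroup (Option S)) :
    ∃ i j, E.a j ≤ letterMap S (shift k) F w (E.a i) ∧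
      letterMap S (shift k) F w (E.b i) ≤ E.b j ∧
      D.a' j ≤ letterMap S (shift k) F' w (D.a' i) ∧
      letterMap S (shift k) F' w (D.b' i) ≤ D.b' j := by
  obtain ⟨n, l, hl, -, h1, h2⟩ := exists_reduced_pair D.symm D.commute D.commute' D.rel w
  rw [h1, h2]
  simp only [RelIso.mul_apply]
  -- A starting component that is not expanded by the letter acting first.
  obtain ⟨i, hi⟩ : ∃ i, (l ++ [(label h E i)⁻¹]).IsChain fun x y => x * y ≠ 1 := by
    rcases List.eq_nil_or_concat l with rfl | ⟨l', s, rfl⟩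
    · exact ⟨0, by simp⟩
    · obtain ⟨i, hi⟩ := exists_label_ne h E s
      refine ⟨i, List.isChain_append.2 ⟨hl.2, by simp, ?_⟩⟩
      intro a ha b hb
      simp at ha hb
      subst ha hb
      intro hcon
      rw [mul_inv_eq_one] at hcon
      exact hi hcon.symm
  obtain ⟨j, -, e1, e2, e3, e4⟩ := D.list_comp hl hi
  refine ⟨i, j + E.N * (k * n), ?_⟩
  rw [E.shift_a k, E.shift_b k, D.shift_a', D.shift_b']
  simp only [OrderIso.le_iff_le]
  exact ⟨e1, e2, e3, e4⟩

end Perturbed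

end

/-! ### Equivariant perturbation of attracting and repelling fixed points -/

theorem exists_fixed_of_attracts {F : ℝ ≃o ℝ} {r₁ r₂ : ℝ} (hr : r₁ < r₂)
    (h : (r₁ < F r₁ ∧ F r₂ < r₂) ∨ (r₁ < F⁻¹ r₁ ∧ F⁻¹ r₂ < r₂)) :
    ∃ p, r₁ < p ∧ p < r₂ ∧ F p = p := by
  have key : ∀ F : ℝ ≃o ℝ, r₁ < F r₁ → F r₂ < r₂ → ∃ p, r₁ < p ∧ p < r₂ ∧ F p = p := by
    intro F h1 h2
    have hc : ContinuousOn (fun t => F t - t) (Icc r₁ r₂) :=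
      (F.continuous.sub continuous_id).continuousOn
    obtain ⟨p, hp, hp'⟩ := intermediate_value_Icc' hr.le hc
      (show (0 : ℝ) ∈ Icc (F r₂ - r₂) (F r₁ - r₁) from ⟨by linarith, by linarith⟩)
    have hp' : F p = p := by simpa [sub_eq_zero] using hp'
    refine ⟨p, lt_of_le_of_ne hp.1 ?_, lt_of_le_of_ne hp.2 ?_, hp'⟩
    · rintro rfl; exact h1.ne' hp'
    · rintro rfl; exact h2.ne hp'
  rcases h with ⟨h1, h2⟩ | ⟨h1, h2⟩
  · exact key F h1 h2
  · obtain ⟨p, hp1, hp2, hp⟩ := key F⁻¹ h1 h2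
    refine ⟨p, hp1, hp2, ?_⟩
    conv_lhs => rw [← hp]
    exact RelIso.apply_inv_self _ _

theorem zpow_fixed {F : ℝ ≃o ℝ} {p : ℝ} (h : F p = p) (n : ℤ) : (F ^ n) p = p := by
  have h' : F⁻¹ p = p := by
    conv_lhs => rw [← h]
    exact RelIso.inv_apply_self _ _
  induction n with
  | zero => rfl
  | succ n ih => rw [zpow_add_one, RelIso.mul_apply, h, ih]
  | pred n ih => rw [zpow_sub_one, RelIso.mul_apply, h', ih]

/-- The orbit of a moved point under an increasing map is strictly monotone, so it never returns. -/
theorem fixed_of_zpow_fixed {F : ℝ ≃o ℝ} {p : ℝ} {m : ℤ} (hm : m ≠ 0) (h : (F ^ m) p = p) :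
    F p = p := by
  have hnat : ∀ n : ℕ, n ≠ 0 → (F ^ n) p = p → F p = p := by
    intro n hn hp
    by_contra hne
    rcases lt_or_gt_of_ne hne with hlt | hlt
    · have : ∀ n : ℕ, (F ^ (n + 1)) p < p := by
        intro n
        induction n with
        | zero => simpa using hlt
        | succ n ih =>
          rw [pow_succ', RelIso.mul_apply]
          exact (F.strictMono ih).trans hlt
      obtain ⟨n, rfl⟩ := Nat.exists_eq_succ_of_ne_zero hn
      exact (this n).ne hp
    · have : ∀ n : ℕ, p < (F ^ (n + 1)) p := by
        intro n
        induction n with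
        | zero => simpa using hlt
        | succ n ih =>
          rw [pow_succ', RelIso.mul_apply]
          exact hlt.trans (F.strictMono ih)
      obtain ⟨n, rfl⟩ := Nat.exists_eq_succ_of_ne_zero hn
      exact (this n).ne' hp
  have h2 : (F ^ (-m)) p = p := by
    rw [zpow_neg]
    conv_lhs => rw [← h]
    exact RelIso.inv_apply_self _ _
  rcases Int.natAbs_eq m with e | e
  · refine hnat m.natAbs (by omega) ?_
    rw [← zpow_natCast, ← e]; exact h
  · refine hnat m.natAbs (by omega) ?_
    rw [← zpow_natCast, show (m.natAbs : ℤ) = -m by omega]; exact h2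

/-- Convergence of a family of actions on the line to a given action. -/
def Converges {Ω Q : Type*} [Group Q] (l : Filter Ω) (f' : Ω → Q →* (ℝ ≃o ℝ))
    (f : Q →* (ℝ ≃o ℝ)) : Prop :=
  ∀ q t, Filter.Tendsto (fun ω => f' ω q t) l (𝓝 (f q t))

/-- Let a group act on the line, and let the maps `q i` be attracting or repelling at the points
`pt i s`. Then these points persist under small perturbations of the action, equivariantly and
with given bounds. -/
theorem exists_equivariant {Q Ω ι κ : Type*} [Group Q] [Finite κ] {l : Filter Ω}
    {f : Q →* (ℝ ≃o ℝ)} {f' : Ω → Q →* (ℝ ≃o ℝ)} (hf : Converges l f' f)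
    (pt : ι → κ → ℝ) {R : Set ι} (hRfin : R.Finite)
    (hR : ∀ i, ∃ r ∈ R, ∃ q, ∀ s, f q (pt r s) = pt i s)
    {A : Set ℝ} (hA : ∀ q, ∀ t ∈ A, f q t ∈ A) (q : ι → Q)
    (hstab : ∀ᶠ ω in l, ∀ i q', (∀ s, f q' (pt i s) = pt i s) →
      ∃ m n : ℤ, m ≠ 0 ∧ f' ω q' ^ m = f' ω (q i) ^ n)
    (hrob : ∀ T ⊆ A, T.Finite → ∃ r₁ r₂ : ι → κ → ℝ, ∀ i s,
      r₁ i s < pt i s ∧ pt i s < r₂ i s ∧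
      (∀ t ∈ T, t < pt i s → t ≤ r₁ i s) ∧ (∀ t ∈ T, pt i s < t → r₂ i s ≤ t) ∧
      ((r₁ i s < f (q i) (r₁ i s) ∧ f (q i) (r₂ i s) < r₂ i s) ∨
        (r₁ i s < f (q i)⁻¹ (r₁ i s) ∧ f (q i)⁻¹ (r₂ i s) < r₂ i s)) ∧
      ∀ s', pt i s < pt i s' → r₂ i s < r₁ i s')
    {Lo Up : Set (ι × κ × ℝ)} (hLofin : Lo.Finite) (hUpfin : Up.Finite)
    (hLo : ∀ x ∈ Lo, ∃ t ∈ A, x.2.2 < t ∧ t < pt x.1 x.2.1)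
    (hUp : ∀ x ∈ Up, ∃ t ∈ A, pt x.1 x.2.1 < t ∧ t < x.2.2) :
    ∀ᶠ ω in l, ∃ p : ι → κ → ℝ,
      (∀ q i j, (∀ s, f q (pt i s) = pt j s) → ∀ s, f' ω q (p i s) = p j s) ∧
      (∀ x ∈ Lo, x.2.2 < p x.1 x.2.1) ∧ (∀ x ∈ Up, p x.1 x.2.1 < x.2.2) ∧
      ∀ i s s', pt i s < pt i s' → p i s < p i s' := by
  classical
  let rel : Setoid ι :=
    { r := fun i j => ∃ q, ∀ s, f q (pt i s) = pt j s
      iseqv := by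
        refine ⟨fun i => ⟨1, fun s => by simp⟩, ?_, ?_⟩
        · rintro i j ⟨q, hq⟩
          refine ⟨q⁻¹, fun s => ?_⟩
          rw [map_inv, ← hq s]; exact RelIso.inv_apply_self _ _
        · rintro i j m ⟨q, hq⟩ ⟨q', hq'⟩
          exact ⟨q' * q, fun s => by rw [map_mul, RelIso.mul_apply, hq, hq']⟩ }
  -- Each orbit gets one representative `ρ i` in the finite set `R`, and `w i` transports it to `i`.
  -- The perturbed points will be chosen at the representatives and transported by the perturbed `w
  -- i`.
  choose ρ' hρ'R hρ' using fun x : Quotient rel => hR x.out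
  let ρ : ι → ι := fun i => ρ' ⟦i⟧
  have hρR : ∀ i, ρ i ∈ R := fun i => hρ'R _
  have hρeq : ∀ i j, (∃ q, ∀ s, f q (pt i s) = pt j s) → ρ i = ρ j := by
    intro i j hij
    exact congrArg ρ' (Quotient.sound hij)
  have hρ : ∀ i, ∃ w, ∀ s, f w (pt (ρ i) s) = pt i s := by
    intro i
    exact rel.trans (hρ' ⟦i⟧) (Quotient.exact (Quotient.out_eq ⟦i⟧))
  choose w hw using hρ
  have hinv : ∀ i t, f (w i) (f (w i)⁻¹ t) = t := fun i t => by
    rw [map_inv]; exact RelIso.apply_inv_self _ _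
  choose! tl htlA htl1 htl2 using hLo
  choose! tu htuA htu1 htu2 using hUp
  -- The barriers for the required bounds are pulled back to the representatives; the intervals
  -- `[r₁, r₂]` do not pass beyond them.
  obtain ⟨r₁, r₂, hr⟩ := hrob
    ((fun x => f (w x.1)⁻¹ (tl x)) '' Lo ∪ (fun x => f (w x.1)⁻¹ (tu x)) '' Up) (by
      rintro _ (⟨x, hx, rfl⟩ | ⟨x, hx, rfl⟩)
      · exact hA _ _ (htlA x hx)
      · exact hA _ _ (htuA x hx)) ((hLofin.image _).union (hUpfin.image _))
  have hcross : ∀ q t c, t < f q c → ∀ᶠ ω in l, t < f' ω q c := fun q t c h =>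
    (hf q c).eventually_const_lt h
  have hcross' : ∀ q t c, f q c < t → ∀ᶠ ω in l, f' ω q c < t := fun q t c h =>
    (hf q c).eventually_lt_const h
  have hfix : ∀ᶠ ω in l, ∀ r ∈ R, ∀ s, ∃ p, r₁ r s < p ∧ p < r₂ r s ∧ f' ω (q r) p = p := by
    rw [Filter.eventually_all_finite hRfin]
    intro r _
    rw [Filter.eventually_all]
    intro s
    obtain ⟨h1, h2, -, -, h3, -⟩ := hr r s
    rcases h3 with ⟨h3, h4⟩ | ⟨h3, h4⟩
    · filter_upwards [hcross _ _ _ h3, hcross' _ _ _ h4] with ω h5 h6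
      exact exists_fixed_of_attracts (h1.trans h2) (Or.inl ⟨h5, h6⟩)
    · filter_upwards [hcross _ _ _ h3, hcross' _ _ _ h4] with ω h5 h6
      rw [map_inv] at h5 h6
      exact exists_fixed_of_attracts (h1.trans h2) (Or.inr ⟨h5, h6⟩)
  have hLo' : ∀ᶠ ω in l, ∀ x ∈ Lo, x.2.2 < f' ω (w x.1) (f (w x.1)⁻¹ (tl x)) := by
    rw [Filter.eventually_all_finite hLofin]
    intro x hx
    refine hcross _ _ _ ?_
    rw [hinv]; exact htl1 x hx
  have hUp' : ∀ᶠ ω in l, ∀ x ∈ Up, f' ω (w x.1) (f (w x.1)⁻¹ (tu x)) < x.2.2 := by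
    rw [Filter.eventually_all_finite hUpfin]
    intro x hx
    refine hcross' _ _ _ ?_
    rw [hinv]; exact htu2 x hx
  filter_upwards [hfix, hLo', hUp', hstab] with ω hfix hLo' hUp' hstab
  choose! p₀ hp1 hp2 hp3 using hfix
  refine ⟨fun i s => f' ω (w i) (p₀ (ρ i) s), ?_, ?_, ?_, ?_⟩
  · intro g i j hij s
    have hρij := hρeq i j ⟨g, hij⟩
    -- The transports agree up to an element fixing the representative; a power of it is a power of
    -- the perturbed `q`, so it fixes the chosen point `p₀`.
    have hfixq : ∀ s, f ((w j)⁻¹ * g * w i) (pt (ρ i) s) = pt (ρ i) s := by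
      intro s
      rw [map_mul, map_mul, RelIso.mul_apply, RelIso.mul_apply, hw, hij, ← hw j, hρij, map_inv]
      exact RelIso.inv_apply_self _ _
    obtain ⟨m, n, hm, hmn⟩ := hstab _ _ hfixq
    have h1 : f' ω ((w j)⁻¹ * g * w i) (p₀ (ρ i) s) = p₀ (ρ i) s := by
      refine fixed_of_zpow_fixed hm ?_
      rw [hmn]
      exact zpow_fixed (hp3 _ (hρR i) s) n
    rw [map_mul, map_mul, RelIso.mul_apply, RelIso.mul_apply, map_inv] at h1
    change f' ω g (f' ω (w i) (p₀ (ρ i) s)) = f' ω (w j) (p₀ (ρ j) s)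
    have h2 := congrArg (f' ω (w j)) h1
    rw [show f' ω (w j) ((f' ω (w j))⁻¹ (f' ω g (f' ω (w i) (p₀ (ρ i) s)))) =
      f' ω g (f' ω (w i) (p₀ (ρ i) s)) from RelIso.apply_inv_self _ _] at h2
    rw [← hρij]
    exact h2
  · intro x hx
    have hlt : f (w x.1)⁻¹ (tl x) < pt (ρ x.1) x.2.1 := by
      rw [← (f (w x.1)).lt_iff_lt, hinv, hw]; exact htl2 x hx
    have h1 := (hr (ρ x.1) x.2.1).2.2.1 _ (Or.inl ⟨x, hx, rfl⟩) hlt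
    exact (hLo' x hx).trans ((f' ω (w x.1)).strictMono (h1.trans_lt (hp1 _ (hρR _) _)))
  · intro x hx
    have hlt : pt (ρ x.1) x.2.1 < f (w x.1)⁻¹ (tu x) := by
      rw [← (f (w x.1)).lt_iff_lt, hinv, hw]; exact htu1 x hx
    have h1 := (hr (ρ x.1) x.2.1).2.2.2.1 _ (Or.inr ⟨x, hx, rfl⟩) hlt
    exact ((f' ω (w x.1)).strictMono ((hp2 _ (hρR _) _).trans_le h1)).trans (hUp' x hx)
  · intro i s s' hss
    refine (f' ω (w i)).strictMono ?_
    have hlt : pt (ρ i) s < pt (ρ i) s' := by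
      rw [← (f (w i)).lt_iff_lt, hw, hw]; exact hss
    exact (hp2 _ (hρR i) s).trans (((hr (ρ i) s).2.2.2.2.2 s' hlt).trans (hp1 _ (hρR i) s'))

section

/-! ### Convergence of lifts -/

/-- `F` is the conjugate by the multiplication by `k` of a lift of `f`. -/
def IsScaledLift (k : ℕ) (F : ℝ ≃o ℝ) (f : HomeoPlus) : Prop :=
  ∃ F₀, IsLift F₀ f ∧ ∀ t, F (k * t) = k * F₀ t

namespace IsScaledLift

variable {k : ℕ} {F H : ℝ ≃o ℝ} {f h : HomeoPlus}

theorem one : IsScaledLift k 1 1 := ⟨1, IsLift.one, fun _ => rfl⟩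

theorem mul (hF : IsScaledLift k F f) (hH : IsScaledLift k H h) : IsScaledLift k (F * H) (f * h) := by
  obtain ⟨F₀, h1, h2⟩ := hF
  obtain ⟨H₀, h3, h4⟩ := hH
  exact ⟨F₀ * H₀, h1.mul h3, fun t => by simp only [RelIso.mul_apply, h4, h2]⟩

theorem inv (hF : IsScaledLift k F f) : IsScaledLift k F⁻¹ f⁻¹ := by
  obtain ⟨F₀, h1, h2⟩ := hF
  refine ⟨F₀⁻¹, h1.inv, fun t => ?_⟩
  apply F.injective
  rw [RelIso.apply_inv_self, h2, RelIso.apply_inv_self]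

theorem shift : IsScaledLift k (shift k) 1 := by
  refine ⟨_, IsLift.one.shift_mul 1, fun t => ?_⟩
  simp; ring

theorem unique (hk : 1 ≤ k) (hF : IsScaledLift k F f) (hH : IsScaledLift k H f) :
    ∃ n : ℤ, F = BasicPartition.shift k ^ n * H := by
  have hk' : (k : ℝ) ≠ 0 := by positivity
  obtain ⟨F₀, h1, h2⟩ := hF
  obtain ⟨H₀, h3, h4⟩ := hH
  obtain ⟨n, hn⟩ := h3.unique h1
  refine ⟨n, ?_⟩
  ext t
  obtain ⟨t, rfl⟩ : ∃ x, t = k * x := ⟨t / k, by field_simp⟩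
  rw [RelIso.mul_apply, h2, h4, hn, shift_zpow]
  simp; ring

theorem commute (hF : IsScaledLift k F f) (hk : 1 ≤ k) : Commute F (BasicPartition.shift k) := by
  have hk' : (k : ℝ) ≠ 0 := by positivity
  obtain ⟨F₀, h1, h2⟩ := hF
  ext t
  obtain ⟨t, rfl⟩ : ∃ x, t = k * x := ⟨t / k, by field_simp⟩
  simp only [RelIso.mul_apply, h2, OrderIso.addRight_apply]
  rw [show (k : ℝ) * t + k = k * (t + 1) by ring, h2, h1.add_one]; ring

/-- The reason for the scaling: multiplication by `k` on the line covers the map `x ↦ k x` of the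
circle, which carries `ψ g` to `φ g`. -/
theorem isLift {G : Type*} [Group G] {ψ φ : G →* HomeoPlus} (hψ : IsFoldLift k ψ φ) (hk : 1 ≤ k)
    {g : G} (hF : IsScaledLift k F (ψ g)) : IsLift F (φ g) := by
  have hk' : (k : ℝ) ≠ 0 := by positivity
  obtain ⟨F₀, h1, h2⟩ := hF
  intro t
  obtain ⟨t, rfl⟩ : ∃ x, t = k * x := ⟨t / k, by field_simp⟩
  have := hψ g (t : Circ)
  rw [h1, ← AddCircle.coe_nsmul, ← AddCircle.coe_nsmul, nsmul_eq_mul, nsmul_eq_mul] at this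
  rw [this, h2]

theorem letterMap {Γ : Type*} [Group Γ] {S : Set Γ} {θ : Γ →* HomeoPlus} {F : Γ → ℝ ≃o ℝ}
    (hF : ∀ s ∈ S, IsScaledLift k (F s) (θ s)) (w : FreeGroup (Option S)) :
    IsScaledLift k (letterMap S (BasicPartition.shift k) F w) (θ (wordProd S w)) := by
  induction w using FreeGroup.induction_on with
  | C1 => rw [map_one, map_one, map_one]; exact one
  | of o =>
    cases o with
    | none => rw [letterMap_none, wordProd, letterMap_none, map_one]; exact shift
    | some s => rw [letterMap_some, wordProd, letterMap_some]; exact hF s s.2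
  | inv_of o ih => rw [map_inv, map_inv, map_inv]; exact ih.inv
  | mul x y hx hy => rw [map_mul, map_mul, map_mul]; exact hx.mul hy

end IsScaledLift

/-- For increasing maps pointwise convergence passes to products: the moving argument is replaced by
a fixed point `x` on the right side of it. -/
theorem tendsto_mul {Ω : Type*} {l : Filter Ω} {F H : ℝ ≃o ℝ} {F' H' : Ω → ℝ ≃o ℝ}
    (hF : ∀ t, Filter.Tendsto (fun ω => F' ω t) l (𝓝 (F t)))
    (hH : ∀ t, Filter.Tendsto (fun ω => H' ω t) l (𝓝 (H t))) (t : ℝ) :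
    Filter.Tendsto (fun ω => (F' ω * H' ω) t) l (𝓝 ((F * H) t)) := by
  rw [tendsto_order]
  have e : ∀ x, F (F⁻¹ x) = x := RelIso.apply_inv_self F
  constructor
  · intro y hy
    rw [RelIso.mul_apply, ← e y, F.lt_iff_lt] at hy
    obtain ⟨x, h1, h2⟩ := exists_between hy
    have h3 : y < F x := by rw [← e y]; exact F.strictMono h1
    filter_upwards [(hF x).eventually_const_lt h3, (hH t).eventually_const_lt h2] with ω h4 h5
    exact h4.trans ((F' ω).strictMono h5)
  · intro y hy
    rw [gt_iff_lt, RelIso.mul_apply, ← e y, F.lt_iff_lt] at hy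
    obtain ⟨x, h1, h2⟩ := exists_between hy
    have h3 : F x < y := by rw [← e y]; exact F.strictMono h2
    filter_upwards [(hF x).eventually_lt_const h3, (hH t).eventually_lt_const h1] with ω h4 h5
    exact ((F' ω).strictMono h5).trans h4

theorem tendsto_inv {Ω : Type*} {l : Filter Ω} {F : ℝ ≃o ℝ} {F' : Ω → ℝ ≃o ℝ}
    (hF : ∀ t, Filter.Tendsto (fun ω => F' ω t) l (𝓝 (F t))) (t : ℝ) :
    Filter.Tendsto (fun ω => (F' ω)⁻¹ t) l (𝓝 (F⁻¹ t)) := by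
  have e : ∀ (F : ℝ ≃o ℝ) x, F (F⁻¹ x) = x := fun F => RelIso.apply_inv_self F
  rw [tendsto_order]
  constructor
  · intro y hy
    rw [← F.lt_iff_lt, e] at hy
    filter_upwards [(hF y).eventually_lt_const hy] with ω h
    rwa [← (F' ω).lt_iff_lt, e]
  · intro y hy
    rw [gt_iff_lt, ← F.lt_iff_lt, e] at hy
    filter_upwards [(hF y).eventually_const_lt hy] with ω h
    rwa [← (F' ω).lt_iff_lt, e]

theorem converges_letterMap {Ω Γ : Type*} {S : Set Γ} {l : Filter Ω} {c : ℝ ≃o ℝ}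
    {F : Γ → ℝ ≃o ℝ} {F' : Ω → Γ → ℝ ≃o ℝ}
    (hF : ∀ s ∈ S, ∀ t, Filter.Tendsto (fun ω => F' ω s t) l (𝓝 (F s t))) :
    Converges l (fun ω => letterMap S c (F' ω)) (letterMap S c F) := by
  intro w
  induction w using FreeGroup.induction_on with
  | C1 => intro t; simp only [map_one]; exact tendsto_const_nhds
  | of o =>
    intro t
    cases o with
    | none => simp only [letterMap_none]; exact tendsto_const_nhds
    | some s => simp only [letterMap_some]; exact hF s s.2 t
  | inv_of o ih => intro t; simp only [map_inv]; exact tendsto_inv ih t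
  | mul x y hx hy => intro t; simp only [map_mul]; exact tendsto_mul hx hy t

/-- Scaled lifts of the identity that converge to one another are eventually equal. -/
theorem eventually_eq_shift {Ω : Type*} {l : Filter Ω} {k : ℕ} (hk : 1 ≤ k) {F : ℝ ≃o ℝ}
    {F' : Ω → ℝ ≃o ℝ} (hF : IsScaledLift k F 1) (hF' : ∀ ω, IsScaledLift k (F' ω) 1)
    (hlim : Filter.Tendsto (fun ω => F' ω 0) l (𝓝 (F 0))) :
    ∃ n : ℤ, F = shift k ^ n ∧ ∀ᶠ ω in l, F' ω = shift k ^ n := by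
  have hk' : (1 : ℝ) ≤ k := by exact_mod_cast hk
  obtain ⟨n, hn⟩ := hF.unique hk IsScaledLift.one
  rw [mul_one] at hn
  refine ⟨n, hn, ?_⟩
  have h1 := hlim.eventually (Metric.ball_mem_nhds _ one_pos)
  filter_upwards [h1] with ω h1
  obtain ⟨m, hm⟩ := (hF' ω).unique hk IsScaledLift.one
  rw [mul_one] at hm
  rw [hn, hm, shift_zpow, shift_zpow, Real.dist_eq] at h1
  simp only [OrderIso.addRight_apply, zero_add] at h1
  -- The two translations are by multiples of `k ≥ 1` and differ by less than one, so they are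
  -- equal.
  have h2 : |((m - n : ℤ) : ℝ)| < 1 := by
    push_cast
    rw [← sub_mul, abs_mul, abs_of_pos (by linarith : (0 : ℝ) < k)] at h1
    nlinarith [abs_nonneg ((m : ℝ) - n)]
  have := int_eq_zero_of_abs_lt (abs_lt.1 h2).2 (abs_lt.1 h2).1
  rw [hm, show m = n by omega]

theorem dist_le_uniformDist (f h : HomeoPlus) (x : Circ) : dist (f x) (h x) ≤ uniformDist f h := by
  refine le_ciSup (f := fun x : Circ => dist (f x) (h x)) ⟨|1| / 2, ?_⟩ x
  rintro _ ⟨y, rfl⟩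
  simp only [dist_eq_norm]
  exact AddCircle.norm_le_half_period 1 one_ne_zero

/-- The difference of the lifts stays within `1 / 4` of the integers, so it never crosses a
half-integer; starting in `[-1/2, 1/2]` at `0`, it stays near to the integer `0`. -/
theorem abs_sub_lt_of_uniformDist {f h : HomeoPlus} {F H : ℝ ≃o ℝ} (hF : IsLift F f)
    (hH : IsLift H h) (h0 : |F 0 - H 0| ≤ 1 / 2) {ε : ℝ} (hε : ε ≤ 1 / 4)
    (hd : uniformDist f h < ε) (t : ℝ) : |F t - H t| < ε := by
  have key : ∀ t, |F t - H t - round (F t - H t)| < ε := by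
    intro t
    have := (dist_le_uniformDist f h (t : Circ)).trans_lt hd
    rwa [hF, hH, dist_eq_norm, ← AddCircle.coe_sub, UnitAddCircle.norm_eq] at this
  have hhalf : ∀ t (n : ℤ), F t - H t ≠ n + 1 / 2 := by
    intro t n hn
    have h1 := abs_lt.1 (key t)
    rw [hn] at h1
    have h2 : (-1 : ℝ) < ((n - round ((n : ℝ) + 1 / 2) : ℤ) : ℝ) := by push_cast; linarith [h1.1]
    have h3 : ((n - round ((n : ℝ) + 1 / 2) : ℤ) : ℝ) < 0 := by push_cast; linarith [h1.2]
    have h2' : (-1 : ℤ) < n - round ((n : ℝ) + 1 / 2) := by exact_mod_cast h2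
    have h3' : n - round ((n : ℝ) + 1 / 2) < (0 : ℤ) := by exact_mod_cast h3
    omega
  have hcont : Continuous fun t => F t - H t := F.continuous.sub H.continuous
  have h0' := abs_le.1 h0
  have hu : F t - H t < 1 / 2 := by
    by_contra hcon
    push Not at hcon
    obtain ⟨s, hs⟩ := mem_range_of_exists_le_of_exists_ge hcont ⟨0, h0'.2⟩ ⟨t, hcon⟩
    exact hhalf s 0 (by simpa using hs)
  have hl : -(1 / 2) < F t - H t := by
    by_contra hcon
    push Not at hcon
    obtain ⟨s, hs⟩ := mem_range_of_exists_le_of_exists_ge hcont ⟨t, hcon⟩ ⟨0, h0'.1⟩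
    refine hhalf s (-1) ?_
    simp only at hs
    rw [hs]; norm_num
  have h1 := key t
  have h2 : round (F t - H t) = 0 := by
    rw [round_eq_zero_iff]
    exact ⟨hl.le, hu⟩
  rwa [h2, Int.cast_zero, sub_zero] at h1

/-- The lift for `ω` is normalized by an integer so as to be within `1 / 2` of `F` at `0`; both
lifts are then conjugated by the multiplication by `k`. -/
theorem exists_converging_lift {G : Type*} [Group G] {k : ℕ} (hk : 1 ≤ k) (ψ : G →* HomeoPlus)
    (g : G) : ∃ (F : ℝ ≃o ℝ) (F' : (G →* HomeoPlus) → ℝ ≃o ℝ), IsScaledLift k F (ψ g) ∧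
      (∀ ω, IsScaledLift k (F' ω) (ω g)) ∧
      ∀ t, Filter.Tendsto (fun ω => F' ω t) (@nhds _ (weakTopology G) ψ) (𝓝 (F t)) := by
  have hk' : (0 : ℝ) < k := by positivity
  obtain ⟨F, hF⟩ := exists_isLift (ψ g)
  have near : ∀ ω : G →* HomeoPlus, ∃ H, IsLift H (ω g) ∧ |H 0 - F 0| ≤ 1 / 2 := by
    intro ω
    obtain ⟨H, hH⟩ := exists_isLift (ω g)
    refine ⟨_, hH.shift_mul (-round (H 0 - F 0)), ?_⟩
    have := abs_sub_round (H 0 - F 0)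
    rw [RelIso.mul_apply, OrderIso.addRight_apply]
    push_cast
    rwa [show H 0 + -(round (H 0 - F 0) : ℝ) - F 0 = H 0 - F 0 - round (H 0 - F 0) by ring]
  choose H hH hH0 using near
  let m : ℝ ≃o ℝ := OrderIso.mulLeft₀ (k : ℝ) hk'
  have hm : ∀ (F : ℝ ≃o ℝ) t, (m * F * m⁻¹) t = k * F (t / k) := by
    intro F t
    have : m⁻¹ t = t / k := by
      apply m.injective
      rw [RelIso.apply_inv_self]
      change t = k * (t / k)
      field_simp
    rw [RelIso.mul_apply, RelIso.mul_apply, this]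
    rfl
  have hms : ∀ (F : ℝ ≃o ℝ) f, IsLift F f → IsScaledLift k (m * F * m⁻¹) f := by
    intro F f hF
    refine ⟨F, hF, fun t => ?_⟩
    rw [hm, mul_div_cancel_left₀ _ hk'.ne']
  refine ⟨m * F * m⁻¹, fun ω => m * H ω * m⁻¹, hms _ _ hF, fun ω => hms _ _ (hH ω), ?_⟩
  intro t
  simp only [hm]
  refine Filter.Tendsto.const_mul _ ?_
  rw [Metric.tendsto_nhds]
  intro ε hε
  have hopen : {ω : G →* HomeoPlus | uniformDist (ω g) (ψ g) < min ε (1 / 4)} ∈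
      @nhds _ (weakTopology G) ψ := by
    let _ := weakTopology G
    refine IsOpen.mem_nhds ?_ ?_
    · exact TopologicalSpace.isOpen_generateFrom_of_mem ⟨ψ, g, _, by positivity, rfl⟩
    · change uniformDist (ψ g) (ψ g) < _
      rw [uniformDist]
      simp only [dist_self, ciSup_const]
      positivity
  filter_upwards [hopen] with ω hω
  rw [Real.dist_eq]
  exact (abs_sub_lt_of_uniformDist (hH ω) hF (hH0 ω) (min_le_right _ _) hω _).trans_le
    (min_le_left _ _)

end

section

/-! ### The orbits of the end points -/

/-- The real points that represent images of boundary points. -/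
def orbitSet {Γ : Type*} [Group Γ] (φ : Γ →* HomeoPlus) (P : Set Circ) : Set ℝ :=
  {t | ∃ γ, ∃ x ∈ boundaryPart P, (t : Circ) = φ γ x}

section OrbitSet

variable {Γ : Type*} [Group Γ] {S : Set Γ} {φ : Γ →* HomeoPlus} {P : Set Circ}
  (h : IsPureBP S φ P) (E : Enum P) (hS : ∀ s ∈ S, s⁻¹ ∈ S) (hgen : Subgroup.closure S = ⊤)

theorem lift_mem_orbitSet {t : ℝ} (ht : t ∈ orbitSet φ P) {γ : Γ} {F : ℝ ≃o ℝ}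
    (hF : IsLift F (φ γ)) : F t ∈ orbitSet φ P := by
  obtain ⟨γ', x, hx, e⟩ := ht
  refine ⟨γ * γ', x, hx, ?_⟩
  rw [← hF t, e, map_mul]
  rfl

theorem add_int_mem_orbitSet {t : ℝ} (ht : t ∈ orbitSet φ P) (n : ℤ) :
    t + n ∈ orbitSet φ P := by
  obtain ⟨γ', x, hx, e⟩ := ht
  exact ⟨γ', x, hx, by rw [coe_add_int, e]⟩

theorem mem_orbitSet_of_boundary {t : ℝ} (ht : (t : Circ) ∈ boundaryPart P) :
    t ∈ orbitSet φ P := ⟨1, t, ht, by rw [map_one]; rfl⟩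

theorem a_mem_orbitSet (i : ℤ) : E.a i ∈ orbitSet φ P :=
  mem_orbitSet_of_boundary ((E.mem_boundaryPart_iff _).2 ⟨i, Or.inl rfl⟩)

theorem b_mem_orbitSet (i : ℤ) : E.b i ∈ orbitSet φ P :=
  mem_orbitSet_of_boundary ((E.mem_boundaryPart_iff _).2 ⟨i, Or.inr rfl⟩)

include h hS hgen in
-- The dichotomy of `lift_gap` holds for all group elements, by the ping-pong of `Coding.position'`.
theorem lift_position {γ : Γ} {F : ℝ ≃o ℝ} (hF : IsLift F (φ γ)) (i : ℤ) :
    (∃ j, F (E.b i) = E.b j ∧ F (E.a (i + 1)) = E.a (j + 1)) ∨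
      ∃ j, E.a j < F (E.b i) ∧ F (E.a (i + 1)) < E.b j := by
  have hlt : F (E.b i) < F (E.a (i + 1)) := F.strictMono (E.b_lt_a i)
  rcases (codingOf h E hS hgen).position' γ (J := E.gap i) ⟨i, rfl⟩ with ⟨j, hj⟩ | ⟨t, -, j, hj, -⟩
  · obtain ⟨n, h1, h2⟩ := lift_of_image_gap E hF hj.symm
    exact Or.inl ⟨_, h1, h2⟩
  · right
    have hj : φ γ '' E.gap i ⊆ ((↑) : ℝ → Circ) '' Ioo (E.a j) (E.b j) := hj
    rw [Enum.gap, hF.image, F.image_Icc] at hj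
    have hmem : ∀ t ∈ Icc (F (E.b i)) (F (E.a (i + 1))), ∃ m, E.a m < t ∧ t < E.b m := by
      intro t ht
      refine (E.coe_mem_interior_iff t).1 ?_
      have : interior (E.comp j) ⊆ interior P :=
        interior_mono fun x hx => by
          obtain ⟨s, hs, rfl⟩ := hx
          exact (E.mem_iff s).2 ⟨j, hs⟩
      exact this (coe_image_Ioo_subset_interior _ _ (hj ⟨t, ht, rfl⟩))
    obtain ⟨m, h1, h2⟩ := hmem _ ⟨le_rfl, hlt.le⟩
    obtain ⟨m', h3, h4⟩ := hmem _ ⟨hlt.le, le_rfl⟩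
    have h5 := E.subset_comp ordConnected_Icc (c := F (E.b i)) ⟨le_rfl, hlt.le⟩ ⟨h1.le, h2.le⟩
      (fun t ht => by
        obtain ⟨m, e1, e2⟩ := hmem t ht
        exact (E.mem_iff t).2 ⟨m, e1.le, e2.le⟩) ⟨hlt.le, le_rfl⟩
    have e1 := E.le_of_a_le_b (h3.le.trans h5.2)
    have e2 := E.le_of_a_le_b (h5.1.trans h4.le)
    have : m' = m := by omega
    subst this
    exact ⟨m', h1, h4⟩

theorem derived_antitone (S : Set Γ) (φ : Γ →* HomeoPlus) (P : Set Circ) :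
    Antitone (derived S φ P) := by
  refine antitone_nat_of_succ_le fun n => ?_
  intro x hx
  have := mem_iInter₂.1 hx 1 (mem_insert _ _)
  rw [map_one] at this
  obtain ⟨y, hy, rfl⟩ := this
  exact hy

theorem derived_subset {l : List Γ} (hl : ∀ s ∈ l, s ∈ S) :
    derived S φ P l.length ⊆ φ l.prod '' P := by
  induction l with
  | nil =>
    rw [List.prod_nil, map_one]
    exact fun x hx => ⟨x, hx, rfl⟩
  | cons s l ih =>
    intro x hx
    obtain ⟨y, hy, rfl⟩ := mem_iInter₂.1 hx s (mem_insert_of_mem _ (hl s (by simp)))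
    obtain ⟨z, hz, rfl⟩ := ih (fun t ht => hl t (List.mem_cons_of_mem _ ht)) hy
    exact ⟨z, hz, by rw [List.prod_cons, map_mul]; rfl⟩

include h E hS hgen in
-- No group element carries an end point of a gap into an open gap, so its orbit lies in `P`. The
-- orbit being invariant, it lies in all derived sets.
theorem orbit_mem_derived {γ : Γ} {x : Circ} (hx : x ∈ boundaryPart P) (n : ℕ) :
    φ γ x ∈ derived S φ P n := by
  induction n generalizing γ with
  | zero =>
    obtain ⟨t, rfl⟩ := coe_surj x
    obtain ⟨F, hF⟩ := exists_isLift (φ γ)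
    obtain ⟨i, rfl | rfl⟩ := (E.mem_boundaryPart_iff t).1 hx
    · rw [hF]
      refine (E.mem_iff _).2 ?_
      have hlt := F.strictMono (E.b_lt_a (i - 1))
      rcases lift_position h E hS hgen hF (i - 1) with ⟨j, h1, h2⟩ | ⟨j, h1, h2⟩ <;>
        rw [sub_add_cancel] at h2 hlt
      · exact ⟨j + 1, h2.ge, h2.le.trans (E.a_lt_b _).le⟩
      · exact ⟨j, (h1.trans hlt).le, h2.le⟩
    · rw [hF]
      refine (E.mem_iff _).2 ?_
      have hlt := F.strictMono (E.b_lt_a i)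
      rcases lift_position h E hS hgen hF i with ⟨j, h1, h2⟩ | ⟨j, h1, h2⟩
      · exact ⟨j, (E.a_lt_b _).le.trans h1.ge, h1.le⟩
      · exact ⟨j, h1.le, (hlt.trans h2).le⟩
  | succ n ih =>
    refine mem_iInter₂.2 fun s _ => ⟨φ (s⁻¹ * γ) x, ih, ?_⟩
    have : φ s * φ (s⁻¹ * γ) = φ γ := by rw [← map_mul, mul_inv_cancel_left]
    rw [← this]; rfl

include h E hS hgen in
-- Once `n` is at least the length of a word for `γ`, the derived set avoids the image of an open
-- gap adjacent to `x`, while it contains the image of `x`, which lies in the closure of that image.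
theorem eventually_mem_derived {t : ℝ} (ht : t ∈ orbitSet φ P) :
    ∀ᶠ n in Filter.atTop, (t : Circ) ∈ boundaryPart (derived S φ P n) := by
  obtain ⟨γ, x, hx, e⟩ := ht
  obtain ⟨l, hl, rfl⟩ := exists_reduced hS hgen γ
  filter_upwards [Filter.eventually_ge_atTop l.length] with n hn
  rw [e]
  refine ⟨orbit_mem_derived h E hS hgen hx n, ?_⟩
  obtain ⟨i, hi⟩ : ∃ i, x ∈ E.gap i := by
    have := hx.2
    rw [E.sharp_eq] at this
    obtain ⟨_, ⟨i, rfl⟩, hi⟩ := this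
    exact ⟨i, hi⟩
  have hsub : φ l.prod '' E.openGap i ⊆ (derived S φ P n)ᶜ := by
    rintro _ ⟨y, hy, rfl⟩ hmem
    obtain ⟨z, hz, hzy⟩ := derived_subset hl.1 (derived_antitone S φ P hn hmem)
    have : z = y := (φ l.prod : Circ ≃ₜ Circ).injective hzy
    subst this
    have : z ∈ Pᶜ := by rw [E.compl_eq]; exact ⟨_, ⟨i, rfl⟩, hy⟩
    exact this hz
  have hpre : IsPreconnected (φ l.prod '' E.openGap i) :=
    ((isPreconnected_Ioo.image _ continuous_coe.continuousOn).image _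
      (φ l.prod : Circ ≃ₜ Circ).continuous.continuousOn)
  have hne : (φ l.prod '' E.openGap i).Nonempty :=
    ((nonempty_Ioo.2 (E.b_lt_a i)).image _).image _
  obtain ⟨y, hy⟩ := hne
  refine ⟨_, ⟨connectedComponentIn (derived S φ P n)ᶜ y, ⟨y, hsub hy, rfl⟩, rfl⟩, ?_⟩
  refine closure_mono (hpre.subset_connectedComponentIn hy hsub) ?_
  have hcl : closure (φ l.prod '' E.openGap i) = φ l.prod '' E.gap i := by
    rw [Enum.gap, ← closure_coe_Ioo (E.b_lt_a i)]
    exact ((φ l.prod : Circ ≃ₜ Circ).image_closure _).symm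
  rw [hcl]
  exact mem_image_of_mem _ hi

include h in
/-- Every component of `P` contains at least two points of the orbits in its interior. -/
theorem exists_two_orbit_points (i : ℤ) : ∃ t ∈ orbitSet φ P, ∃ t' ∈ orbitSet φ P,
    E.a i < t ∧ t < t' ∧ t' < E.b i := by
  obtain ⟨F, hF⟩ := exists_isLift (φ (label h E i))
  obtain ⟨j, j', hjj, h1, h2, -⟩ := lift_expand h E hF
  have hF' : IsLift F⁻¹ (φ (label h E i)⁻¹) := by rw [map_inv]; exact hF.inv
  have e : ∀ t, F (F⁻¹ t) = t := RelIso.apply_inv_self F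
  refine ⟨F⁻¹ (E.b j), lift_mem_orbitSet (b_mem_orbitSet E j) hF', F⁻¹ (E.a (j + 1)),
    lift_mem_orbitSet (a_mem_orbitSet E _) hF', ?_, F⁻¹.strictMono (E.b_lt_a j), ?_⟩
  · rw [← F.lt_iff_lt, e, h1]; exact E.a_lt_b j
  · rw [← F.lt_iff_lt, e, h2]
    exact (E.a_lt_b _).trans_le (E.b_strictMono.monotone (by omega))

include h hS in
/-- A component receiving a gap in its interior by a generator also receives both adjacent
components. -/
theorem neighbours_inside {s : Γ} (hs : s ∈ S) {F : ℝ ≃o ℝ} (hF : IsLift F (φ s)) {i j : ℤ}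
    (h1 : E.a j < F (E.b i)) (h2 : F (E.a (i + 1)) < E.b j) :
    E.a j ≤ F (E.a i) ∧ F (E.b (i + 1)) ≤ E.b j := by
  have hlt := F.strictMono (E.b_lt_a i)
  have hlab : label h E j = s⁻¹ := by
    rcases lift_gap_label h E hS hs hF i with ⟨m, e1, e2⟩ | ⟨m, e0, e1, e2⟩
    · rw [e1] at h1 hlt
      rw [e2] at h2 hlt
      have := E.le_of_a_le_b h1.le
      have := E.le_of_a_le_b h2.le
      omega
    · have e3 := E.le_of_a_le_b ((h1.trans hlt).trans e2).le
      have e4 := E.le_of_a_le_b ((e1.trans hlt).trans h2).le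
      rw [show j = m by omega, e0]
  have hF' : IsLift F⁻¹ (φ (label h E j)) := by rw [hlab, map_inv]; exact hF.inv
  obtain ⟨m, m', -, e1, e2, -⟩ := lift_expand h E hF'
  have e : ∀ t, F⁻¹ (F t) = t := RelIso.inv_apply_self F
  have h1' := F⁻¹.strictMono h1
  have h2' := F⁻¹.strictMono h2
  rw [e, e1] at h1'
  rw [e, e2] at h2'
  have e3 := E.le_of_a_le_b h1'.le
  have e4 := E.le_of_a_le_b h2'.le
  constructor
  · rw [← F⁻¹.le_iff_le, e, e1]; exact E.a_strictMono.monotone e3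
  · rw [← F⁻¹.le_iff_le, e, e2]; exact E.b_strictMono.monotone e4

include h hS in
/-- There are marks in the components, separated from the end points by points of the orbits,
such that the gaps mapped into a component by a generator are mapped between the marks. -/
theorem exists_marks (hSfin : S.Finite) : ∃ A B : ℤ → ℝ, (∀ i, A i < B i) ∧
    (∀ i, ∃ t ∈ orbitSet φ P, E.a i < t ∧ t < A i) ∧
    (∀ i, ∃ t ∈ orbitSet φ P, B i < t ∧ t < E.b i) ∧
    (∀ s ∈ S, ∀ F, IsLift F (φ s) → ∀ i j, E.a j < F (E.b i) → F (E.a (i + 1)) < E.b j →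
      A j < F (B i) ∧ F (A (i + 1)) < B j) ∧
    (∀ i m : ℤ, A (i + E.N * m) = A i + m) ∧ ∀ i m : ℤ, B (i + E.N * m) = B i + m := by
  let X : ℤ → Set ℝ := fun i => orbitSet φ P ∩ Ioo (E.a i) (E.b i)
  have hXne : ∀ i, (X i).Nonempty := fun i => by
    obtain ⟨t, ht, t', -, h1, h2, h3⟩ := exists_two_orbit_points h E i
    exact ⟨t, ht, h1, h2.trans h3⟩
  have hXb : ∀ i, BddBelow (X i) := fun i => ⟨E.a i, fun t ht => ht.2.1.le⟩
  have hXa : ∀ i, BddAbove (X i) := fun i => ⟨E.b i, fun t ht => ht.2.2.le⟩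
  have hXadd : ∀ i m : ℤ, X (i + E.N * m) = (OrderIso.addRight (m : ℝ)) '' X i := by
    intro i m
    ext t
    constructor
    · rintro ⟨ht, h1, h2⟩
      rw [E.a_add_mul] at h1
      rw [E.b_add_mul] at h2
      refine ⟨t + (-m : ℤ), ⟨add_int_mem_orbitSet ht _, ?_, ?_⟩, ?_⟩
      · push_cast; linarith
      · push_cast; linarith
      · simp
    · rintro ⟨s, ⟨hs, h1, h2⟩, rfl⟩
      refine ⟨add_int_mem_orbitSet hs m, ?_, ?_⟩
      · rw [E.a_add_mul]; simpa using h1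
      · rw [E.b_add_mul]; simpa using h2
  -- The marks will be `α i + δ` and `β i - δ`. The orbit may accumulate at the end points of the
  -- component, so that `α i = a i`; adding `δ` leaves an orbit point strictly between `a i` and the
  -- mark.
  let α : ℤ → ℝ := fun i => sInf (X i)
  let β : ℤ → ℝ := fun i => sSup (X i)
  have hα : ∀ i, ∀ t ∈ X i, α i ≤ t := fun i t ht => csInf_le (hXb i) ht
  have hβ : ∀ i, ∀ t ∈ X i, t ≤ β i := fun i t ht => le_csSup (hXa i) ht
  have hαadd : ∀ i m : ℤ, α (i + E.N * m) = α i + m := by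
    intro i m
    have := ((OrderIso.addRight (m : ℝ)).isGLB_image').2 (isGLB_csInf (hXne i) (hXb i))
    rw [← hXadd] at this
    exact (isGLB_csInf (hXne _) (hXb _)).unique this
  have hβadd : ∀ i m : ℤ, β (i + E.N * m) = β i + m := by
    intro i m
    have := ((OrderIso.addRight (m : ℝ)).isLUB_image').2 (isLUB_csSup (hXne i) (hXa i))
    rw [← hXadd] at this
    exact (isLUB_csSup (hXne _) (hXa _)).unique this
  have hαβ : ∀ i, α i < β i := fun i => by
    obtain ⟨t, ht, t', ht', h1, h2, h3⟩ := exists_two_orbit_points h E i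
    exact (hα i t ⟨ht, h1, h2.trans h3⟩).trans_lt (h2.trans_le (hβ i t' ⟨ht', h1.trans h2, h3⟩))
  choose F hF using fun s : Γ => exists_isLift (φ s)
  have hlim : ∀ (H : ℝ ≃o ℝ) (x : ℝ), Filter.Tendsto (fun δ : ℝ => H (x + δ)) (𝓝[>] 0) (𝓝 (H x)) := by
    intro H x
    have h1 : Continuous fun δ : ℝ => H (x + δ) := H.continuous.comp (continuous_const_add x)
    have h2 := (h1.tendsto 0).mono_left (nhdsWithin_le_nhds (s := Ioi (0 : ℝ)))
    simpa using h2
  have hlim' : ∀ (H : ℝ ≃o ℝ) (x : ℝ), Filter.Tendsto (fun δ : ℝ => H (x - δ)) (𝓝[>] 0) (𝓝 (H x)) := by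
    intro H x
    have h1 : Continuous fun δ : ℝ => H (x - δ) := H.continuous.comp (continuous_sub_left x)
    have h2 := (h1.tendsto 0).mono_left (nhdsWithin_le_nhds (s := Ioi (0 : ℝ)))
    simpa using h2
  have ev1 : ∀ᶠ δ in 𝓝[>] (0 : ℝ), ∀ i ∈ Ico (0 : ℤ) (1 * E.N), α i + δ < β i - δ := by
    rw [Filter.eventually_all_finite (finite_Ico _ _)]
    intro i _
    exact (hlim 1 (α i)).eventually_lt (hlim' 1 (β i)) (hαβ i)
  have ev2 : ∀ᶠ δ in 𝓝[>] (0 : ℝ), ∀ s ∈ S, ∀ i ∈ Ico (0 : ℤ) (1 * E.N), ∀ j,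
      E.a j < F s (E.b i) → F s (E.a (i + 1)) < E.b j →
      α j + δ < F s (β i - δ) ∧ F s (α (i + 1) + δ) < β j - δ := by
    rw [Filter.eventually_all_finite hSfin]
    intro s hs
    rw [Filter.eventually_all_finite (finite_Ico _ _)]
    intro i _
    by_cases hex : ∃ j, E.a j < F s (E.b i) ∧ F s (E.a (i + 1)) < E.b j
    · obtain ⟨j, h1, h2⟩ := hex
      have hlt := (F s).strictMono (E.b_lt_a i)
      obtain ⟨h3, h4⟩ := neighbours_inside h E hS hs (hF s) h1 h2
      have hX : ∀ m t, (m = i ∨ m = i + 1) → t ∈ X m → F s t ∈ X j := by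
        rintro m t hm ⟨ht, h5, h6⟩
        refine ⟨lift_mem_orbitSet ht (hF s), ?_, ?_⟩
        · refine h3.trans_lt ((F s).strictMono (lt_of_le_of_lt ?_ h5))
          exact E.a_strictMono.monotone (by omega)
        · refine ((F s).strictMono (lt_of_lt_of_le h6 ?_)).trans_le h4
          exact E.b_strictMono.monotone (by omega)
      -- Strict because the component `i` contains two distinct orbit points, whose images are orbit
      -- points of the component `j`.
      have h5 : α j < F s (β i) := by
        obtain ⟨t, ht, t', ht', e1, e2, e3⟩ := exists_two_orbit_points h E i
        exact (hα j _ (hX i t (Or.inl rfl) ⟨ht, e1, e2.trans e3⟩)).trans_lt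
          ((F s).strictMono (e2.trans_le (hβ i t' ⟨ht', e1.trans e2, e3⟩)))
      have h6 : F s (α (i + 1)) < β j := by
        obtain ⟨t, ht, t', ht', e1, e2, e3⟩ := exists_two_orbit_points h E (i + 1)
        exact ((F s).strictMono ((hα (i + 1) t ⟨ht, e1, e2.trans e3⟩).trans_lt e2)).trans_le
          (hβ j _ (hX (i + 1) t' (Or.inr rfl) ⟨ht', e1.trans e2, e3⟩))
      filter_upwards [(hlim 1 (α j)).eventually_lt (hlim' (F s) (β i)) h5,
        (hlim (F s) (α (i + 1))).eventually_lt (hlim' 1 (β j)) h6] with δ e1 e2 j' e3 e4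
      have e5 := E.le_of_a_le_b ((h1.trans hlt).trans e4).le
      have e6 := E.le_of_a_le_b ((e3.trans hlt).trans h2).le
      have : j' = j := by omega
      subst this
      exact ⟨e1, e2⟩
    · push Not at hex
      refine Filter.Eventually.of_forall fun δ j h1 h2 => ?_
      exact absurd h2 (not_lt.2 (hex j h1))
  obtain ⟨δ, ⟨h1, h2⟩, hδ⟩ := ((ev1.and ev2).and self_mem_nhdsWithin).exists
  have hδ : 0 < δ := hδ
  refine ⟨fun i => α i + δ, fun i => β i - δ, ?_, ?_, ?_, ?_, ?_, ?_⟩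
  · intro i
    obtain ⟨j, m, h3, h4, rfl⟩ := E.exists_mod i 1 one_pos
    have := h1 j ⟨h3, by simpa using h4⟩
    simp only [Nat.cast_one, one_mul, hαadd, hβadd]
    linarith
  · intro i
    obtain ⟨t, ht, ht'⟩ := exists_lt_of_csInf_lt (hXne i) (lt_add_of_pos_right (α i) hδ)
    exact ⟨t, ht.1, ht.2.1, ht'⟩
  · intro i
    obtain ⟨t, ht, ht'⟩ := exists_lt_of_lt_csSup (hXne i) (sub_lt_self (β i) hδ)
    exact ⟨t, ht.1, ht', ht.2.2⟩
  · intro s hs H hH i j h3 h4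
    obtain ⟨n, hn⟩ := (hF s).unique hH
    obtain ⟨i₀, m, h5, h6, rfl⟩ := E.exists_mod i 1 one_pos
    simp only [Nat.cast_one, one_mul] at *
    have e1 : i₀ + E.N * m + 1 = i₀ + 1 + E.N * m := by ring
    obtain ⟨j₀, rfl⟩ : ∃ j₀, j = j₀ + E.N * (m + n) := ⟨j - E.N * (m + n), by ring⟩
    rw [hn, E.b_add_mul, E.a_add_mul, (hF s).add_int] at h3
    rw [hn, e1, E.b_add_mul, E.a_add_mul, (hF s).add_int] at h4
    push_cast at h3 h4
    obtain ⟨h7, h8⟩ := h2 s hs i₀ ⟨h5, by simpa using h6⟩ j₀ (by linarith) (by linarith)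
    have e2 : β i₀ + m - δ = β i₀ - δ + m := by ring
    have e3 : α (i₀ + 1) + m + δ = α (i₀ + 1) + δ + m := by ring
    rw [e1, hαadd, hβadd, hαadd, hβadd, hn, hn, e2, e3, (hF s).add_int, (hF s).add_int]
    push_cast
    constructor <;> linarith
  · intro i m
    simp only [hαadd]; ring
  · intro i m
    simp only [hβadd]; ring

end OrbitSet

end

section

/-! ### Robustness on the line -/

theorem exists_next_lift {D : Set Circ} {x : ℝ} {u w : Circ} (hu : IsNext D u x)
    (hw : IsNext D x w) {f : HomeoPlus} (hf : f '' cIcc u w ⊂ cIcc u w) :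
    ∃ a b : ℝ, a < x ∧ x < b ∧ b < a + 1 ∧ cIcc u w = ((↑) : ℝ → Circ) '' Icc a b ∧
      ∀ t : ℝ, (t : Circ) ∈ D → (a < t → t < x → False) ∧ (x < t → t < b → False) := by
  obtain ⟨a, h1, h2, rfl⟩ := coe_surj_Ico u (x - 1)
  obtain ⟨b, h3, h4, rfl⟩ := coe_surj_Ico w x
  have hax : a < x := by linarith
  have ha : x - 1 < a := by
    refine lt_of_le_of_ne h1 ?_
    rintro rfl
    refine hu.2.2.1 (coe_eq_coe_iff.2 ⟨1, by push_cast; ring⟩)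
  have hb : x < b := by
    refine lt_of_le_of_ne h3 ?_
    rintro rfl
    exact hw.2.2.1 rfl
  -- If `b = a + 1`, the arc is the whole circle and has no proper image under `f`; if `b > a + 1`,
  -- then `w` lies between `u` and `x`, which are adjacent.
  have hba : b < a + 1 := by
    by_contra hcon
    push Not at hcon
    have e : ((b - 1 : ℝ) : Circ) = b := coe_eq_coe_iff.2 ⟨1, by push_cast; ring⟩
    rcases hcon.eq_or_lt with h | h
    · have : (a : Circ) = b := by rw [← e, ← h, add_sub_cancel_right]
      rw [← this, cIcc_coe_self] at hf
      refine hf.2 ?_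
      rw [image_univ, (f : Circ ≃ₜ Circ).surjective.range_eq]
    · refine hu.2.2.2 _ hw.2.1 ?_
      rw [← e]
      exact coe_mem_cIoo (by linarith) (by linarith) (by linarith)
  refine ⟨a, b, hax, hb, hba, cIcc_coe (hax.trans hb) hba, fun t ht => ⟨fun e1 e2 => ?_, fun e1 e2 => ?_⟩⟩
  · exact hu.2.2.2 _ ht (coe_mem_cIoo (by linarith) e1 e2)
  · exact hw.2.2.2 _ ht (coe_mem_cIoo (by linarith) e1 e2)

/-- Closed intervals of length less than one around `x`, contracted by a circle map. -/
theorem attracts_of_image_subset {r₁ r₂ x : ℝ} (h1 : r₁ < x) (h2 : x < r₂) (h3 : r₂ < r₁ + 1)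
    {f : HomeoPlus} (hf : f '' (((↑) : ℝ → Circ) '' Icc r₁ r₂) ⊆
      interior (((↑) : ℝ → Circ) '' Icc r₁ r₂)) {F : ℝ ≃o ℝ} (hF : IsLift F f) (hx : F x = x) :
    r₁ < F r₁ ∧ F r₂ < r₂ := by
  rw [hF.image, F.image_Icc] at hf
  have e1 := F.strictMono h1
  have e2 := F.strictMono h2
  rw [hx] at e1 e2
  have hsub : Icc (F r₁) (F r₂) ⊆ Icc r₁ r₂ :=
    subset_Icc_of_coe ordConnected_Icc h3 (c := x) ⟨e1.le, e2.le⟩ ⟨h1.le, h2.le⟩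
      fun t ht => interior_subset (hf ⟨t, ht, rfl⟩)
  have key : ∀ t ∈ Icc (F r₁) (F r₂), t ∈ Ioo r₁ r₂ := by
    intro t ht
    obtain ⟨n, hn⟩ := coe_mem_interior h3 (hf ⟨t, ht, rfl⟩)
    have := hsub ht
    have hn0 : n = 0 := int_eq_zero_of_abs_lt (by linarith [hn.2, this.1]) (by linarith [hn.1, this.2])
    simpa [hn0] using hn
  exact ⟨(key _ ⟨le_rfl, (e1.trans e2).le⟩).1, (key _ ⟨(e1.trans e2).le, le_rfl⟩).2⟩

theorem iterate_attracts {F : ℝ ≃o ℝ} {r₁ r₂ : ℝ} (h : r₁ < F r₁ ∧ F r₂ < r₂) {n : ℤ} (hn : n ≠ 0) :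
    (r₁ < (F ^ n) r₁ ∧ (F ^ n) r₂ < r₂) ∨ (r₁ < (F ^ n)⁻¹ r₁ ∧ (F ^ n)⁻¹ r₂ < r₂) := by
  have key : ∀ m : ℕ, r₁ < (F ^ (m + 1)) r₁ ∧ (F ^ (m + 1)) r₂ < r₂ := by
    intro m
    induction m with
    | zero => simpa using h
    | succ m ih =>
      rw [pow_succ', RelIso.mul_apply, RelIso.mul_apply]
      exact ⟨h.1.trans (F.strictMono ih.1), (F.strictMono ih.2).trans h.2⟩
  obtain ⟨m, hm⟩ := Nat.exists_eq_succ_of_ne_zero (Int.natAbs_ne_zero.2 hn)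
  rcases Int.natAbs_eq n with e | e
  · left
    rw [e, hm, zpow_natCast]; exact key m
  · right
    rw [← zpow_neg, show -n = (n.natAbs : ℤ) by omega, hm, zpow_natCast]; exact key m

namespace BasicConfiguration

variable {𝒯 : TreeOfGroups} {φ : 𝒯.FundamentalGroup →* HomeoPlus} (B : BasicConfiguration 𝒯 φ)

/-- For large `l` the finite set `T` consists of points of `derivedPoints l`, which do not lie in
the interior of `[x⁻, x⁺]` except possibly at `x`. The lifted intervals `K x ⊆ [x⁻, x⁺]` are
therefore bounded by `T` on each side. -/
theorem IsRobust.exists_intervals {B : BasicConfiguration 𝒯 φ} (hB : B.IsRobust) {T : Set ℝ}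
    (hfin : T.Finite) (hT : ∀ t ∈ T, ∀ᶠ l in Filter.atTop, (t : Circ) ∈ B.derivedPoints l) :
    ∃ r₁ r₂ : ℝ → ℝ, ∀ x : ℝ, (x : Circ) ∈ B.points →
      r₁ x < x ∧ x < r₂ x ∧ (∀ t ∈ T, t < x → t ≤ r₁ x) ∧ (∀ t ∈ T, x < t → r₂ x ≤ t) ∧
      (∀ g F, φ g ≠ 1 → IsLift F (φ g) → F x = x →
        (r₁ x < F (r₁ x) ∧ F (r₂ x) < r₂ x) ∨ (r₁ x < F⁻¹ (r₁ x) ∧ F⁻¹ (r₂ x) < r₂ x)) ∧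
      ∀ y : ℝ, (y : Circ) ∈ B.points → (x : Circ) ≠ y → x < y → r₂ x < r₁ y := by
  obtain ⟨l₀, hl₀⟩ := hB
  have hev : ∀ᶠ l in Filter.atTop, l₀ ≤ l ∧ ∀ t ∈ T, (t : Circ) ∈ B.derivedPoints l :=
    (Filter.eventually_ge_atTop l₀).and ((Filter.eventually_all_finite hfin).2 hT)
  obtain ⟨l, hl, hTl⟩ := hev.exists
  obtain ⟨K, hdisj, hK⟩ := hl₀ l hl
  have hpt : ∀ x : ℝ, ∃ r₁ r₂ : ℝ, (x : Circ) ∈ B.points →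
      r₁ < x ∧ x < r₂ ∧ K x = ((↑) : ℝ → Circ) '' Icc r₁ r₂ ∧
      (∀ t ∈ T, t < x → t ≤ r₁) ∧ (∀ t ∈ T, x < t → r₂ ≤ t) ∧
      (∀ g F, φ g ≠ 1 → IsLift F (φ g) → F x = x →
        (r₁ < F r₁ ∧ F r₂ < r₂) ∨ (r₁ < F⁻¹ r₁ ∧ F⁻¹ r₂ < r₂)) := by
    intro x
    by_cases hx : (x : Circ) ∈ B.points
    swap
    · exact ⟨0, 0, fun h => absurd h hx⟩
    obtain ⟨u, w, hu, hw, harc, hxK, hKsub, f, hf, hfuw, hfK⟩ := hK _ hx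
    obtain ⟨a, b, ha, hb, hba, hcIcc, hD⟩ := exists_next_lift hu hw hfuw
    obtain ⟨r₁, r₂, h1, h2, h3, h4, h5⟩ := exists_lift_arc harc x (interior_subset hxK)
    have hx12 : r₁ < x ∧ x < r₂ := by
      rw [h3] at hxK
      obtain ⟨n, hn⟩ := coe_mem_interior h2 hxK
      have hn0 : n = 0 := int_eq_zero_of_abs_lt (by linarith [hn.2]) (by linarith [hn.1])
      simpa [hn0] using hn
    have hsub : Icc r₁ r₂ ⊆ Icc a b :=
      subset_Icc_of_coe ordConnected_Icc hba (c := x) ⟨h4, h5⟩ ⟨ha.le, hb.le⟩ fun t ht => by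
        rw [← hcIcc]; exact hKsub (by rw [h3]; exact ⟨t, ht, rfl⟩)
    refine ⟨r₁, r₂, fun _ => ⟨hx12.1, hx12.2, h3, ?_, ?_, ?_⟩⟩
    · intro t ht htx
      by_contra hcon
      push Not at hcon
      exact (hD t (hTl t ht)).1 ((hsub ⟨le_rfl, h1.le⟩).1.trans_lt hcon) htx
    · intro t ht htx
      by_contra hcon
      push Not at hcon
      exact (hD t (hTl t ht)).2 htx (hcon.trans_le (hsub ⟨h1.le, le_rfl⟩).2)
    · intro g F hg hF hFx
      have hgx : φ g ∈ Subgroup.zpowers f := by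
        rw [hf]
        refine ⟨g, ?_, rfl⟩
        change φ g '' {(x : Circ)} = {(x : Circ)}
        rw [image_singleton, hF, hFx]
      obtain ⟨n, hn⟩ := Subgroup.mem_zpowers_iff.1 hgx
      have hfx : f (x : Circ) = x := by
        have hmem : f ∈ (stab φ {(x : Circ)}).map φ := by
          rw [← hf]; exact Subgroup.mem_zpowers f
        obtain ⟨g', hg', rfl⟩ := hmem
        have hg' : φ g' '' {(x : Circ)} = {(x : Circ)} := hg'
        rwa [image_singleton, singleton_eq_singleton_iff] at hg'
      obtain ⟨H, hH⟩ := exists_isLift f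
      obtain ⟨m, hm⟩ := coe_eq_coe_iff.1 ((hH x).symm.trans hfx)
      have hH' := hH.shift_mul m
      have hHx : (shift m * H) x = x := by
        rw [RelIso.mul_apply]; exact hm.symm
      set H' := shift m * H
      have hzp : ∀ n : ℤ, IsLift (H' ^ n) (f ^ n) := by
        have hnat : ∀ n : ℕ, IsLift (H' ^ n) (f ^ n) := by
          intro n
          induction n with
          | zero => rw [pow_zero, pow_zero]; exact IsLift.one
          | succ n ih => rw [pow_succ, pow_succ]; exact ih.mul hH'
        intro n
        obtain ⟨n, rfl | rfl⟩ := n.eq_nat_or_neg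
        · rw [zpow_natCast, zpow_natCast]; exact hnat n
        · rw [zpow_neg, zpow_neg, zpow_natCast, zpow_natCast]; exact (hnat n).inv
      -- Both maps lift `φ g` and fix `x`, so the integer by which they differ is zero.
      have hFn : F = H' ^ n := by
        have h6 := hzp n
        rw [hn] at h6
        obtain ⟨c, hc⟩ := h6.unique hF
        have h7 := hc x
        rw [hFx, zpow_fixed hHx] at h7
        have : (c : ℝ) = 0 := by linarith
        ext t
        rw [hc, this, add_zero]
      have hn0 : n ≠ 0 := by
        rintro rfl
        exact hg (by rw [← hn, zpow_zero])
      rw [hFn]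
      refine iterate_attracts ?_ hn0
      rw [h3] at hfK
      exact attracts_of_image_subset hx12.1 hx12.2 h2 hfK hH' hHx
  choose r₁ r₂ hr using hpt
  refine ⟨r₁, r₂, fun x hx => ?_⟩
  obtain ⟨h1, h2, h3, h4, h5, h6⟩ := hr x hx
  refine ⟨h1, h2, h4, h5, h6, fun y hy hxy hlt => ?_⟩
  obtain ⟨e1, e2, e3, -⟩ := hr y hy
  have hd := hdisj hx hy hxy
  by_contra hcon
  push Not at hcon
  have hd' : ∀ t ∈ Icc (r₁ x) (r₂ x), t ∉ Icc (r₁ y) (r₂ y) := by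
    intro t ht ht'
    have hxt : (t : Circ) ∈ K x := by rw [h3]; exact ⟨t, ht, rfl⟩
    have hyt : (t : Circ) ∈ K y := by rw [e3]; exact ⟨t, ht', rfl⟩
    exact Set.disjoint_left.1 hd hxt hyt
  refine hd' (max x (r₁ y)) ⟨h1.le.trans (le_max_left _ _), max_le h2.le hcon⟩
    ⟨le_max_right _ _, max_le (hlt.le.trans e2.le) (e1.le.trans e2.le)⟩

end BasicConfiguration

/-! ### Absence of global fixed points -/

section FixedPoint

variable {Γ : Type*} [Group Γ] {S : Set Γ} {φ : Γ →* HomeoPlus} {P : Set Circ}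
  (h : IsPureBP S φ P) (E : Enum P)

include h in
theorem lift_next_of_b {s : Γ} (hs : s ∈ S) {F : ℝ ≃o ℝ} (hF : IsLift F (φ s)) {i j : ℤ}
    (hb : F (E.b i) = E.b j) : F (E.a (i + 1)) = E.a (j + 1) := by
  have hlt := F.strictMono (E.b_lt_a i)
  rcases lift_gap h E hs hF i with ⟨m, e1, e2⟩ | ⟨m, e1, e2⟩
  · rw [e2, E.b_strictMono.injective (e1.symm.trans hb)]
  · rw [hb] at e1 hlt
    have := E.le_of_a_le_b e1.le
    have := E.b_strictMono.lt_iff_lt.1 (hlt.trans e2)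
    omega

include h in
theorem lift_prev_of_a {s : Γ} (hs : s ∈ S) {F : ℝ ≃o ℝ} (hF : IsLift F (φ s)) {i j : ℤ}
    (ha : F (E.a i) = E.a j) : F (E.b (i - 1)) = E.b (j - 1) := by
  have hlt := F.strictMono (E.b_lt_a (i - 1))
  rcases lift_gap h E hs hF (i - 1) with ⟨m, e1, e2⟩ | ⟨m, e1, e2⟩ <;>
    rw [sub_add_cancel, ha] at *
  · rw [e1, show m = j - 1 by have := E.a_strictMono.injective e2; omega]
  · have := E.le_of_a_le_b e2.le
    have := E.a_strictMono.lt_iff_lt.1 (e1.trans hlt)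
    omega

include h E in
/-- The action of a group with a basic partition has no global fixed point. -/
theorem not_hasGlobalFixedPoint (hS : ∀ s ∈ S, s⁻¹ ∈ S) : ¬ HasGlobalFixedPoint φ := by
  rintro ⟨x, hx⟩
  obtain ⟨x, rfl⟩ := coe_surj x
  have hlift : ∀ g, ∃ F, IsLift F (φ g) ∧ F x = x := by
    intro g
    obtain ⟨H, hH⟩ := exists_isLift (φ g)
    obtain ⟨m, hm⟩ := coe_eq_coe_iff.1 ((hH x).symm.trans (hx g))
    exact ⟨_, hH.shift_mul m, by rw [RelIso.mul_apply]; exact hm.symm⟩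
  choose F hF hFx using hlift
  -- A fixed point in an open gap forces each generator to fix that gap, so it can be replaced by
  -- the left end point of the gap, which lies in `P`.
  obtain ⟨i, y, h1, h2, hFy⟩ : ∃ i y, E.a i ≤ y ∧ y ≤ E.b i ∧ ∀ s ∈ S, F s y = y := by
    rcases E.cover' x with ⟨i, h1, h2⟩ | ⟨i, h1, h2⟩
    · exact ⟨i, x, h1, h2, fun s _ => hFx s⟩
    · refine ⟨i, E.b i, (E.a_lt_b i).le, le_rfl, fun s hs => ?_⟩
      have e1 := (F s).strictMono h1
      have e2 := (F s).strictMono h2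
      rw [hFx] at e1 e2
      rcases lift_gap h E hs (hF s) i with ⟨j, f1, f2⟩ | ⟨j, f1, f2⟩
      · rw [f1] at e1
        rw [f2] at e2
        have := E.b_strictMono.lt_iff_lt.1 ((e1.trans h2).trans (E.a_lt_b (i + 1)))
        have := E.b_strictMono.lt_iff_lt.1 ((h1.trans e2).trans (E.a_lt_b (j + 1)))
        rw [f1, show j = i by omega]
      · have := E.a_strictMono.lt_iff_lt.1 ((f1.trans e1).trans h2)
        have := E.b_strictMono.lt_iff_lt.1 ((h1.trans e2).trans f2)
        omega
  -- A generator `s` not expanding the component `i` maps it into a component expanded by `s⁻¹`;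
  -- both contain the fixed point `y`, so that component is `i` again. Hence only one generator and
  -- its inverse occur.
  have hSs : ∀ s ∈ S, s = label h E i ∨ s⁻¹ = label h E i := by
    intro s hs
    by_contra hcon
    push Not at hcon
    obtain ⟨j, e0, e1, e2, -⟩ := lift_comp h E hS hs (hF s) hcon.1
    have e3 := (F s).monotone h1
    have e4 := (F s).monotone h2
    rw [hFy s hs] at e3 e4
    have := E.le_of_a_le_b ((e1.trans e3).trans h2)
    have := E.le_of_a_le_b (h1.trans (e4.trans e2))
    rw [show j = i by omega] at e0
    exact hcon.2 e0.symm
  set s := label h E i with hsdef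
  have hs : s ∈ S := label_mem h E i
  have hlab : ∀ m, label h E m ≠ s⁻¹ → label h E m = s := by
    intro m hm
    rcases hSs _ (label_mem h E m) with h3 | h3
    · exact h3
    · exact absurd (by rw [← h3, inv_inv]) hm
  have hexp : ∀ m, label h E m = s → ∃ j j', j < j' ∧ F s (E.a m) = E.a j ∧
      F s (E.b m) = E.b j' ∧ ∀ r, j ≤ r → r ≤ j' → label h E r = s := by
    intro m hm
    obtain ⟨j, j', h3, h4, h5, h6⟩ := lift_expand h E (i := m) (F := F s) (by rw [hm]; exact hF s)
    rw [hm] at h6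
    exact ⟨j, j', h3, h4, h5, fun r hr hr' => hlab r (h6 r hr hr')⟩
  obtain ⟨j, j', h3, h4, h5, h6⟩ := hexp i rfl
  have e3 := (F s).monotone h1
  have e4 := (F s).monotone h2
  rw [hFy s hs, h4] at e3
  rw [hFy s hs, h5] at e4
  have hji := E.le_of_a_le_b (e3.trans h2)
  have hij := E.le_of_a_le_b (h1.trans e4)
  have hFy1 : ∀ n : ℤ, F s (y + n) = y + n := fun n => by rw [(hF s).add_int, hFy s hs]
  -- The image of the component `i` covers a further component on the right or on the left. All
  -- components covered are again expanded by `s`, so the excess propagates component by component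
  -- through a whole period, past the fixed point `y + 1` or `y - 1`; this is impossible.
  rcases lt_or_ge i j' with hlt | hge
  · have key : ∀ n : ℕ, ∃ p, i + n < p ∧ F s (E.b (i + n)) = E.b p ∧
        ∀ r, i ≤ r → r ≤ p → label h E r = s := by
      intro n
      induction n with
      | zero => exact ⟨j', by simpa using hlt, by simpa using h5, fun r hr hr' => h6 r (by omega) hr'⟩
      | succ n ih =>
        obtain ⟨p, e5, e6, e7⟩ := ih
        have e8 := lift_next_of_b h E hs (hF s) e6
        obtain ⟨q, q', f1, f2, f3, f4⟩ := hexp (i + n + 1) (e7 _ (by omega) (by omega))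
        have hq : q = p + 1 := E.a_strictMono.injective (f2.symm.trans e8)
        refine ⟨q', by push_cast; omega, by rw [← f3]; push_cast; congr 2; ring, fun r hr hr' => ?_⟩
        rcases le_or_gt r p with h | h
        · exact e7 r hr h
        · exact f4 r (by omega) hr'
    obtain ⟨p, e5, e6, -⟩ := key (E.N - 1)
    have hN := E.N_pos
    have e7 : E.b (i + (E.N - 1 : ℕ)) < y + (1 : ℤ) := by
      refine lt_of_lt_of_le ?_ (add_le_add_left h1 _)
      rw [← E.a_add_mul]
      exact E.b_lt_a' (by omega)
    have e8 := (F s).strictMono e7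
    rw [hFy1, e6] at e8
    have e9 : y + (1 : ℤ) ≤ E.b p := by
      refine (add_le_add_left h2 _).trans ?_
      rw [← E.b_add_mul]
      exact E.b_strictMono.monotone (by omega)
    linarith
  · have key : ∀ n : ℕ, ∃ p, p < i - n ∧ F s (E.a (i - n)) = E.a p ∧
        ∀ r, p ≤ r → r ≤ i → label h E r = s := by
      intro n
      induction n with
      | zero => exact ⟨j, by push_cast; omega, by simpa using h4, fun r hr hr' => h6 r hr (by omega)⟩
      | succ n ih =>
        obtain ⟨p, e5, e6, e7⟩ := ih
        have e8 := lift_prev_of_a h E hs (hF s) e6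
        obtain ⟨q, q', f1, f2, f3, f4⟩ := hexp (i - n - 1) (e7 _ (by omega) (by omega))
        have hq : q' = p - 1 := E.b_strictMono.injective (f3.symm.trans e8)
        refine ⟨q, by push_cast; omega, by rw [← f2]; push_cast; congr 2; ring, fun r hr hr' => ?_⟩
        rcases lt_or_ge r p with h | h
        · exact f4 r hr (by omega)
        · exact e7 r h hr'
    obtain ⟨p, e5, e6, -⟩ := key (E.N - 1)
    have hN := E.N_pos
    have e7 : y + (-1 : ℤ) < E.a (i - (E.N - 1 : ℕ)) := by
      refine lt_of_le_of_lt (add_le_add_left h2 _) ?_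
      rw [← E.b_add_mul]
      exact E.b_lt_a' (by omega)
    have e8 := (F s).strictMono e7
    rw [hFy1, e6] at e8
    have e9 : E.a p ≤ y + (-1 : ℤ) := by
      refine le_trans ?_ (add_le_add_left h1 _)
      rw [← E.a_add_mul]
      exact E.a_strictMono.monotone (by omega)
    linarith

end FixedPoint

end

section

/-! ### Entrances of edge groups -/

namespace TreeOfGroups

variable {𝒯 : TreeOfGroups}

/-- The group of the edge `{v, u}` as a subgroup of the group of `v`. -/
def edgeSub {v u : 𝒯.V} (h : 𝒯.graph.Adj v u) : Subgroup (𝒯.Γ v) :=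
  𝒯.edgeSubgroup ⟨s(v, u), h⟩ v (Sym2.mem_mk_left v u)

theorem edgeSubgroup_eq_edgeSub {v u : 𝒯.V} (h : 𝒯.graph.Adj v u) (e : 𝒯.graph.edgeSet)
    (he : (e : Sym2 𝒯.V) = s(v, u)) (hv : v ∈ (e : Sym2 𝒯.V)) :
    𝒯.edgeSubgroup e v hv = edgeSub h := by
  obtain ⟨e, he'⟩ := e
  subst he
  rfl

theorem vertexMap_ι (e : 𝒯.graph.edgeSet) (v : 𝒯.V) (hv : v ∈ (e : Sym2 𝒯.V)) (x : 𝒯.Λ e) :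
    𝒯.vertexMap v (𝒯.ι e v hv x) = QuotientGroup.mk' (Subgroup.normalClosure 𝒯.relators)
      (Monoid.Coprod.inr (Monoid.CoprodI.of x)) := by
  symm
  rw [← mul_inv_eq_one, vertexMap, MonoidHom.comp_apply, MonoidHom.comp_apply, ← map_inv, ← map_mul]
  exact (QuotientGroup.eq_one_iff _).2 (Subgroup.subset_normalClosure ⟨e, v, hv, x, rfl⟩)

end TreeOfGroups

open TreeOfGroups

namespace BasicConfiguration

variable {𝒯 : TreeOfGroups} {φ : 𝒯.FundamentalGroup →* HomeoPlus} (B : BasicConfiguration 𝒯 φ)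
  (E : ∀ v, Enum (B.P v))

/-- The gap with number `i` at the vertex `v` belongs to the entrance of the edge `{v, u}`. -/
def Ent {v u : 𝒯.V} (h : 𝒯.graph.Adj v u) (i : ℤ) : Prop :=
  stab (𝒯.restrict φ v) ((E v).gap i) ≠ ⊥ ∧ stab (𝒯.restrict φ v) ((E v).gap i) ≤ edgeSub h

theorem ent_add {v u : 𝒯.V} (h : 𝒯.graph.Adj v u) (i m : ℤ) :
    B.Ent E h (i + (E v).N * m) ↔ B.Ent E h i := by
  rw [Ent, Ent, (E v).gap_add]

theorem mem_entrance_iff {v u : 𝒯.V} (h : 𝒯.graph.Adj v u) (t : ℝ) :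
    (t : Circ) ∈ entrance (𝒯.restrict φ v) (edgeSub h) (B.P v) ↔
      ∃ i, B.Ent E h i ∧ (E v).b i ≤ t ∧ t ≤ (E v).a (i + 1) := by
  constructor
  · rintro ⟨J, ⟨hJ, h1, h2⟩, ht⟩
    obtain ⟨i, rfl⟩ := ((E v).isComponent_sharp_iff J).1 hJ
    obtain ⟨n, hn⟩ := coe_mem_image.1 ht
    refine ⟨i + (E v).N * (-n), (B.ent_add E h _ _).2 ⟨h1, h2⟩, ?_, ?_⟩
    · rw [(E v).b_add_mul]; push_cast; linarith [hn.1]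
    · rw [show i + (E v).N * (-n) + 1 = i + 1 + (E v).N * (-n) by ring, (E v).a_add_mul]
      push_cast; linarith [hn.2]
  · rintro ⟨i, ⟨h1, h2⟩, h3, h4⟩
    exact ⟨(E v).gap i, ⟨((E v).isComponent_sharp_iff _).2 ⟨i, rfl⟩, h1, h2⟩, t, ⟨h3, h4⟩, rfl⟩

theorem mem_interior_entrance {v u : 𝒯.V} (h : 𝒯.graph.Adj v u) {i : ℤ} (hi : B.Ent E h i) {t : ℝ}
    (h1 : (E v).b i < t) (h2 : t < (E v).a (i + 1)) :
    (t : Circ) ∈ interior (entrance (𝒯.restrict φ v) (edgeSub h) (B.P v)) := by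
  have hsub : ((↑) : ℝ → Circ) '' Ioo ((E v).b i) ((E v).a (i + 1)) ⊆
      entrance (𝒯.restrict φ v) (edgeSub h) (B.P v) := by
    rintro _ ⟨s, hs, rfl⟩
    exact (B.mem_entrance_iff E h s).2 ⟨i, hi, hs.1.le, hs.2.le⟩
  exact interior_maximal hsub (isOpenMap_coe _ isOpen_Ioo) ⟨t, ⟨h1, h2⟩, rfl⟩

theorem combinable' {v u : 𝒯.V} (h : 𝒯.graph.Adj v u) :
    entrance (𝒯.restrict φ v) (edgeSub h) (B.P v) ∪
        entrance (𝒯.restrict φ u) (edgeSub h.symm) (B.P u) = univ ∧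
      interior (entrance (𝒯.restrict φ v) (edgeSub h) (B.P v)) ∩
        interior (entrance (𝒯.restrict φ u) (edgeSub h.symm) (B.P u)) = ∅ := by
  have := B.combinable ⟨s(v, u), h⟩ v u (Sym2.mem_mk_left v u) (Sym2.mem_mk_right v u) h.ne
  rwa [edgeSubgroup_eq_edgeSub h _ rfl, edgeSubgroup_eq_edgeSub h.symm _ Sym2.eq_swap] at this

/-- An open interval covered by an entrance is contained in a single gap. -/
theorem exists_gap_of_cover {v u : 𝒯.V} (h : 𝒯.graph.Adj v u) {x y : ℝ} (hxy : x < y)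
    (hcov : ∀ t, x < t → t < y → ∃ i, B.Ent E h i ∧ (E v).b i ≤ t ∧ t ≤ (E v).a (i + 1)) :
    ∃ i, B.Ent E h i ∧ (E v).b i ≤ x ∧ y ≤ (E v).a (i + 1) := by
  have hno : ∀ t j, x < t → t < y → (E v).a j < t → t < (E v).b j → False := by
    intro t j h1 h2 h3 h4
    obtain ⟨i, -, h5, h6⟩ := hcov t h1 h2
    have := (E v).b_strictMono.lt_iff_lt.1 (h5.trans_lt h4)
    have := (E v).a_strictMono.lt_iff_lt.1 (h3.trans_le h6)
    omega
  obtain ⟨t, h1, h2⟩ := exists_between hxy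
  obtain ⟨i, hi, h3, h4⟩ := hcov t h1 h2
  refine ⟨i, hi, ?_, ?_⟩
  · by_contra hcon
    push Not at hcon
    obtain ⟨s, h5, h6⟩ := exists_between (max_lt hcon ((E v).a_lt_b i))
    exact hno s i ((le_max_left _ _).trans_lt h5) (by linarith) ((le_max_right _ _).trans_lt h5) h6
  · by_contra hcon
    push Not at hcon
    obtain ⟨s, h5, h6⟩ := exists_between (lt_min hcon ((E v).a_lt_b (i + 1)))
    exact hno s (i + 1) (by linarith) (h6.trans_le (min_le_left _ _)) h5
      (h6.trans_le (min_le_right _ _))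

/-- The two entrances cover the circle, so an interval avoiding one is covered by the other, and
then lies in a single gap of it. -/
theorem cover_of_avoid {v u : 𝒯.V} (h : 𝒯.graph.Adj v u) {x y : ℝ} (hxy : x < y)
    (hav : ∀ t, x < t → t < y → ∀ i, B.Ent E h i → (E v).b i ≤ t → t ≤ (E v).a (i + 1) → False) :
    ∃ m, B.Ent E h.symm m ∧ (E u).b m ≤ x ∧ y ≤ (E u).a (m + 1) := by
  refine B.exists_gap_of_cover E h.symm hxy fun t h1 h2 => ?_
  rw [← mem_entrance_iff]
  have hmem : (t : Circ) ∈ entrance (𝒯.restrict φ v) (edgeSub h) (B.P v) ∪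
      entrance (𝒯.restrict φ u) (edgeSub h.symm) (B.P u) := by
    rw [(B.combinable' h).1]; trivial
  rcases hmem with hm | hm
  · obtain ⟨i, h3, h4, h5⟩ := (B.mem_entrance_iff E h t).1 hm
    exact (hav t h1 h2 i h3 h4 h5).elim
  · exact hm

theorem comp_sub {v u : 𝒯.V} (h : 𝒯.graph.Adj v u) (j : ℤ) :
    ∃ m, B.Ent E h.symm m ∧ (E u).b m ≤ (E v).a j ∧ (E v).b j ≤ (E u).a (m + 1) := by
  refine B.cover_of_avoid E h ((E v).a_lt_b j) fun t h1 h2 i _ h3 h4 => ?_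
  have := (E v).b_strictMono.lt_iff_lt.1 (h3.trans_lt h2)
  have := (E v).a_strictMono.lt_iff_lt.1 (h1.trans_le h4)
  omega

theorem gap_sub {v u : 𝒯.V} (h : 𝒯.graph.Adj v u) {j : ℤ} (hj : ¬ B.Ent E h j) :
    ∃ m, B.Ent E h.symm m ∧ (E u).b m ≤ (E v).b j ∧ (E v).a (j + 1) ≤ (E u).a (m + 1) := by
  refine B.cover_of_avoid E h ((E v).b_lt_a j) fun t h1 h2 i hi h3 h4 => ?_
  have := (E v).lt_of_b_le_a (h3.trans h2.le)
  have := (E v).lt_of_b_le_a (h1.le.trans h4)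
  rw [show j = i by omega] at hj
  exact hj hi

/-- The component of `u` to the left of the gap `m` lies in an entrance gap of `v`. If the latter
extended beyond the common point, the interiors of the two entrances would meet. -/
theorem exists_left_gap {v u : 𝒯.V} (h : 𝒯.graph.Adj v u) {m : ℤ} (hm : B.Ent E h.symm m) :
    ∃ i, B.Ent E h i ∧ (E v).a (i + 1) = (E u).b m := by
  obtain ⟨i, h1, h2, h3⟩ := B.comp_sub E h.symm m
  refine ⟨i, h1, le_antisymm ?_ h3⟩
  by_contra hcon
  push Not at hcon
  obtain ⟨t, h4, h5⟩ := exists_between (lt_min hcon ((E u).b_lt_a m))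
  have h6 := B.mem_interior_entrance E h h1 (t := t)
    (h2.trans_lt (((E u).a_lt_b m).trans h4)) (h5.trans_le (min_le_left _ _))
  have h7 := B.mem_interior_entrance E h.symm hm h4 (h5.trans_le (min_le_right _ _))
  have := (B.combinable' h).2
  exact Set.eq_empty_iff_forall_notMem.1 this _ ⟨h6, h7⟩

theorem exists_right_gap {v u : 𝒯.V} (h : 𝒯.graph.Adj v u) {m : ℤ} (hm : B.Ent E h.symm m) :
    ∃ i, B.Ent E h i ∧ (E v).b i = (E u).a (m + 1) := by
  obtain ⟨i, h1, h2, h3⟩ := B.comp_sub E h.symm (m + 1)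
  refine ⟨i, h1, le_antisymm h2 ?_⟩
  by_contra hcon
  push Not at hcon
  obtain ⟨t, h4, h5⟩ := exists_between (max_lt hcon ((E u).b_lt_a m))
  have h6 := B.mem_interior_entrance E h h1 (t := t) ((le_max_left _ _).trans_lt h4)
    (h5.trans (((E u).a_lt_b (m + 1)).trans_le h3))
  have h7 := B.mem_interior_entrance E h.symm hm ((le_max_right _ _).trans_lt h4) h5
  have := (B.combinable' h).2
  exact Set.eq_empty_iff_forall_notMem.1 this _ ⟨h6, h7⟩

/-- Since the edge group is cyclic, `Coding.entranceGaps_invariant` applies: one gap of the entrance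
returning to the entrance forces the whole entrance to do so. -/
theorem image_entrance_subset {v u : 𝒯.V} (h : 𝒯.graph.Adj v u) {γ : 𝒯.Γ v} {i j : ℤ}
    (hi : B.Ent E h i) (hj : B.Ent E h j)
    (hij : 𝒯.restrict φ v γ '' (E v).gap i = (E v).gap j) :
    𝒯.restrict φ v γ '' entrance (𝒯.restrict φ v) (edgeSub h) (B.P v) ⊆
      entrance (𝒯.restrict φ v) (edgeSub h) (B.P v) := by
  have hcyc := B.edge_cyclic ⟨s(v, u), h⟩
  obtain ⟨z, hz⟩ := hcyc.exists_generator
  have hL : edgeSub h = Subgroup.zpowers (𝒯.ι ⟨s(v, u), h⟩ v (Sym2.mem_mk_left v u) z) := by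
    rw [edgeSub, edgeSubgroup, ← MonoidHom.map_zpowers, MonoidHom.range_eq_map]
    congr 1
    exact ((Subgroup.eq_top_iff' _).2 hz).symm
  let D := codingOf (B.pure v) (E v) (B.S_symm v) (B.S_generates v)
  have hmem : ∀ m, B.Ent E h m → (E v).gap m ∈ D.entranceGaps (edgeSub h) := by
    rintro m ⟨h1, h2⟩
    obtain ⟨⟨g, hg⟩, hg1⟩ := Subgroup.ne_bot_iff_exists_ne_one.1 h1
    exact ⟨⟨m, rfl⟩, ⟨g, fun h => hg1 (Subtype.ext h), hg⟩, fun g hg => h2 hg⟩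
  have hij' : D.act γ ((E v).gap i) ∈ D.entranceGaps (edgeSub h) := by
    change 𝒯.restrict φ v γ '' (E v).gap i ∈ _
    rw [hij]; exact hmem j hj
  rintro _ ⟨y, ⟨J, ⟨hJ, h1, h2⟩, hy⟩, rfl⟩
  obtain ⟨m, rfl⟩ := ((E v).isComponent_sharp_iff J).1 hJ
  obtain ⟨⟨n, hn⟩, ⟨g, hg1, hg⟩, h3⟩ := D.entranceGaps_invariant hL (hmem i hi) hij' (hmem m ⟨h1, h2⟩)
  refine ⟨𝒯.restrict φ v γ '' (E v).gap m, ⟨((E v).isComponent_sharp_iff _).2 ⟨n, hn.symm⟩, ?_,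
    fun g hg => h3 g hg⟩, y, hy, rfl⟩
  exact Subgroup.ne_bot_iff_exists_ne_one.2 ⟨⟨g, hg⟩, fun h => hg1 (congrArg Subtype.val h)⟩

/-- An element mapping a gap of the entrance of an edge group to a gap of the entrance of an edge
group belongs to the edge group, and the two edges coincide. -/
theorem ent_unique {v u u' : 𝒯.V} (h : 𝒯.graph.Adj v u) (h' : 𝒯.graph.Adj v u') {γ : 𝒯.Γ v}
    {i j : ℤ} (hi : B.Ent E h i) (hj : B.Ent E h' j) {F : ℝ ≃o ℝ}
    (hF : IsLift F (𝒯.restrict φ v γ)) (hb : F ((E v).b i) = (E v).b j)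
    (ha : F ((E v).a (i + 1)) = (E v).a (j + 1)) : u = u' ∧ γ ∈ edgeSub h := by
  have hij := image_gap (E v) hF hb ha
  have hinv : 𝒯.restrict φ v γ⁻¹ '' (E v).gap j = (E v).gap i := by
    rw [← hij, ← image_comp, map_inv]
    have : (((𝒯.restrict φ v γ)⁻¹ : HomeoPlus) : Circ → Circ) ∘ 𝒯.restrict φ v γ = id := by
      funext x
      exact (𝒯.restrict φ v γ : Circ ≃ₜ Circ).symm_apply_apply x
    rw [this, image_id]
  have huu : u = u' := by
    by_contra hne
    have hne' : (⟨s(v, u'), h'⟩ : 𝒯.graph.edgeSet) ≠ ⟨s(v, u), h⟩ := by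
      intro he
      have := Sym2.congr_right.1 (congrArg Subtype.val he)
      exact hne this.symm
    -- A nontrivial element stabilizing the gap `j` lies in the second edge group and in the
    -- conjugate by `γ` of the first one.
    have htr := B.edge_transverse v _ _ (Sym2.mem_mk_left v u') (Sym2.mem_mk_left v u) hne' γ
    obtain ⟨⟨g, hg⟩, hg1⟩ := Subgroup.ne_bot_iff_exists_ne_one.1 hj.1
    have hg1 : g ≠ 1 := fun h => hg1 (Subtype.ext h)
    refine hg1 ((Subgroup.mem_bot).1 ?_)
    rw [← htr]
    refine ⟨hj.2 hg, γ⁻¹ * g * γ, hi.2 ?_, ?_⟩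
    · have hmul : ∀ x y, (𝒯.restrict φ v (x * y) : Circ → Circ) =
          𝒯.restrict φ v x ∘ 𝒯.restrict φ v y := fun x y => by rw [map_mul]; rfl
      change 𝒯.restrict φ v (γ⁻¹ * g * γ) '' (E v).gap i = (E v).gap i
      have hg : 𝒯.restrict φ v g '' (E v).gap j = (E v).gap j := hg
      rw [hmul, image_comp, hij, hmul, image_comp, hg, hinv]
    · simp [MulAut.conj_apply, mul_assoc]
  subst huu
  refine ⟨rfl, ?_⟩
  have hst := B.stab_entrance ⟨s(v, u), h⟩ v (Sym2.mem_mk_left v u)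
  change _ ∈ 𝒯.edgeSubgroup _ _ _
  rw [← hst]
  refine Subset.antisymm (B.image_entrance_subset E h hi hj hij) ?_
  intro x hx
  refine ⟨𝒯.restrict φ v γ⁻¹ x, B.image_entrance_subset E h hj hi hinv ⟨x, hx, rfl⟩, ?_⟩
  rw [map_inv]
  exact (𝒯.restrict φ v γ : Circ ≃ₜ Circ).apply_symm_apply x

end BasicConfiguration

end

section

/-! ### Lifts of all generators and their perturbations -/

/-- A robust configuration for `φ`, a `k`-fold lift `ψ` of `φ`, and coherent choices of lifts for
the elements of the vertex groups under `ψ` and under all homomorphisms near `ψ`. -/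
structure Setup (𝒯 : TreeOfGroups) (φ ψ : 𝒯.FundamentalGroup →* HomeoPlus) (k : ℕ) where
  B : BasicConfiguration 𝒯 φ
  robust : B.IsRobust
  one_le : 1 ≤ k
  fold : IsFoldLift k ψ φ
  E : ∀ v, Enum (B.P v)
  F : ∀ v, 𝒯.Γ v → ℝ ≃o ℝ
  F' : (𝒯.FundamentalGroup →* HomeoPlus) → ∀ v, 𝒯.Γ v → ℝ ≃o ℝ
  lift : ∀ v γ, IsScaledLift k (F v γ) (ψ (𝒯.vertexMap v γ))
  lift' : ∀ ω v γ, IsScaledLift k (F' ω v γ) (ω (𝒯.vertexMap v γ))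
  tendsto : ∀ v γ t, Filter.Tendsto (fun ω => F' ω v γ t) (@nhds _ (weakTopology _) ψ)
    (𝓝 (F v γ t))

theorem exists_setup {𝒯 : TreeOfGroups} {φ ψ : 𝒯.FundamentalGroup →* HomeoPlus} {k : ℕ}
    (B : BasicConfiguration 𝒯 φ) (hB : B.IsRobust) (hk : 1 ≤ k) (hψ : IsFoldLift k ψ φ) :
    Nonempty (Setup 𝒯 φ ψ k) := by
  choose F F' h1 h2 h3 using fun v γ => exists_converging_lift hk ψ (𝒯.vertexMap v γ)
  exact ⟨⟨B, hB, hk, hψ, fun v => (B.pure v).exists_enum.some, F, fun ω v γ => F' v γ ω, h1,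
    fun ω v γ => h2 v γ ω, h3⟩⟩

namespace Setup

open TreeOfGroups

variable {𝒯 : TreeOfGroups} {φ ψ : 𝒯.FundamentalGroup →* HomeoPlus} {k : ℕ} (D : Setup 𝒯 φ ψ k)

/-- The neighbourhood filter of `ψ`. -/
def nbhds (_ : Setup 𝒯 φ ψ k) : Filter (𝒯.FundamentalGroup →* HomeoPlus) :=
  @nhds _ (weakTopology _) ψ

/-- Words in the generators of a vertex group. -/
abbrev W (v : 𝒯.V) : Type _ := FreeGroup (Option (D.B.S v))

/-- The action of words on the line. -/
def f (v : 𝒯.V) : D.W v →* (ℝ ≃o ℝ) := letterMap (D.B.S v) (shift k) (D.F v)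

/-- The perturbed action of words on the line. -/
def f' (ω : 𝒯.FundamentalGroup →* HomeoPlus) (v : 𝒯.V) : D.W v →* (ℝ ≃o ℝ) :=
  letterMap (D.B.S v) (shift k) (D.F' ω v)

/-- The element of the vertex group given by a word. -/
def η (v : 𝒯.V) : D.W v →* 𝒯.Γ v := wordProd (D.B.S v)

/-- The central letter. -/
def τ (v : 𝒯.V) : D.W v := FreeGroup.of none

theorem η_τ (v : 𝒯.V) : D.η v (D.τ v) = 1 := letterMap_none _ _

theorem f_τ (v : 𝒯.V) : D.f v (D.τ v) = shift k := letterMap_none _ _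

theorem f'_τ (ω) (v : 𝒯.V) : D.f' ω v (D.τ v) = shift k := letterMap_none _ _

theorem η_surjective (v : 𝒯.V) : Function.Surjective (D.η v) :=
  wordProd_surjective (D.B.S_generates v)

theorem scaled_f (v : 𝒯.V) (w : D.W v) :
    IsScaledLift k (D.f v w) (ψ (𝒯.vertexMap v (D.η v w))) :=
  IsScaledLift.letterMap (θ := ψ.comp (𝒯.vertexMap v)) (fun s _ => D.lift v s) w

theorem scaled_f' (ω) (v : 𝒯.V) (w : D.W v) :
    IsScaledLift k (D.f' ω v w) (ω (𝒯.vertexMap v (D.η v w))) :=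
  IsScaledLift.letterMap (θ := ω.comp (𝒯.vertexMap v)) (fun s _ => D.lift' ω v s) w

theorem isLift_f (v : 𝒯.V) (w : D.W v) : IsLift (D.f v w) (𝒯.restrict φ v (D.η v w)) :=
  (D.scaled_f v w).isLift D.fold D.one_le

theorem converges (v : 𝒯.V) : Converges D.nbhds (fun ω => D.f' ω v) (D.f v) :=
  converges_letterMap fun s _ t => D.tendsto v s t

/-- The relations between inverse generators lift to the same translations for the original and the
perturbed actions. -/
def Good (ω : 𝒯.FundamentalGroup →* HomeoPlus) : Prop :=
  ∀ v, ∀ s ∈ D.B.S v, ∃ n : ℤ, D.F v s * D.F v s⁻¹ = shift k ^ n ∧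
    D.F' ω v s * D.F' ω v s⁻¹ = shift k ^ n

/-- Each relation holds eventually by `eventually_eq_shift`, and there are only finitely many
vertices and generators. -/
theorem eventually_good : ∀ᶠ ω in D.nbhds, D.Good ω := by
  have := 𝒯.finite_V
  refine Filter.eventually_all.2 fun v => ?_
  refine (Filter.eventually_all_finite (D.B.S_finite v)).2 fun s _ => ?_
  have hone : ∀ ω : 𝒯.FundamentalGroup →* HomeoPlus,
      ω (𝒯.vertexMap v s) * ω (𝒯.vertexMap v s⁻¹) = 1 := fun ω => by
    rw [← map_mul, ← map_mul, mul_inv_cancel, map_one, map_one]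
  have h1 := (D.lift v s).mul (D.lift v s⁻¹)
  rw [hone] at h1
  obtain ⟨n, h2, h3⟩ := eventually_eq_shift (l := D.nbhds) D.one_le h1
    (F' := fun ω => D.F' ω v s * D.F' ω v s⁻¹)
    (fun ω => by rw [← hone ω]; exact (D.lift' ω v s).mul (D.lift' ω v s⁻¹))
    (tendsto_mul (D.tendsto v s) (D.tendsto v s⁻¹) 0)
  filter_upwards [h3] with ω h3
  exact ⟨n, h2, h3⟩

/-- Nonempty reduced words are nontrivial in the vertex group, so a word representing the identity
reduces to a power of the central letter, with the same exponent for both actions. -/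
theorem kernel {ω} (hω : D.Good ω) {v : 𝒯.V} {w : D.W v} (hw : D.η v w = 1) :
    ∃ n : ℤ, D.f v w = shift k ^ n ∧ D.f' ω v w = shift k ^ n := by
  obtain ⟨n, l, hl, h1, h2, h3⟩ := exists_reduced_pair (D.B.S_symm v)
    (fun s _ => (D.lift v s).commute D.one_le) (fun s _ => (D.lift' ω v s).commute D.one_le)
    (hω v) w
  have hnil : l = [] := by
    by_contra hne
    exact (codingOf (D.B.pure v) (D.E v) (D.B.S_symm v) (D.B.S_generates v)).free l hl hne
      (h1.symm.trans hw)
  subst hnil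
  refine ⟨n, ?_, ?_⟩
  · rw [f, h2]; simp
  · rw [f', h3]; simp

theorem eq_of_η_eq {ω} (hω : D.Good ω) {v : 𝒯.V} {w w' : D.W v} (h : D.η v w = D.η v w') :
    ∃ n : ℤ, D.f v w = shift k ^ n * D.f v w' ∧ D.f' ω v w = shift k ^ n * D.f' ω v w' := by
  obtain ⟨n, h1, h2⟩ := D.kernel hω (w := w * w'⁻¹) (by rw [map_mul, map_inv, h, mul_inv_cancel])
  refine ⟨n, ?_, ?_⟩
  · rw [← h1, map_mul, map_inv, inv_mul_cancel_right]
  · rw [← h2, map_mul, map_inv, inv_mul_cancel_right]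

/-! ### Words acting on gaps, and the persistence of end points -/

/-- The word `w` maps the gap `i` at the vertex `v` to the gap `j`. -/
def Rel (v : 𝒯.V) (w : D.W v) (i j : ℤ) : Prop :=
  D.f v w ((D.E v).b i) = (D.E v).b j ∧ D.f v w ((D.E v).a (i + 1)) = (D.E v).a (j + 1)

variable {D} in
theorem Rel.mul {v : 𝒯.V} {w w' : D.W v} {i j m : ℤ} (h : D.Rel v w i j) (h' : D.Rel v w' j m) :
    D.Rel v (w' * w) i m := by
  constructor
  · rw [map_mul, RelIso.mul_apply, h.1, h'.1]
  · rw [map_mul, RelIso.mul_apply, h.2, h'.2]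

variable {D} in
theorem Rel.inv {v : 𝒯.V} {w : D.W v} {i j : ℤ} (h : D.Rel v w i j) : D.Rel v w⁻¹ j i := by
  constructor
  · rw [map_inv, ← h.1]; exact RelIso.inv_apply_self _ _
  · rw [map_inv, ← h.2]; exact RelIso.inv_apply_self _ _

theorem rel_τ (v : 𝒯.V) (i n : ℤ) : D.Rel v (D.τ v ^ n) i (i + (D.E v).N * (k * n)) := by
  constructor
  · rw [map_zpow, f_τ, (D.E v).shift_b]
  · rw [map_zpow, f_τ, show i + (D.E v).N * (k * n) + 1 = i + 1 + (D.E v).N * (k * n) by ring,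
      (D.E v).shift_a]

theorem rel_of_b {v : 𝒯.V} {w : D.W v} {i j : ℤ} (h : D.f v w ((D.E v).b i) = (D.E v).b j) :
    D.Rel v w i j := by
  rcases lift_position (D.B.pure v) (D.E v) (D.B.S_symm v) (D.B.S_generates v)
    (D.isLift_f v w) i with ⟨m, h1, h2⟩ | ⟨m, h1, h2⟩
  · rw [(D.E v).b_strictMono.injective (h.symm.trans h1)]; exact ⟨h1, h2⟩
  · exfalso
    have hlt := (D.f v w).strictMono ((D.E v).b_lt_a i)
    rw [h] at h1 hlt
    have := (D.E v).le_of_a_le_b h1.le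
    have := (D.E v).b_strictMono.lt_iff_lt.1 (hlt.trans h2)
    omega

theorem rel_of_a {v : 𝒯.V} {w : D.W v} {i j : ℤ}
    (h : D.f v w ((D.E v).a (i + 1)) = (D.E v).a (j + 1)) : D.Rel v w i j := by
  rcases lift_position (D.B.pure v) (D.E v) (D.B.S_symm v) (D.B.S_generates v)
    (D.isLift_f v w) i with ⟨m, h1, h2⟩ | ⟨m, h1, h2⟩
  · have := (D.E v).a_strictMono.injective (h.symm.trans h2)
    rw [show j = m by omega]; exact ⟨h1, h2⟩
  · exfalso
    have hlt := (D.f v w).strictMono ((D.E v).b_lt_a i)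
    rw [h] at h2 hlt
    have := (D.E v).le_of_a_le_b h2.le
    have := (D.E v).a_strictMono.lt_iff_lt.1 (h1.trans hlt)
    omega

/-- For every gap there is a word fixing it and acting nontrivially on the circle, such that all
words fixing the gap are commensurable to it. -/
theorem exists_loop (v : 𝒯.V) (i : ℤ) : ∃ q : D.W v, D.Rel v q i i ∧
    𝒯.restrict φ v (D.η v q) ≠ 1 ∧ ∀ ω, D.Good ω → ∀ w, D.Rel v w i i →
      ∃ m n : ℤ, m ≠ 0 ∧ D.f' ω v w ^ m = D.f' ω v q ^ n := by
  let X := codingOf (D.B.pure v) (D.E v) (D.B.S_symm v) (D.B.S_generates v)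
  have hJ : (D.E v).gap i ∈ X.gaps := ⟨i, rfl⟩
  obtain ⟨p, hp0, hp⟩ := X.exists_period hJ
  have hk := D.one_le
  obtain ⟨c, hc⟩ := D.η_surjective v (X.w p ((D.E v).gap i))
  have hfix : 𝒯.restrict φ v (D.η v c) '' (D.E v).gap i = (D.E v).gap i := by
    rw [hc]
    exact (X.act_w p _).trans hp
  obtain ⟨n, h1, h2⟩ := lift_of_image_gap (D.E v) (D.isLift_f v c) hfix
  rw [(D.E v).b_add_mul] at h1
  rw [show i + (D.E v).N * n + 1 = i + 1 + (D.E v).N * n by ring, (D.E v).a_add_mul] at h2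
  have hpow : ∀ t, D.f v c t = t + n → ∀ m : ℕ, D.f v (c ^ m) t = t + ((m * n : ℤ) : ℝ) := by
    intro t ht m
    induction m with
    | zero => simp
    | succ m ih =>
      rw [pow_succ', map_mul, RelIso.mul_apply, ih, (D.isLift_f v c).add_int, ht]
      push_cast; ring
  -- The loop may translate the lifted gap by an integer `n`, whereas the central letter is a
  -- translation by `k`. The `k`-th power of the loop translates by `k * n`, which `τ ^ (-n)`
  -- compensates.
  have hq : ∀ t, D.f v c t = t + n → D.f v (D.τ v ^ (-n) * c ^ k) t = t := by
    intro t ht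
    rw [map_mul, RelIso.mul_apply, hpow t ht, map_zpow, f_τ, shift_zpow]
    simp [mul_comm]
  have hrel : D.Rel v (D.τ v ^ (-n) * c ^ k) i i := ⟨hq _ h1, hq _ h2⟩
  have hη : D.η v (D.τ v ^ (-n) * c ^ k) = X.w (p * k) ((D.E v).gap i) := by
    rw [map_mul, map_zpow, η_τ, one_zpow, one_mul, map_pow, hc, X.w_pow hp]
  refine ⟨D.τ v ^ (-n) * c ^ k, hrel, ?_, ?_⟩
  · rw [hη]
    refine reduced_ne_one (D.B.pure v) (D.E v) (D.B.S_symm v) (X.reduced_wl hJ _) ?_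
    intro hnil
    have hlen := congrArg List.length hnil
    rw [X.length_wl] at hlen
    have hpos : 0 < p * k := Nat.mul_pos hp0 hk
    exact hpos.ne' hlen
  · intro ω hω w hw
    obtain ⟨m, hm⟩ := X.stabilizer_pow hJ hp (g := D.η v w)
      (image_gap (D.E v) (D.isLift_f v w) hw.1 hw.2)
    have hηw : D.η v (w ^ (p * k)) = D.η v ((D.τ v ^ (-n) * c ^ k) ^ m) := by
      rw [map_pow, map_zpow, hη, ← X.w_pow hp, pow_mul, hm, ← zpow_natCast, ← zpow_natCast,
        ← zpow_mul, ← zpow_mul, mul_comm]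
    obtain ⟨r, h3, h4⟩ := D.eq_of_η_eq hω hηw
    -- Both words fix the point `b i`, so the translation between them is trivial.
    have hr : r = 0 := by
      have h5 := congrArg (fun G : ℝ ≃o ℝ => G ((D.E v).b i)) h3
      simp only [RelIso.mul_apply] at h5
      rw [map_pow, ← zpow_natCast, zpow_fixed hw.1, map_zpow, zpow_fixed hrel.1, shift_zpow] at h5
      have hk' : (k : ℝ) ≠ 0 := by positivity
      simpa [hk'] using h5
    refine ⟨(p * k : ℕ), m, by positivity, ?_⟩
    rw [hr, zpow_zero, one_mul, map_pow, map_zpow] at h4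
    rw [zpow_natCast]; exact h4

/-- The end points of gaps. -/
def pt (v : 𝒯.V) (i : ℤ) : Bool → ℝ
  | false => (D.E v).b i
  | true => (D.E v).a (i + 1)

theorem rel_iff (v : 𝒯.V) (w : D.W v) (i j : ℤ) :
    D.Rel v w i j ↔ ∀ s, D.f v w (D.pt v i s) = D.pt v j s := by
  rw [Bool.forall_bool]; rfl

theorem pt_mem_points (v : 𝒯.V) (i : ℤ) (s : Bool) : (D.pt v i s : Circ) ∈ D.B.points := by
  refine mem_iUnion.2 ⟨v, ((D.E v).mem_boundaryPart_iff _).2 ?_⟩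
  cases s
  · exact ⟨i, Or.inr rfl⟩
  · exact ⟨i + 1, Or.inl rfl⟩

/-- Equivariant perturbation of the end points of a set of gaps at a vertex. -/
theorem exists_perturbed_gaps (v : 𝒯.V) (Q : Subgroup (D.W v)) (I : Set ℤ)
    (hI : ∀ i m : ℤ, i + (D.E v).N * (k * m) ∈ I ↔ i ∈ I) (hτ : D.τ v ∈ Q)
    (hQ : ∀ i ∈ I, ∀ w, D.Rel v w i i → w ∈ Q) {A : Set ℝ}
    (hA : ∀ w ∈ Q, ∀ t ∈ A, D.f v w t ∈ A)
    (hA' : ∀ t ∈ A, ∀ᶠ n in Filter.atTop, (t : Circ) ∈ D.B.derivedPoints n)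
    {L U : Type*} [Finite L] [Finite U] {i₁ : L → I} {s₁ : L → Bool} {F₁ : L → ℝ ≃o ℝ}
    {F₁' : (𝒯.FundamentalGroup →* HomeoPlus) → L → ℝ ≃o ℝ} {c₁ : L → ℝ}
    (h₁ : ∀ x t, Filter.Tendsto (fun ω => F₁' ω x t) D.nbhds (𝓝 (F₁ x t)))
    (h₁' : ∀ x, ∃ t ∈ A, c₁ x < F₁ x t ∧ t < D.pt v (i₁ x) (s₁ x))
    {i₂ : U → I} {s₂ : U → Bool} {F₂ : U → ℝ ≃o ℝ}
    {F₂' : (𝒯.FundamentalGroup →* HomeoPlus) → U → ℝ ≃o ℝ} {c₂ : U → ℝ}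
    (h₂ : ∀ x t, Filter.Tendsto (fun ω => F₂' ω x t) D.nbhds (𝓝 (F₂ x t)))
    (h₂' : ∀ x, ∃ t ∈ A, F₂ x t < c₂ x ∧ D.pt v (i₂ x) (s₂ x) < t) :
    ∀ᶠ ω in D.nbhds, ∃ p : ℤ → Bool → ℝ,
      (∀ w ∈ Q, ∀ i ∈ I, ∀ j ∈ I, D.Rel v w i j → ∀ s, D.f' ω v w (p i s) = p j s) ∧
      (∀ i ∈ I, p i false < p i true) ∧
      (∀ x, c₁ x < F₁' ω x (p (i₁ x) (s₁ x))) ∧ ∀ x, F₂' ω x (p (i₂ x) (s₂ x)) < c₂ x := by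
  classical
  choose q hq1 hq2 hq3 using fun i : I => D.exists_loop v i
  choose t₁ ht₁A ht₁ ht₁' using h₁'
  choose t₂ ht₂A ht₂ ht₂' using h₂'
  have einv : ∀ (F : ℝ ≃o ℝ) t, F (F⁻¹ t) = t := fun F => RelIso.apply_inv_self F
  -- Room is left between `t₁ x` and the preimage of `c₁ x`: a bound by the constant `d₁ x` before
  -- applying the perturbed map still gives the bound `c₁ x` after it.
  have hd₁ : ∀ x, ∃ d, F₁⁻¹ x (c₁ x) < d ∧ d < t₁ x := fun x =>
    exists_between (by rw [← (F₁ x).lt_iff_lt, Pi.inv_apply, einv]; exact ht₁ x)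
  have hd₂ : ∀ x, ∃ d, t₂ x < d ∧ d < F₂⁻¹ x (c₂ x) := fun x =>
    exists_between (by rw [← (F₂ x).lt_iff_lt, Pi.inv_apply, einv]; exact ht₂ x)
  choose d₁ hd₁ hd₁' using hd₁
  choose d₂ hd₂ hd₂' using hd₂
  have main := exists_equivariant (Q := Q) (l := D.nbhds) (f := (D.f v).comp Q.subtype)
    (f' := fun ω => (D.f' ω v).comp Q.subtype) (fun q t => D.converges v q t)
    (fun (i : I) s => D.pt v i s) (R := {i : I | 0 ≤ (i : ℤ) ∧ (i : ℤ) < k * (D.E v).N})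
    (Set.Finite.preimage Subtype.val_injective.injOn (finite_Ico (0 : ℤ) (k * (D.E v).N)))
    (by
      rintro ⟨i, hi⟩
      obtain ⟨j, m, h1, h2, rfl⟩ := (D.E v).exists_mod i k D.one_le
      exact ⟨⟨j, (hI j m).1 hi⟩, ⟨h1, h2⟩, ⟨D.τ v ^ m, zpow_mem hτ m⟩,
        (D.rel_iff v _ _ _).1 (D.rel_τ v j m)⟩)
    (A := A) (fun w t ht => hA w w.2 t ht)
    (fun i => ⟨q i, hQ i i.2 _ (hq1 i)⟩)
    (by
      filter_upwards [D.eventually_good] with ω hω i w hw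
      exact hq3 i ω hω w ((D.rel_iff v _ _ _).2 hw))
    (by
      intro T hT hTfin
      obtain ⟨r₁, r₂, hr⟩ := BasicConfiguration.IsRobust.exists_intervals D.robust hTfin
        fun t ht => hA' t (hT ht)
      refine ⟨fun i s => r₁ (D.pt v i s), fun i s => r₂ (D.pt v i s), fun i s => ?_⟩
      obtain ⟨e1, e2, e3, e4, e5, e6⟩ := hr _ (D.pt_mem_points v i s)
      refine ⟨e1, e2, e3, e4, ?_, ?_⟩
      · have := e5 _ (D.f v (q i)) (hq2 i) (D.isLift_f v (q i)) ((D.rel_iff v _ _ _).1 (hq1 i) s)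
        rw [← map_inv] at this
        exact this
      · intro s' hlt
        refine e6 _ (D.pt_mem_points v i s') ?_ hlt
        intro he
        cases s <;> cases s'
        · exact lt_irrefl _ hlt
        · exact hlt.ne (coe_injOn ((D.E v).a_succ_lt i) ⟨le_rfl, hlt.le⟩ ⟨hlt.le, le_rfl⟩ he)
        · exact lt_asymm hlt ((D.E v).b_lt_a i)
        · exact lt_irrefl _ hlt)
    (Lo := range fun x => (i₁ x, s₁ x, d₁ x)) (Up := range fun x => (i₂ x, s₂ x, d₂ x))
    (finite_range _) (finite_range _)
    (by
      rintro _ ⟨x, rfl⟩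
      exact ⟨t₁ x, ht₁A x, hd₁' x, ht₁' x⟩)
    (by
      rintro _ ⟨x, rfl⟩
      exact ⟨t₂ x, ht₂A x, ht₂' x, hd₂ x⟩)
  have ev₁ : ∀ᶠ ω in D.nbhds, ∀ x, c₁ x < F₁' ω x (d₁ x) := by
    refine Filter.eventually_all.2 fun x => (h₁ x (d₁ x)).eventually_const_lt ?_
    have := (F₁ x).strictMono (hd₁ x)
    rwa [Pi.inv_apply, einv] at this
  have ev₂ : ∀ᶠ ω in D.nbhds, ∀ x, F₂' ω x (d₂ x) < c₂ x := by
    refine Filter.eventually_all.2 fun x => (h₂ x (d₂ x)).eventually_lt_const ?_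
    have := (F₂ x).strictMono (hd₂' x)
    rwa [Pi.inv_apply, einv] at this
  filter_upwards [main, ev₁, ev₂] with ω ⟨p, hp1, hp2, hp3, hp4⟩ ev₁ ev₂
  refine ⟨fun i s => if hi : i ∈ I then p ⟨i, hi⟩ s else 0, ?_, ?_, ?_, ?_⟩
  · intro w hw i hi j hj hrel s
    simp only [dif_pos hi, dif_pos hj]
    exact hp1 ⟨w, hw⟩ ⟨i, hi⟩ ⟨j, hj⟩ ((D.rel_iff v _ _ _).1 hrel) s
  · intro i hi
    simp only [dif_pos hi]
    exact hp4 ⟨i, hi⟩ false true ((D.E v).b_lt_a i)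
  · intro x
    simp only [dif_pos (i₁ x).2]
    exact (ev₁ x).trans ((F₁' ω x).strictMono (hp2 _ ⟨x, rfl⟩))
  · intro x
    simp only [dif_pos (i₂ x).2]
    exact ((F₂' ω x).strictMono (hp3 _ ⟨x, rfl⟩)).trans (ev₂ x)

end Setup

end

section

namespace Setup

open TreeOfGroups

variable {𝒯 : TreeOfGroups} {φ ψ : 𝒯.FundamentalGroup →* HomeoPlus} {k : ℕ} (D : Setup 𝒯 φ ψ k)

instance : D.nbhds.NeBot := @nhds_neBot _ (weakTopology _) ψ

/-! ### Linking the words at the two ends of an edge -/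

/-- Words representing elements of an edge group act like words at the other end of the edge. -/
theorem link {v u : 𝒯.V} (h : 𝒯.graph.Adj v u) : ∀ᶠ ω in D.nbhds, ∀ w, D.η v w ∈ edgeSub h →
    ∃ w', D.η u w' ∈ edgeSub h.symm ∧ D.f v w = D.f u w' ∧ D.f' ω v w = D.f' ω u w' := by
  let e : 𝒯.graph.edgeSet := ⟨s(v, u), h⟩
  obtain ⟨z, hz⟩ := (D.B.edge_cyclic e).exists_generator
  obtain ⟨zv, hzv⟩ := D.η_surjective v (𝒯.ι e v (Sym2.mem_mk_left v u) z)
  obtain ⟨zu, hzu⟩ := D.η_surjective u (𝒯.ι e u (Sym2.mem_mk_right v u) z)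
  have hvu : 𝒯.vertexMap v (D.η v zv) = 𝒯.vertexMap u (D.η u zu) := by
    rw [hzv, hzu, vertexMap_ι, vertexMap_ι]
  have h1 := (D.scaled_f v zv).mul (D.scaled_f u zu).inv
  rw [hvu, mul_inv_cancel] at h1
  -- The words for the generator of the edge group at the two ends represent the same element, so
  -- they act on the line up to a translation, eventually the same one for the perturbed action.
  obtain ⟨n, h2, h3⟩ := eventually_eq_shift (l := D.nbhds) D.one_le h1
    (F' := fun ω => D.f' ω v zv * (D.f' ω u zu)⁻¹)
    (fun ω => by
      have := (D.scaled_f' ω v zv).mul (D.scaled_f' ω u zu).inv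
      rwa [hvu, mul_inv_cancel] at this)
    (tendsto_mul (D.converges v zv) (tendsto_inv (D.converges u zu)) 0)
  filter_upwards [h3, D.eventually_good] with ω h3 hω w hw
  obtain ⟨x, hx⟩ := hw
  obtain ⟨r, rfl⟩ := hz x
  obtain ⟨j, h4, h5⟩ := D.eq_of_η_eq hω (w := w) (w' := zv ^ r) (by
    rw [map_zpow, hzv, ← map_zpow]; exact hx.symm)
  refine ⟨D.τ u ^ j * (D.τ u ^ n * zu) ^ r, ?_, ?_, ?_⟩
  · rw [← edgeSubgroup_eq_edgeSub h.symm e Sym2.eq_swap (Sym2.mem_mk_right v u)]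
    refine ⟨z ^ r, ?_⟩
    simp only [map_mul, map_zpow, η_τ, one_zpow, one_mul, hzu]
  · rw [h4, map_zpow, mul_inv_eq_iff_eq_mul.1 h2]
    simp only [map_mul, map_zpow, f_τ]
  · rw [h5, map_zpow, mul_inv_eq_iff_eq_mul.1 h3]
    simp only [map_mul, map_zpow, f'_τ]

theorem exists_link {v u : 𝒯.V} (h : 𝒯.graph.Adj v u) {w : D.W v} (hw : D.η v w ∈ edgeSub h) :
    ∃ w', D.η u w' ∈ edgeSub h.symm ∧ D.f v w = D.f u w' := by
  obtain ⟨ω, hω⟩ := (D.link h).exists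
  obtain ⟨w', h1, h2, -⟩ := hω w hw
  exact ⟨w', h1, h2⟩

/-- The real numbers over the orbits of the boundary points of the partition at a vertex. -/
def orbit (v : 𝒯.V) : Set ℝ := orbitSet (𝒯.restrict φ v) (D.B.P v)

theorem f_mem_orbit {v : 𝒯.V} (w : D.W v) {t : ℝ} (ht : t ∈ D.orbit v) : D.f v w t ∈ D.orbit v :=
  lift_mem_orbitSet ht (D.isLift_f v w)

theorem eventually_mem_derivedPoints {v : 𝒯.V} {t : ℝ} (ht : t ∈ D.orbit v) :
    ∀ᶠ n in Filter.atTop, (t : Circ) ∈ D.B.derivedPoints n :=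
  (eventually_mem_derived (D.B.pure v) (D.E v) (D.B.S_symm v) (D.B.S_generates v) ht).mono
    fun _ hn => mem_iUnion.2 ⟨v, hn⟩

/-! ### Marks -/

/-- Points of the components of the partition at a vertex near to their end points. -/
structure Marks (v : 𝒯.V) where
  A : ℤ → ℝ
  B : ℤ → ℝ
  A_lt_B : ∀ i, A i < B i
  left : ∀ i, ∃ t ∈ D.orbit v, (D.E v).a i < t ∧ t < A i
  right : ∀ i, ∃ t ∈ D.orbit v, B i < t ∧ t < (D.E v).b i
  inside : ∀ s ∈ D.B.S v, ∀ F, IsLift F (𝒯.restrict φ v s) → ∀ i j, (D.E v).a j < F ((D.E v).b i) →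
    F ((D.E v).a (i + 1)) < (D.E v).b j → A j < F (B i) ∧ F (A (i + 1)) < B j
  A_add : ∀ i m : ℤ, A (i + (D.E v).N * m) = A i + m
  B_add : ∀ i m : ℤ, B (i + (D.E v).N * m) = B i + m

theorem nonempty_marks (v : 𝒯.V) : Nonempty (D.Marks v) := by
  obtain ⟨A, B, h1, h2, h3, h4, h5, h6⟩ := exists_marks (D.B.pure v) (D.E v) (D.B.S_symm v)
    (D.B.S_finite v)
  exact ⟨⟨A, B, h1, h2, h3, h4, h5, h6⟩⟩

variable {D}

theorem Marks.B_lt_A {v : 𝒯.V} (K : D.Marks v) (i : ℤ) : K.B i < K.A (i + 1) := by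
  obtain ⟨t, -, h1, h2⟩ := K.right i
  obtain ⟨t', -, h3, h4⟩ := K.left (i + 1)
  have := (D.E v).b_lt_a i
  linarith

theorem Marks.A_strictMono {v : 𝒯.V} (K : D.Marks v) : StrictMono K.A :=
  strictMono_int_of_lt_succ fun i => (K.A_lt_B i).trans (K.B_lt_A i)

variable (D)

/-! ### Perturbed gaps -/

/-- The points `p i false` and `p i true` are perturbations of the end points of the gaps with
numbers `i ∈ I`, equivariant and separated by the marks. -/
def GapsOn {v : 𝒯.V} (K : D.Marks v) (ω : 𝒯.FundamentalGroup →* HomeoPlus) (I : Set ℤ)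
    (p : ℤ → Bool → ℝ) : Prop :=
  (∀ w, ∀ i ∈ I, ∀ j ∈ I, D.Rel v w i j → ∀ s, D.f' ω v w (p i s) = p j s) ∧
    ∀ i ∈ I, K.B i < p i false ∧ p i false < p i true ∧ p i true < K.A (i + 1)

theorem f'_τ_zpow (ω) (v : 𝒯.V) (m : ℤ) (t : ℝ) :
    D.f' ω v (D.τ v ^ m) t = t + ((k * m : ℤ) : ℝ) := by
  rw [map_zpow, f'_τ, shift_zpow, mul_comm]
  push_cast; rfl

/-- Equivariance under the central letter extends the bounds from one period of `k * N` gaps to all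
gaps. -/
theorem gapsOn_of_window {v : 𝒯.V} (K : D.Marks v) {ω} {I : Set ℤ} {p : ℤ → Bool → ℝ}
    (hI : ∀ i m : ℤ, i + (D.E v).N * (k * m) ∈ I ↔ i ∈ I)
    (h₁ : ∀ w, ∀ i ∈ I, ∀ j ∈ I, D.Rel v w i j → ∀ s, D.f' ω v w (p i s) = p j s)
    (h₂ : ∀ i ∈ I, p i false < p i true)
    (h₃ : ∀ i ∈ I, 0 ≤ i → i < k * (D.E v).N → K.B i < p i false ∧ p i true < K.A (i + 1)) :
    D.GapsOn K ω I p := by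
  refine ⟨h₁, fun i hi => ?_⟩
  obtain ⟨j, m, h4, h5, rfl⟩ := (D.E v).exists_mod i k D.one_le
  have hj := (hI j m).1 hi
  have hp : ∀ s, p (j + (D.E v).N * (k * m)) s = p j s + ((k * m : ℤ) : ℝ) := fun s => by
    rw [← h₁ _ j hj _ hi (D.rel_τ v j m) s, f'_τ_zpow]
  obtain ⟨h6, h7⟩ := h₃ j hj h4 h5
  rw [hp, hp, K.B_add, show j + (D.E v).N * (k * m) + 1 = j + 1 + (D.E v).N * (k * m) by ring,
    K.A_add]
  have := h₂ j hj
  exact ⟨by linarith, by linarith, by linarith⟩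

/-- The gap `i` is an image of a gap in the entrance of the edge `{v, u}`. -/
def InOrbit {v u : 𝒯.V} (h : 𝒯.graph.Adj v u) (i : ℤ) : Prop :=
  ∃ w i₀, D.B.Ent D.E h i₀ ∧ D.Rel v w i₀ i

variable {D}

theorem InOrbit.rel {v u : 𝒯.V} {h : 𝒯.graph.Adj v u} {i j : ℤ} {w : D.W v} (hi : D.InOrbit h i)
    (hw : D.Rel v w i j) : D.InOrbit h j := by
  obtain ⟨w', i₀, h1, h2⟩ := hi
  exact ⟨w * w', i₀, h1, h2.mul hw⟩

theorem inOrbit_add {v u : 𝒯.V} (h : 𝒯.graph.Adj v u) (i m : ℤ) :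
    D.InOrbit h (i + (D.E v).N * (k * m)) ↔ D.InOrbit h i :=
  ⟨fun hi => hi.rel (D.rel_τ v i m).inv, fun hi => hi.rel (D.rel_τ v i m)⟩

theorem inOrbit_of_ent {v u : 𝒯.V} {h : 𝒯.graph.Adj v u} {i : ℤ} (hi : D.B.Ent D.E h i) :
    D.InOrbit h i := ⟨1, i, hi, by rw [Rel, map_one]; exact ⟨rfl, rfl⟩⟩

theorem ent_rel {v u u' : 𝒯.V} {h : 𝒯.graph.Adj v u} {h' : 𝒯.graph.Adj v u'} {i j : ℤ} {w : D.W v}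
    (hi : D.B.Ent D.E h i) (hj : D.B.Ent D.E h' j) (hw : D.Rel v w i j) :
    u = u' ∧ D.η v w ∈ edgeSub h :=
  D.B.ent_unique D.E h h' hi hj (D.isLift_f v w) hw.1 hw.2

theorem InOrbit.unique {v u u' : 𝒯.V} {h : 𝒯.graph.Adj v u} {h' : 𝒯.graph.Adj v u'} {i : ℤ}
    (hi : D.InOrbit h i) (hi' : D.InOrbit h' i) : u = u' := by
  obtain ⟨w, i₀, h1, h2⟩ := hi
  obtain ⟨w', i₁, h3, h4⟩ := hi'
  exact (ent_rel h1 h3 (h2.mul h4.inv)).1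

variable (D)

/-- Extension of perturbed gaps from an entrance to its orbit. -/
theorem exists_extension {v u : 𝒯.V} (h : 𝒯.graph.Adj v u) (K : D.Marks v) {ω}
    {p₀ : ℤ → Bool → ℝ} (r : {i // D.InOrbit h i} → D.W v) (o : {i // D.InOrbit h i} → ℤ)
    (ho : ∀ i, D.B.Ent D.E h (o i)) (hr : ∀ i, D.Rel v (r i) (o i) i)
    (h₁ : ∀ w i j, D.η v w ∈ edgeSub h → D.B.Ent D.E h i → D.B.Ent D.E h j → D.Rel v w i j →
      ∀ s, D.f' ω v w (p₀ i s) = p₀ j s)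
    (h₂ : ∀ i, D.B.Ent D.E h i → p₀ i false < p₀ i true)
    (h₃ : ∀ i : {i // D.InOrbit h i}, 0 ≤ (i : ℤ) → (i : ℤ) < k * (D.E v).N →
      K.B i < D.f' ω v (r i) (p₀ (o i) false) ∧ D.f' ω v (r i) (p₀ (o i) true) < K.A (i + 1)) :
    ∃ p, D.GapsOn K ω {i | D.InOrbit h i} p ∧ ∀ i, D.B.Ent D.E h i → ∀ s, p i s = p₀ i s := by
  classical
  refine ⟨fun i s => if hi : D.InOrbit h i then D.f' ω v (r ⟨i, hi⟩) (p₀ (o ⟨i, hi⟩) s) else 0,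
    D.gapsOn_of_window K (inOrbit_add h) ?_ ?_ ?_, ?_⟩
  · intro w i hi j hj hw s
    have hi : D.InOrbit h i := hi
    have hj : D.InOrbit h j := hj
    simp only [dif_pos hi, dif_pos hj]
    -- Two transports of entrance gaps differ by a word mapping an entrance gap to an entrance gap.
    -- It represents an element of the edge group, for which `h₁` gives equivariance.
    have hrel := ((hr ⟨i, hi⟩).mul hw).mul (hr ⟨j, hj⟩).inv
    rw [← h₁ _ _ _ (ent_rel (ho _) (ho _) hrel).2 (ho _) (ho _) hrel s, ← RelIso.mul_apply,
      ← RelIso.mul_apply, ← map_mul, ← map_mul, mul_inv_cancel_left]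
  · intro i hi
    have hi : D.InOrbit h i := hi
    simp only [dif_pos hi]
    exact (D.f' ω v _).strictMono (h₂ _ (ho _))
  · intro i hi h4 h5
    have hi : D.InOrbit h i := hi
    simp only [dif_pos hi]
    exact h₃ ⟨i, hi⟩ h4 h5
  · intro i hi s
    have hi' := inOrbit_of_ent hi
    simp only [dif_pos hi']
    exact h₁ _ _ _ (ent_rel (ho _) hi (hr _)).2 (ho _) hi (hr _) s

/-- The end points shared by the entrances at the two ends of an edge are perturbed in the same
way. -/
def Shared {v u : 𝒯.V} (h : 𝒯.graph.Adj v u) (p q : ℤ → Bool → ℝ) : Prop :=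
  ∀ i m, D.B.Ent D.E h i → D.B.Ent D.E h.symm m →
    ((D.E v).a (i + 1) = (D.E u).b m → q m false = p i true) ∧
    ((D.E v).b i = (D.E u).a (m + 1) → p i false = q m true)

/-- The entrance gaps at `v` are perturbed equivariantly under the edge group only; their end points
are reused as end points of the entrance gaps at `u`. Both families are then extended to their
orbits under the full vertex groups. The bounds by the marks at both vertices have to be imposed on
the one perturbation at `v`. -/
theorem exists_edge_gaps (K : ∀ v, D.Marks v) {v u : 𝒯.V} (h : 𝒯.graph.Adj v u) :
    ∀ᶠ ω in D.nbhds, ∃ p q, D.GapsOn (K v) ω {i | D.InOrbit h i} p ∧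
      D.GapsOn (K u) ω {m | D.InOrbit h.symm m} q ∧ D.Shared h p q := by
  choose r o ho hr using fun i : {i // D.InOrbit h i} => i.2
  choose r' o' ho' hr' using fun m : {m // D.InOrbit h.symm m} => m.2
  choose l hl hl' using fun m : {m // D.B.Ent D.E h.symm m} => D.B.exists_left_gap D.E h m.2
  choose g hg hg' using fun m : {m // D.B.Ent D.E h.symm m} => D.B.exists_right_gap D.E h m.2
  let I : Set ℤ := {i | D.B.Ent D.E h i}
  let X := {i : {i // D.InOrbit h i} // 0 ≤ (i : ℤ) ∧ (i : ℤ) < k * (D.E v).N}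
  let Y := {m : {m // D.InOrbit h.symm m} // 0 ≤ (m : ℤ) ∧ (m : ℤ) < k * (D.E u).N}
  have : Finite X := Set.Finite.preimage (f := Subtype.val) Subtype.val_injective.injOn
    (finite_Ico (0 : ℤ) (k * (D.E v).N))
  have : Finite Y := Set.Finite.preimage (f := Subtype.val) Subtype.val_injective.injOn
    (finite_Ico (0 : ℤ) (k * (D.E u).N))
  have main := D.exists_perturbed_gaps v ((edgeSub h).comap (D.η v)) I
    (fun i m => D.B.ent_add D.E h i _) (by
      change D.η v (D.τ v) ∈ edgeSub h
      rw [η_τ]; exact one_mem _)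
    -- The barriers come from the orbits at both vertices. Their union is invariant under the edge
    -- group, whose elements also act by words at `u`.
    (fun i hi w hw => (ent_rel hi hi hw).2) (A := D.orbit v ∪ D.orbit u)
    (by
      rintro w hw t (ht | ht)
      · exact Or.inl (D.f_mem_orbit w ht)
      · obtain ⟨w', -, h2⟩ := D.exists_link h hw
        rw [h2]
        exact Or.inr (D.f_mem_orbit w' ht))
    (by
      rintro t (ht | ht)
      · exact D.eventually_mem_derivedPoints ht
      · exact D.eventually_mem_derivedPoints ht)
    -- `X` indexes the bounds at `v` and `Y` those at `u`. A gap of `u` lies between the gaps `l`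
    -- and `g` of `v`: its left end is the right end of `l`, its right end the left end of `g`,
    -- hence the exchanged Boolean values for `Y`.
    (L := X ⊕ Y) (U := X ⊕ Y)
    (i₁ := Sum.elim (fun x => ⟨o x, ho x⟩) fun y => ⟨l ⟨o' y, ho' y⟩, hl _⟩)
    (s₁ := Sum.elim (fun _ => false) fun _ => true)
    (F₁ := Sum.elim (fun x => D.f v (r x)) fun y => D.f u (r' y))
    (F₁' := fun ω => Sum.elim (fun x => D.f' ω v (r x)) fun y => D.f' ω u (r' y))
    (c₁ := Sum.elim (fun x => (K v).B (x : {i // D.InOrbit h i})) fun y => (K u).B (y : {m // D.InOrbit h.symm m}))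
    (by
      rintro (x | y) t
      · exact D.converges v _ t
      · exact D.converges u _ t)
    (by
      rintro (x | y)
      · obtain ⟨t, h1, h2, h3⟩ := (K v).right x.1
        refine ⟨D.f v (r x)⁻¹ t, Or.inl (D.f_mem_orbit _ h1), ?_, ?_⟩
        · simp only [Sum.elim_inl, map_inv, RelIso.apply_inv_self]; exact h2
        · have := (D.f v (r x)⁻¹).strictMono h3
          rwa [(hr x).inv.1] at this
      · obtain ⟨t, h1, h2, h3⟩ := (K u).right y.1
        refine ⟨D.f u (r' y)⁻¹ t, Or.inr (D.f_mem_orbit _ h1), ?_, ?_⟩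
        · simp only [Sum.elim_inr, map_inv, RelIso.apply_inv_self]; exact h2
        · have := (D.f u (r' y)⁻¹).strictMono h3
          rw [(hr' y).inv.1, ← hl' ⟨o' y, ho' y⟩] at this
          exact this)
    (i₂ := Sum.elim (fun x => ⟨o x, ho x⟩) fun y => ⟨g ⟨o' y, ho' y⟩, hg _⟩)
    (s₂ := Sum.elim (fun _ => true) fun _ => false)
    (F₂ := Sum.elim (fun x => D.f v (r x)) fun y => D.f u (r' y))
    (F₂' := fun ω => Sum.elim (fun x => D.f' ω v (r x)) fun y => D.f' ω u (r' y))
    (c₂ := Sum.elim (fun x => (K v).A ((x : {i // D.InOrbit h i}) + 1))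
      fun y => (K u).A ((y : {m // D.InOrbit h.symm m}) + 1))
    (by
      rintro (x | y) t
      · exact D.converges v _ t
      · exact D.converges u _ t)
    (by
      rintro (x | y)
      · obtain ⟨t, h1, h2, h3⟩ := (K v).left (x.1 + 1)
        refine ⟨D.f v (r x)⁻¹ t, Or.inl (D.f_mem_orbit _ h1), ?_, ?_⟩
        · simp only [Sum.elim_inl, map_inv, RelIso.apply_inv_self]; exact h3
        · have := (D.f v (r x)⁻¹).strictMono h2
          rwa [(hr x).inv.2] at this
      · obtain ⟨t, h1, h2, h3⟩ := (K u).left (y.1 + 1)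
        refine ⟨D.f u (r' y)⁻¹ t, Or.inr (D.f_mem_orbit _ h1), ?_, ?_⟩
        · simp only [Sum.elim_inr, map_inv, RelIso.apply_inv_self]; exact h3
        · have := (D.f u (r' y)⁻¹).strictMono h2
          rw [(hr' y).inv.2, ← hg' ⟨o' y, ho' y⟩] at this
          exact this)
  filter_upwards [main, D.link h.symm] with ω ⟨p₀, h1, h2, h3, h4⟩ hlink
  obtain ⟨p, hp, hpp⟩ := D.exists_extension h (K v) (p₀ := p₀) r o ho hr
    (fun w i j hw hi hj hrel => h1 w hw i hi j hj hrel) h2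
    (fun i hi hi' => ⟨h3 (Sum.inl ⟨i, hi, hi'⟩), h4 (Sum.inl ⟨i, hi, hi'⟩)⟩)
  classical
  let q₀ : ℤ → Bool → ℝ := fun m s => if hm : D.B.Ent D.E h.symm m then
    cond s (p₀ (g ⟨m, hm⟩) false) (p₀ (l ⟨m, hm⟩) true) else 0
  have hq₀ : ∀ m (hm : D.B.Ent D.E h.symm m), q₀ m false = p₀ (l ⟨m, hm⟩) true ∧
      q₀ m true = p₀ (g ⟨m, hm⟩) false := fun m hm => by simp [q₀, hm]
  obtain ⟨q, hq, hqq⟩ := D.exists_extension h.symm (K u) (p₀ := q₀) (ω := ω) r' o' ho' hr'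
    (by
      intro w m m' hw hm hm' hrel
      obtain ⟨w', e1, e2, e3⟩ := hlink w hw
      rw [Bool.forall_bool, (hq₀ m hm).1, (hq₀ m' hm').1, (hq₀ m hm).2, (hq₀ m' hm').2, e3]
      have r1 : D.Rel v w' (l ⟨m, hm⟩) (l ⟨m', hm'⟩) := D.rel_of_a (by
        rw [← e2, hl', hl']; exact hrel.1)
      have r2 : D.Rel v w' (g ⟨m, hm⟩) (g ⟨m', hm'⟩) := D.rel_of_b (by
        rw [← e2, hg', hg']; exact hrel.2)
      exact ⟨h1 w' e1 _ (hl _) _ (hl _) r1 true, h1 w' e1 _ (hg _) _ (hg _) r2 false⟩)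
    (by
      intro m hm
      rw [(hq₀ m hm).1, (hq₀ m hm).2, ← hpp _ (hl _), ← hpp _ (hg _)]
      have e1 := (hp.2 _ (inOrbit_of_ent (hl ⟨m, hm⟩))).2.2
      have e2 := (hp.2 _ (inOrbit_of_ent (hg ⟨m, hm⟩))).1
      -- At least one component of `v` lies between the gaps `l` and `g`; its marks separate the
      -- perturbed end points.
      have e3 : l ⟨m, hm⟩ + 1 ≤ g ⟨m, hm⟩ := (D.E v).le_of_a_le_b (by
        rw [hl', hg']; exact ((D.E u).b_lt_a m).le)
      have e4 := (K v).A_strictMono.monotone e3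
      have e5 := (K v).A_lt_B (g ⟨m, hm⟩)
      linarith)
    (by
      intro m hm hm'
      rw [(hq₀ _ (ho' m)).1, (hq₀ _ (ho' m)).2]
      exact ⟨h3 (Sum.inr ⟨m, hm, hm'⟩), h4 (Sum.inr ⟨m, hm, hm'⟩)⟩)
  refine ⟨p, q, hp, hq, fun i m hi hm => ⟨fun he => ?_, fun he => ?_⟩⟩
  · rw [hqq m hm, hpp i hi, (hq₀ m hm).1]
    have := (D.E v).a_strictMono.injective (he.trans (hl' ⟨m, hm⟩).symm)
    rw [show l ⟨m, hm⟩ = i by omega]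
  · rw [hqq m hm, hpp i hi, (hq₀ m hm).2]
    rw [(D.E v).b_strictMono.injective (he.trans (hg' ⟨m, hm⟩).symm)]

/-- The remaining gaps are not tied to another vertex, so they can be perturbed equivariantly under
the full vertex group at once. -/
theorem exists_free_gaps {v : 𝒯.V} (K : D.Marks v) : ∀ᶠ ω in D.nbhds, ∃ p,
    D.GapsOn K ω {i | ∀ u (h : 𝒯.graph.Adj v u), ¬ D.InOrbit h i} p := by
  let I : Set ℤ := {i | ∀ u (h : 𝒯.graph.Adj v u), ¬ D.InOrbit h i}
  let X := {i : I // 0 ≤ (i : ℤ) ∧ (i : ℤ) < k * (D.E v).N}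
  have : Finite X := Set.Finite.preimage (f := Subtype.val) Subtype.val_injective.injOn
    (finite_Ico (0 : ℤ) (k * (D.E v).N))
  have hI : ∀ i m : ℤ, i + (D.E v).N * (k * m) ∈ I ↔ i ∈ I := fun i m =>
    forall_congr' fun u => forall_congr' fun h => not_congr (inOrbit_add h i m)
  have main := D.exists_perturbed_gaps v ⊤ I hI (Subgroup.mem_top _)
    (fun _ _ _ _ => Subgroup.mem_top _) (A := D.orbit v) (fun w _ t ht => D.f_mem_orbit w ht)
    (fun t ht => D.eventually_mem_derivedPoints ht) (L := X) (U := X)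
    (i₁ := fun x => x.1) (s₁ := fun _ => false) (F₁ := fun _ => 1) (F₁' := fun _ _ => 1)
    (c₁ := fun x => K.B x.1) (fun _ _ => tendsto_const_nhds)
    (fun x => K.right x.1)
    (i₂ := fun x => x.1) (s₂ := fun _ => true) (F₂ := fun _ => 1) (F₂' := fun _ _ => 1)
    (c₂ := fun x => K.A (x.1 + 1)) (fun _ _ => tendsto_const_nhds)
    (fun x => by
      obtain ⟨t, h1, h2, h3⟩ := K.left (x.1 + 1)
      exact ⟨t, h1, h3, h2⟩)
  filter_upwards [main] with ω ⟨p, h1, h2, h3, h4⟩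
  exact ⟨p, D.gapsOn_of_window K hI (fun w => h1 w (Subgroup.mem_top _)) h2
    fun i hi hi1 hi2 => ⟨h3 ⟨⟨i, hi⟩, hi1, hi2⟩, h4 ⟨⟨i, hi⟩, hi1, hi2⟩⟩⟩

end Setup

/-- Choice of values on the ordered pairs of related elements, coherent on opposite pairs. -/
theorem exists_symm_choice {V α : Type*} {R : V → V → Prop} (hR : ∀ v u, R v u → R u v)
    (hR' : ∀ v u, R v u → v ≠ u) {G : V → V → α → α → Prop}
    (hG : ∀ v u a b, R v u → G v u a b → G u v b a) [Nonempty α]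
    (h : ∀ v u, R v u → ∃ a b, G v u a b) : ∃ P : V → V → α, ∀ v u, R v u → G v u (P v u) (P u v) := by
  classical
  choose! x y hxy using h
  let := linearOrderOfSTO (WellOrderingRel (α := V))
  refine ⟨fun v u => if v < u then x v u else y u v, fun v u hvu => ?_⟩
  rcases lt_or_gt_of_ne (hR' v u hvu) with h | h
  · simp only [if_pos h, if_neg h.not_gt]
    exact hxy v u hvu
  · simp only [if_pos h, if_neg h.not_gt]
    exact hG _ _ _ _ (hR _ _ hvu) (hxy u v (hR _ _ hvu))

end

section

namespace Setup

open TreeOfGroups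

variable {𝒯 : TreeOfGroups} {φ ψ : 𝒯.FundamentalGroup →* HomeoPlus} {k : ℕ} (D : Setup 𝒯 φ ψ k)

/-! ### Comparison of the original and the perturbed action -/

variable {D} in
theorem GapsOn.congr {v : 𝒯.V} {K : D.Marks v} {ω} {I I' : Set ℤ} {p p' : ℤ → Bool → ℝ}
    (h : D.GapsOn K ω I p) (hI : I' ⊆ I) (hp : ∀ i ∈ I', p' i = p i) : D.GapsOn K ω I' p' :=
  ⟨fun w i hi j hj hw s => by rw [hp i hi, hp j hj]; exact h.1 w i (hI hi) j (hI hj) hw s,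
    fun i hi => by rw [hp i hi]; exact h.2 i (hI hi)⟩

variable {D} in
theorem Shared.symm {v u : 𝒯.V} {h : 𝒯.graph.Adj v u} {p q : ℤ → Bool → ℝ} (H : D.Shared h p q) :
    D.Shared h.symm q p :=
  fun m i hm hi => ⟨fun he => (H i m hi hm).2 he.symm, fun he => (H i m hi hm).1 he.symm⟩

/-- A gap belongs to the orbit of at most one entrance, so the families for the edges at `v` and the
free gaps combine to one family; related gaps always belong to the same one. -/
theorem exists_gaps (K : ∀ v, D.Marks v) : ∀ᶠ ω in D.nbhds, ∃ p : 𝒯.V → ℤ → Bool → ℝ,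
    (∀ v, D.GapsOn (K v) ω univ (p v)) ∧ ∀ v u (h : 𝒯.graph.Adj v u), D.Shared h (p v) (p u) := by
  classical
  have := 𝒯.finite_V
  have ev₁ : ∀ᶠ ω in D.nbhds, ∀ v u, ∀ h : 𝒯.graph.Adj v u, ∃ p q,
      D.GapsOn (K v) ω {i | D.InOrbit h i} p ∧ D.GapsOn (K u) ω {m | D.InOrbit h.symm m} q ∧
        D.Shared h p q := by
    refine Filter.eventually_all.2 fun v => Filter.eventually_all.2 fun u => ?_
    by_cases h : 𝒯.graph.Adj v u
    · exact (D.exists_edge_gaps K h).mono fun ω hω _ => hω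
    · exact Filter.Eventually.of_forall fun ω h' => (h h').elim
  have ev₂ := Filter.eventually_all.2 fun v => D.exists_free_gaps (K v)
  filter_upwards [ev₁, ev₂] with ω h₁ h₂
  choose p₂ hp₂ using h₂
  obtain ⟨P, hP⟩ := exists_symm_choice (R := 𝒯.graph.Adj) (fun _ _ h => h.symm) (fun _ _ h => h.ne)
    (G := fun v u p q => ∀ h : 𝒯.graph.Adj v u, D.GapsOn (K v) ω {i | D.InOrbit h i} p ∧
      D.GapsOn (K u) ω {m | D.InOrbit h.symm m} q ∧ D.Shared h p q)
    (fun v u p q _ H h => ⟨(H h.symm).2.1, (H h.symm).1, (H h.symm).2.2.symm⟩)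
    (fun v u h => by
      obtain ⟨p, q, H⟩ := h₁ v u h
      exact ⟨p, q, fun _ => H⟩)
  let p : 𝒯.V → ℤ → Bool → ℝ := fun v i =>
    if hi : ∃ u, ∃ h : 𝒯.graph.Adj v u, D.InOrbit h i then P v hi.choose i else p₂ v i
  have e₁ : ∀ {v u} (h : 𝒯.graph.Adj v u) {i}, D.InOrbit h i → p v i = P v u i := by
    intro v u h i hi
    have hex : ∃ u, ∃ h : 𝒯.graph.Adj v u, D.InOrbit h i := ⟨u, h, hi⟩
    simp only [p, dif_pos hex]
    obtain ⟨h', hi'⟩ := hex.choose_spec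
    rw [hi'.unique hi]
  have e₂ : ∀ {v i}, (∀ u (h : 𝒯.graph.Adj v u), ¬ D.InOrbit h i) → p v i = p₂ v i := by
    intro v i hi
    have hex : ¬ ∃ u, ∃ h : 𝒯.graph.Adj v u, D.InOrbit h i := fun ⟨u, h, h'⟩ => hi u h h'
    simp only [p, dif_neg hex]
  have g₁ : ∀ {v u} (h : 𝒯.graph.Adj v u), D.GapsOn (K v) ω {i | D.InOrbit h i} (p v) :=
    fun h => (hP _ _ h h).1.congr subset_rfl fun i hi => e₁ h hi
  have g₂ : ∀ v, D.GapsOn (K v) ω {i | ∀ u (h : 𝒯.graph.Adj v u), ¬ D.InOrbit h i} (p v) :=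
    fun v => (hp₂ v).congr subset_rfl fun i hi => e₂ hi
  refine ⟨p, fun v => ⟨fun w i _ j _ hw s => ?_, fun i _ => ?_⟩, fun v u h i m hi hm => ?_⟩
  · by_cases hi : ∃ u, ∃ h : 𝒯.graph.Adj v u, D.InOrbit h i
    · obtain ⟨u, h, hi⟩ := hi
      exact (g₁ h).1 w i hi j (hi.rel hw) hw s
    · push Not at hi
      exact (g₂ v).1 w i hi j (fun u h hj => hi u h (hj.rel hw.inv)) hw s
  · by_cases hi : ∃ u, ∃ h : 𝒯.graph.Adj v u, D.InOrbit h i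
    · obtain ⟨u, h, hi⟩ := hi
      exact (g₁ h).2 i hi
    · push Not at hi
      exact (g₂ v).2 i hi
  · rw [e₁ h (inOrbit_of_ent hi), e₁ h.symm (inOrbit_of_ent hm)]
    exact (hP _ _ h h).2.2 i m hi hm

theorem _root_.BasicPartition.IsScaledLift.add_mul {k : ℕ} {F : ℝ ≃o ℝ} {f : HomeoPlus}
    (hF : IsScaledLift k F f) (hk : 1 ≤ k) (t : ℝ) (m : ℤ) :
    F (t + ((k * m : ℤ) : ℝ)) = F t + ((k * m : ℤ) : ℝ) := by
  have h := DFunLike.congr_fun ((hF.commute hk).zpow_right m) t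
  rw [shift_zpow] at h
  change F (t + (m * k : ℝ)) = F t + (m * k : ℝ) at h
  push_cast
  rwa [mul_comm (k : ℝ)]

/-- Finitely many strict inequalities suffice, by finiteness of the generating sets and equivariance
under the translation by `k`. -/
theorem eventually_inside (K : ∀ v, D.Marks v) : ∀ᶠ ω in D.nbhds, ∀ v, ∀ s ∈ D.B.S v, ∀ i j,
    (D.E v).a j < D.F v s ((D.E v).b i) → D.F v s ((D.E v).a (i + 1)) < (D.E v).b j →
    (K v).A j < D.F' ω v s ((K v).B i) ∧ D.F' ω v s ((K v).A (i + 1)) < (K v).B j := by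
  have := 𝒯.finite_V
  have key : ∀ᶠ ω in D.nbhds, ∀ v, ∀ s ∈ D.B.S v, ∀ i ∈ Ico (0 : ℤ) (k * (D.E v).N), ∀ j,
      (D.E v).a j < D.F v s ((D.E v).b i) → D.F v s ((D.E v).a (i + 1)) < (D.E v).b j →
      (K v).A j < D.F' ω v s ((K v).B i) ∧ D.F' ω v s ((K v).A (i + 1)) < (K v).B j := by
    refine Filter.eventually_all.2 fun v => ?_
    refine (Filter.eventually_all_finite (D.B.S_finite v)).2 fun s hs => ?_
    refine (Filter.eventually_all_finite (finite_Ico _ _)).2 fun i _ => ?_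
    by_cases hj : ∃ j, (D.E v).a j < D.F v s ((D.E v).b i) ∧
        D.F v s ((D.E v).a (i + 1)) < (D.E v).b j
    · obtain ⟨j, h1, h2⟩ := hj
      obtain ⟨h3, h4⟩ := (K v).inside s hs _ ((D.lift v s).isLift D.fold D.one_le) i j h1 h2
      filter_upwards [(D.tendsto v s ((K v).B i)).eventually_const_lt h3,
        (D.tendsto v s ((K v).A (i + 1))).eventually_lt_const h4] with ω h5 h6 j' h7 h8
      have hlt := (D.F v s).strictMono ((D.E v).b_lt_a i)
      have := (D.E v).le_of_a_le_b (h1.trans (hlt.trans h8)).le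
      have := (D.E v).le_of_a_le_b (h7.trans (hlt.trans h2)).le
      rw [show j' = j by omega]
      exact ⟨h5, h6⟩
    · exact Filter.Eventually.of_forall fun ω j h1 h2 => (hj ⟨j, h1, h2⟩).elim
  filter_upwards [key] with ω key v s hs i j h1 h2
  obtain ⟨i₀, m, h3, h4, rfl⟩ := (D.E v).exists_mod i k D.one_le
  obtain ⟨j₀, rfl⟩ : ∃ j₀, j = j₀ + (D.E v).N * (k * m) := ⟨j - (D.E v).N * (k * m), by ring⟩
  have e : i₀ + (D.E v).N * (k * m) + 1 = i₀ + 1 + (D.E v).N * (k * m) := by ring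
  rw [(D.E v).a_add_mul, (D.E v).b_add_mul, (D.lift v s).add_mul D.one_le] at h1
  rw [e, (D.E v).a_add_mul, (D.E v).b_add_mul, (D.lift v s).add_mul D.one_le] at h2
  obtain ⟨h5, h6⟩ := key v s hs i₀ ⟨h3, h4⟩ j₀ (by linarith) (by linarith)
  rw [e, (K v).A_add, (K v).A_add, (K v).B_add, (K v).B_add, (D.lift' ω v s).add_mul D.one_le,
    (D.lift' ω v s).add_mul D.one_le]
  exact ⟨by linarith, by linarith⟩

theorem exists_bound {V : Type*} [Finite V] {N : V → ℕ} (hN : ∀ v, 0 < N v) (hk : 1 ≤ k)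
    {g : V → ℤ → ℝ} (hg : ∀ v i m, g v (i + N v * (k * m)) = g v i) : ∃ C, ∀ v i, g v i ≤ C := by
  have hfin : (⋃ v, g v '' Ico (0 : ℤ) (k * N v)).Finite :=
    finite_iUnion fun v => (finite_Ico _ _).image _
  obtain ⟨C, hC⟩ := hfin.bddAbove
  refine ⟨C, fun v i => hC (mem_iUnion.2 ⟨v, i % (N v * k), ⟨?_, ?_⟩, ?_⟩)⟩
  · exact Int.emod_nonneg _ (by have := hN v; positivity)
  · rw [mul_comm (k : ℤ)]
    exact Int.emod_lt_of_pos _ (by have := hN v; positivity)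
  · have := hg v (i % (N v * k)) (i / (N v * k))
    rw [← mul_assoc, Int.emod_add_mul_ediv] at this
    exact this.symm

/-- The group of pairs of an original and a perturbed map given by the words at a vertex. -/
def pairs (ω : 𝒯.FundamentalGroup →* HomeoPlus) (v : 𝒯.V) : D.W v →* (ℝ ≃o ℝ) × (ℝ ≃o ℝ) :=
  (D.f v).prod (D.f' ω v)

/-- The perturbed partition at a vertex. -/
def perturbed (K : ∀ v, D.Marks v) {ω} (hω : D.Good ω) {v : 𝒯.V} {p : ℤ → Bool → ℝ}
    (hp : D.GapsOn (K v) ω univ p)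
    (hin : ∀ s ∈ D.B.S v, ∀ i j,
      (D.E v).a j < D.F v s ((D.E v).b i) → D.F v s ((D.E v).a (i + 1)) < (D.E v).b j →
      (K v).A j < D.F' ω v s ((K v).B i) ∧ D.F' ω v s ((K v).A (i + 1)) < (K v).B j) :
    Perturbed (D.B.pure v) (D.E v) k (D.F v) (D.F' ω v) where
  symm := D.B.S_symm v
  lift s _ := (D.lift v s).isLift D.fold D.one_le
  commute s _ := (D.lift v s).commute D.one_le
  commute' s _ := (D.lift' ω v s).commute D.one_le
  rel := hω v
  -- The left end point of the component `i` is the right end point of the gap `i - 1`.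
  a' i := p (i - 1) true
  b' i := p i false
  a_lt_b i := by
    have h1 := (hp.2 (i - 1) (mem_univ _)).2.2
    have h2 := (hp.2 i (mem_univ _)).1
    have h3 := (K v).A_lt_B i
    rw [sub_add_cancel] at h1
    linarith
  b_lt_a i := by
    rw [add_sub_cancel_right]
    exact (hp.2 i (mem_univ _)).2.1
  equivariant w i j h1 h2 := by
    rw [add_sub_cancel_right, add_sub_cancel_right]
    exact ⟨hp.1 w i (mem_univ _) j (mem_univ _) ⟨h1, h2⟩ false,
      hp.1 w i (mem_univ _) j (mem_univ _) ⟨h1, h2⟩ true⟩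
  inside s hs i j h1 h2 := by
    obtain ⟨h3, h4⟩ := hin s hs i j h1 h2
    rw [add_sub_cancel_right]
    have h5 := (hp.2 (j - 1) (mem_univ _)).2.2
    rw [sub_add_cancel] at h5
    exact ⟨h5.trans (h3.trans ((D.F' ω v s).strictMono (hp.2 i (mem_univ _)).1)),
      (((D.F' ω v s).strictMono (hp.2 i (mem_univ _)).2.2).trans h4).trans
        (hp.2 j (mem_univ _)).1⟩

/-- The comparison of the two actions along the tree. -/
def tracking {ω} (R : ∀ v, Perturbed (D.B.pure v) (D.E v) k (D.F v) (D.F' ω v))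
    (hlink : ∀ v u (h : 𝒯.graph.Adj v u) w, D.η v w ∈ edgeSub h →
      ∃ w', D.η u w' ∈ edgeSub h.symm ∧ D.f v w = D.f u w' ∧ D.f' ω v w = D.f' ω u w')
    (hleft : ∀ v u (h : 𝒯.graph.Adj v u) i m, D.B.Ent D.E h i → D.B.Ent D.E h.symm m →
      (D.E v).a (i + 1) = (D.E u).b m → (R u).b' m = (R v).a' (i + 1))
    (hright : ∀ v u (h : 𝒯.graph.Adj v u) i m, D.B.Ent D.E h i → D.B.Ent D.E h.symm m →
      (D.E v).b i = (D.E u).a (m + 1) → (R v).b' i = (R u).a' (m + 1)) :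
    Tracking 𝒯.V 𝒯.graph where
  a v := (D.E v).a
  b v := (D.E v).b
  a' v := (R v).a'
  b' v := (R v).b'
  Q v := (D.pairs ω v).range
  -- The supremum over proofs of adjacency defines the group for all pairs of vertices; it is
  -- trivial for vertices that are not adjacent.
  M v u := ⨆ h : 𝒯.graph.Adj v u, ((edgeSub h).comap (D.η v)).map (D.pairs ω v)
  Ent v u i := ∃ h : 𝒯.graph.Adj v u, D.B.Ent D.E h i
  gap := by
    rintro v _ ⟨w, rfl⟩ i
    exact (R v).word_gap w i
  start := by
    rintro v _ ⟨w, rfl⟩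
    exact (R v).word_comp w
  entrance := by
    rintro v u u' - - _ ⟨w, rfl⟩ i j ⟨h, hi⟩ ⟨h', hj⟩ hb ha
    obtain ⟨h1, h2⟩ := ent_rel hi hj (w := w) ⟨hb, ha⟩
    refine ⟨h1, ?_⟩
    exact Subgroup.mem_iSup_of_mem h ⟨w, h2, rfl⟩
  link := by
    intro v u h
    refine iSup_le fun h => ?_
    rintro _ ⟨w, hw, rfl⟩
    obtain ⟨w', -, h1, h2⟩ := hlink v u h w hw
    exact ⟨w', Prod.ext h1.symm h2.symm⟩
  comp_sub := by
    intro v u h j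
    have hmono : StrictMono (R v).a' :=
      strictMono_int_of_lt_succ fun i => ((R v).a_lt_b i).trans ((R v).b_lt_a i)
    have hmono' : StrictMono (R v).b' :=
      strictMono_int_of_lt_succ fun i => ((R v).b_lt_a i).trans ((R v).a_lt_b _)
    obtain ⟨m, h1, h2, h3⟩ := D.B.comp_sub D.E h j
    obtain ⟨l, hl, hl'⟩ := D.B.exists_left_gap D.E h h1
    obtain ⟨g, hg, hg'⟩ := D.B.exists_right_gap D.E h h1
    refine ⟨m, ⟨h.symm, h1⟩, h2, h3, ?_, ?_⟩
    -- The shared end points turn the inequality into one between end points at `v`, where the order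
    -- of the numbers decides for both actions.
    · rw [hleft v u h l m hl h1 hl']
      rw [← hl'] at h2
      exact hmono.monotone ((D.E v).a_strictMono.le_iff_le.1 h2)
    · rw [← hright v u h g m hg h1 hg']
      rw [← hg'] at h3
      exact hmono'.monotone ((D.E v).b_strictMono.le_iff_le.1 h3)
  gap_sub := by
    intro v u h j hj
    have hmono : StrictMono (R v).a' :=
      strictMono_int_of_lt_succ fun i => ((R v).a_lt_b i).trans ((R v).b_lt_a i)
    obtain ⟨m, h1, h2, h3⟩ := D.B.gap_sub D.E h (j := j) fun hj' => hj ⟨h, hj'⟩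
    obtain ⟨l, hl, hl'⟩ := D.B.exists_left_gap D.E h h1
    obtain ⟨g, hg, hg'⟩ := D.B.exists_right_gap D.E h h1
    refine ⟨m, ⟨h.symm, h1⟩, h2, h3, ?_, ?_⟩
    · rw [hleft v u h l m hl h1 hl']
      rw [← hl'] at h2
      exact (hmono.monotone ((D.E v).le_of_a_le_b h2)).trans ((R v).a_lt_b j).le
    · rw [← hright v u h g m hg h1 hg']
      rw [← hg'] at h3
      exact (hmono.monotone ((D.E v).le_of_a_le_b h3)).trans
        ((R v).a_lt_b g).le

theorem eventually_dist_bounded : ∀ᶠ ω in D.nbhds, ∃ C, ∀ x ∈ ⨆ v, (D.pairs ω v).range,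
    |x.1 0 - x.2 0| ≤ C := by
  have := 𝒯.finite_V
  let K : ∀ v, D.Marks v := fun v => (D.nonempty_marks v).some
  have hlink : ∀ᶠ ω in D.nbhds, ∀ v u, ∀ h : 𝒯.graph.Adj v u, ∀ w, D.η v w ∈ edgeSub h →
      ∃ w', D.η u w' ∈ edgeSub h.symm ∧ D.f v w = D.f u w' ∧ D.f' ω v w = D.f' ω u w' := by
    refine Filter.eventually_all.2 fun v => Filter.eventually_all.2 fun u => ?_
    by_cases h : 𝒯.graph.Adj v u
    · exact (D.link h).mono fun ω hω _ => hω
    · exact Filter.Eventually.of_forall fun ω h' => (h h').elim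
  filter_upwards [D.eventually_good, hlink, D.exists_gaps K, D.eventually_inside K]
    with ω hω hlink ⟨p, hp, hpq⟩ hin
  let R := fun v => D.perturbed K hω (hp v) (hin v)
  let X := D.tracking R hlink
    (fun v u h i m hi hm he => by
      change p u m false = p v (i + 1 - 1) true
      rw [add_sub_cancel_right]
      exact (hpq v u h i m hi hm).1 he)
    (fun v u h i m hi hm he => by
      change p v i false = p u (m + 1 - 1) true
      rw [add_sub_cancel_right]
      exact (hpq v u h i m hi hm).2 he)
  -- The sum of the four quantities is periodic in `i`, so one constant bounds them all.
  obtain ⟨C, hC⟩ := exists_bound (fun v => (D.E v).N_pos) D.one_le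
    (g := fun v i => |(R v).a' i - (D.E v).a i| + |(R v).b' i - (D.E v).b i| +
      |(D.E v).b i - (D.E v).a i| + |(D.E v).a (i + 1) - (D.E v).b i|) (by
    intro v i m
    simp only [(R v).shift_a', (R v).shift_b', (D.E v).shift_a, (D.E v).shift_b,
      show i + (D.E v).N * (k * m) + 1 = i + 1 + (D.E v).N * (k * m) by ring, shift_zpow]
    simp only [shift, OrderIso.addRight_apply, add_sub_add_right_eq_sub])
  have hk := D.one_le
  have hcomm : ∀ {H : ℝ ≃o ℝ} {g : HomeoPlus}, IsScaledLift k H g → ∀ t, H (t + k) = H t + k := by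
    intro H g hH t
    simpa using hH.add_mul hk t 1
  refine ⟨4 * C + 2 * k, fun x hx => X.dist_bounded 𝒯.isTree.connected (by positivity)
    ?_ ?_ ?_ ?_ ?_ ?_ ?_ hx⟩
  · rintro v _ ⟨w, rfl⟩
    exact ⟨hcomm (D.scaled_f v w), hcomm (D.scaled_f' ω v w)⟩
  · intro v i
    refine le_trans ?_ (hC v i)
    have h2 := abs_nonneg ((R v).b' i - (D.E v).b i)
    have h3 := abs_nonneg ((D.E v).b i - (D.E v).a i)
    have h4 := abs_nonneg ((D.E v).a (i + 1) - (D.E v).b i)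
    change |(R v).a' i - (D.E v).a i| ≤ _
    linarith
  · intro v i
    refine le_trans ?_ (hC v i)
    have h1 := abs_nonneg ((R v).a' i - (D.E v).a i)
    have h3 := abs_nonneg ((D.E v).b i - (D.E v).a i)
    have h4 := abs_nonneg ((D.E v).a (i + 1) - (D.E v).b i)
    change |(R v).b' i - (D.E v).b i| ≤ _
    linarith
  · intro v i
    change (D.E v).b i ≤ (D.E v).a i + C
    have h0 := hC v i
    have h1 := abs_nonneg ((R v).a' i - (D.E v).a i)
    have h2 := abs_nonneg ((R v).b' i - (D.E v).b i)
    have h3 := le_abs_self ((D.E v).b i - (D.E v).a i)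
    have h4 := abs_nonneg ((D.E v).a (i + 1) - (D.E v).b i)
    linarith
  · intro v i
    change (D.E v).a (i + 1) ≤ (D.E v).b i + C
    have h0 := hC v i
    have h1 := abs_nonneg ((R v).a' i - (D.E v).a i)
    have h2 := abs_nonneg ((R v).b' i - (D.E v).b i)
    have h3 := abs_nonneg ((D.E v).b i - (D.E v).a i)
    have h4 := le_abs_self ((D.E v).a (i + 1) - (D.E v).b i)
    linarith
  · exact fun v i => ((D.E v).a_lt_b i).le
  · exact fun v i => ((R v).a_lt_b i).le

end Setup

end

section

/-! ### From bounded distance to semiconjugacy -/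

/-- Rescaling of a group of homeomorphisms of the line commuting with the translation by `c` to
lifts of circle maps. -/
def unscale {G : Type*} [Group G] {c : ℝ} (hc : 0 < c) (H : G →* (ℝ ≃o ℝ))
    (hH : ∀ g t, H g (t + c) = H g t + c) : G →* CircleDeg1Lift where
  toFun g :=
    { toFun := fun t => H g (c * t) / c
      monotone' := fun s t hst => by
        have := (H g).monotone (mul_le_mul_of_nonneg_left hst hc.le)
        exact div_le_div_of_nonneg_right this hc.le
      map_add_one' := fun t => by
        rw [mul_add, mul_one, hH]; field_simp }
  map_one' := by
    ext t
    change (H 1) (c * t) / c = t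
    rw [map_one]
    change c * t / c = t
    field_simp
  map_mul' g g' := by
    ext t
    change H (g * g') (c * t) / c = H g (c * (H g' (c * t) / c)) / c
    rw [H.map_mul, RelIso.mul_apply, mul_div_cancel₀ _ hc.ne']

theorem unscale_apply {G : Type*} [Group G] {c : ℝ} (hc : 0 < c) (H : G →* (ℝ ≃o ℝ))
    (hH : ∀ g t, H g (t + c) = H g t + c) (g : G) (t : ℝ) :
    unscale hc H hH g t = H g (c * t) / c := rfl

/-- The hypothesis, applied to the powers of `g`, makes the translation numbers of the two lifts of
`g` equal; Ghys's theorem on lifted actions with equal translation numbers does the rest. -/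
theorem exists_semiconj_of_dist_bounded {G : Type*} [Group G] {c : ℝ} (hc : 0 < c)
    (H H' : G →* (ℝ ≃o ℝ)) (hH : ∀ g t, H g (t + c) = H g t + c)
    (hH' : ∀ g t, H' g (t + c) = H' g t + c) {C : ℝ} (hC : ∀ g, |H g 0 - H' g 0| ≤ C) :
    ∃ A : CircleDeg1Lift, ∀ g t,
      A (unscale hc H' hH' g t) = unscale hc H hH g (A t) := by
  refine CircleDeg1Lift.semiconj_of_group_action_of_forall_translationNumber_eq _ _ fun g => ?_
  refine CircleDeg1Lift.translationNumber_eq_of_dist_bounded (C / c) fun n => ?_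
  rw [← map_pow, ← map_pow, unscale_apply, unscale_apply, mul_zero, Real.dist_eq, ← sub_div,
    abs_div, abs_of_pos hc, abs_sub_comm]
  exact div_le_div_of_nonneg_right (hC _) hc.le

theorem exists_circleMap (A : CircleDeg1Lift) :
    ∃ h : Circ → Circ, ∀ t : ℝ, h (t : Circ) = ((A t : ℝ) : Circ) := by
  refine ⟨fun x => ((A (Quotient.out x) : ℝ) : Circ), fun t => ?_⟩
  obtain ⟨n, hn⟩ := coe_eq_coe_iff.1 (QuotientAddGroup.out_eq' (t : Circ)).symm
  change ((A (Quotient.out (t : Circ)) : ℝ) : Circ) = _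
  rw [hn, A.map_add_int, coe_add_int]

namespace TreeOfGroups

variable {𝒯 : TreeOfGroups}

/-- The edge groups also occur as free factors, but the relators identify their elements with
elements of vertex groups. -/
theorem eq_top_of_vertexMap {H : Subgroup 𝒯.FundamentalGroup} (hH : ∀ v γ, 𝒯.vertexMap v γ ∈ H) :
    H = ⊤ := by
  refine (Subgroup.eq_top_iff' _).2 fun x => ?_
  obtain ⟨x, rfl⟩ := QuotientGroup.mk'_surjective _ x
  induction x using Monoid.Coprod.induction_on with
  | inl x =>
    induction x using Monoid.CoprodI.induction_on with
    | one => rw [map_one, map_one]; exact one_mem _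
    | of v γ => exact hH v γ
    | mul x y hx hy => rw [map_mul, map_mul]; exact mul_mem hx hy
  | inr x =>
    induction x using Monoid.CoprodI.induction_on with
    | one => rw [map_one, map_one]; exact one_mem _
    | of e z =>
      obtain ⟨v, hv⟩ : ∃ v, v ∈ (e : Sym2 𝒯.V) := ⟨_, Sym2.out_fst_mem _⟩
      rw [← vertexMap_ι e v hv]
      exact hH _ _
    | mul x y hx hy => rw [map_mul, map_mul]; exact mul_mem hx hy
  | mul x y hx hy => rw [map_mul]; exact mul_mem hx hy

end TreeOfGroups

/-- The elements intertwined by a map under two actions form a subgroup. -/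
def intertwined {G : Type*} [Group G] (φ₁ φ₂ : G →* HomeoPlus) (h : Circ → Circ) : Subgroup G where
  carrier := {g | ∀ x, φ₂ g (h x) = h (φ₁ g x)}
  one_mem' := fun x => by rw [map_one, map_one]; rfl
  mul_mem' := by
    intro g g' hg hg' x
    rw [map_mul, map_mul]
    change φ₂ g (φ₂ g' (h x)) = h (φ₁ g (φ₁ g' x))
    rw [hg', hg]
  inv_mem' := by
    intro g hg x
    rw [map_inv, map_inv]
    change (φ₂ g : Circ ≃ₜ Circ).symm (h x) = h ((φ₁ g : Circ ≃ₜ Circ).symm x)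
    rw [Homeomorph.symm_apply_eq]
    have := hg ((φ₁ g : Circ ≃ₜ Circ).symm x)
    change (φ₂ g : Circ ≃ₜ Circ) _ = h ((φ₁ g : Circ ≃ₜ Circ) ((φ₁ g : Circ ≃ₜ Circ).symm x)) at this
    rw [Homeomorph.apply_symm_apply] at this
    exact this.symm

/-! ### Local stability of the lift -/

namespace Setup

open TreeOfGroups

variable {𝒯 : TreeOfGroups} {φ ψ : 𝒯.FundamentalGroup →* HomeoPlus} {k : ℕ} (D : Setup 𝒯 φ ψ k)

include D

/-- The covering sends a global fixed point of `ψ` to one of `φ`, but a vertex group already has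
none. -/
theorem not_hasGlobalFixedPoint : ¬ HasGlobalFixedPoint ψ := by
  rintro ⟨x, hx⟩
  obtain ⟨v⟩ := 𝒯.isTree.connected.nonempty
  refine BasicPartition.not_hasGlobalFixedPoint (D.B.pure v) (D.E v) (D.B.S_symm v)
    ⟨k • x, fun γ => ?_⟩
  change φ (𝒯.vertexMap v γ) (k • x) = k • x
  rw [D.fold, hx]

/-- The free group on all generators acts on the line by the chosen lifts, without any relation to
be checked. The intertwining relation is needed only for the generators, since the intertwined
elements form a subgroup. -/
theorem semiconjugate_of_bounded {ω} {C : ℝ}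
    (hC : ∀ x ∈ ⨆ v, (D.pairs ω v).range, |x.1 0 - x.2 0| ≤ C) : Semiconjugate ω ψ := by
  let H : FreeGroup (Σ v, D.B.S v) →* (ℝ ≃o ℝ) := FreeGroup.lift fun x => D.F x.1 x.2
  let H' : FreeGroup (Σ v, D.B.S v) →* (ℝ ≃o ℝ) := FreeGroup.lift fun x => D.F' ω x.1 x.2
  have hk := D.one_le
  have hc : (0 : ℝ) < k := by positivity
  have hmem : ∀ g, H.prod H' g ∈ ⨆ v, (D.pairs ω v).range := by
    intro g
    induction g using FreeGroup.induction_on with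
    | C1 => rw [map_one]; exact one_mem _
    | of x =>
      refine Subgroup.mem_iSup_of_mem x.1 ⟨FreeGroup.of (some x.2), ?_⟩
      refine Prod.ext ?_ ?_
      · change D.f x.1 _ = FreeGroup.lift _ (FreeGroup.of x)
        rw [f, letterMap_some, FreeGroup.lift_apply_of]
      · change D.f' ω x.1 _ = FreeGroup.lift _ (FreeGroup.of x)
        rw [f', letterMap_some, FreeGroup.lift_apply_of]
    | inv_of x hx => rw [map_inv]; exact inv_mem hx
    | mul x y hx hy => rw [map_mul]; exact mul_mem hx hy
  have hscaled : ∀ g, (∃ f, IsScaledLift k (H g) f) ∧ ∃ f, IsScaledLift k (H' g) f := by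
    intro g
    induction g using FreeGroup.induction_on with
    | C1 => rw [map_one, map_one]; exact ⟨⟨1, .one⟩, ⟨1, .one⟩⟩
    | of x =>
      simp only [H, H', FreeGroup.lift_apply_of]
      exact ⟨⟨_, D.lift _ _⟩, ⟨_, D.lift' _ _ _⟩⟩
    | inv_of x hx =>
      rw [map_inv, map_inv]
      exact ⟨⟨_, hx.1.choose_spec.inv⟩, ⟨_, hx.2.choose_spec.inv⟩⟩
    | mul x y hx hy =>
      rw [map_mul, map_mul]
      exact ⟨⟨_, hx.1.choose_spec.mul hy.1.choose_spec⟩, ⟨_, hx.2.choose_spec.mul hy.2.choose_spec⟩⟩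
  have hcomm : ∀ {K : ℝ ≃o ℝ}, (∃ f, IsScaledLift k K f) → ∀ t, K (t + k) = K t + k := by
    rintro K ⟨f, hf⟩ t
    simpa using hf.add_mul hk t 1
  obtain ⟨A, hA⟩ := exists_semiconj_of_dist_bounded hc H H' (fun g => hcomm (hscaled g).1)
    (fun g => hcomm (hscaled g).2) (C := C) fun g => hC _ (hmem g)
  obtain ⟨h, hh⟩ := exists_circleMap A
  have htop : intertwined ω ψ h = ⊤ := by
    refine eq_top_of_vertexMap fun v γ => ?_
    have hle : Subgroup.closure (D.B.S v) ≤ (intertwined ω ψ h).comap (𝒯.vertexMap v) := by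
      refine (Subgroup.closure_le _).2 fun s hs => ?_
      intro x
      obtain ⟨t, rfl⟩ := coe_surj x
      obtain ⟨F₀, h1, h2⟩ := D.lift v s
      obtain ⟨F₁, h3, h4⟩ := D.lift' ω v s
      have key := hA (FreeGroup.of ⟨v, s, hs⟩) t
      rw [unscale_apply, unscale_apply] at key
      simp only [H, H', FreeGroup.lift_apply_of] at key
      rw [h2, h4, mul_div_cancel_left₀ _ hc.ne', mul_div_cancel_left₀ _ hc.ne'] at key
      rw [hh, h1, h3, hh, key]
    rw [D.B.S_generates v] at hle
    exact hle (Subgroup.mem_top γ)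
  have hint : ∀ g x, ψ g (h x) = h (ω g x) := fun g => by
    have : g ∈ intertwined ω ψ h := htop ▸ Subgroup.mem_top g
    exact this
  refine Or.inr ⟨?_, D.not_hasGlobalFixedPoint, h, ⟨A, hh⟩, hint⟩
  -- The intertwining map sends a global fixed point of `ω` to one of `ψ`.
  rintro ⟨x, hx⟩
  exact D.not_hasGlobalFixedPoint ⟨h x, fun g => by rw [hint, hx]⟩

theorem locallyStable : LocallyStable ψ := by
  have hev : ∀ᶠ ω in D.nbhds, Semiconjugate ω ψ :=
    D.eventually_dist_bounded.mono fun ω ⟨_, hC⟩ => D.semiconjugate_of_bounded hC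
  obtain ⟨U, h1, h2, h3⟩ := (@mem_nhds_iff _ (weakTopology _) ψ _).1 hev
  exact ⟨U, h2, h3, fun ω hω => h1 hω⟩

end Setup

end

end BasicPartition

end

theorem mainTheorem10 (𝒯 : BasicPartition.TreeOfGroups)
    (φ ψ : 𝒯.FundamentalGroup →* BasicPartition.HomeoPlus)
    (hφ : ∃ B : BasicPartition.BasicConfiguration 𝒯 φ, B.IsRobust)
    (k : ℕ) (hk : 1 ≤ k) (hψ : BasicPartition.IsFoldLift k ψ φ) :
    BasicPartition.LocallyStable ψ := by
  obtain ⟨B, hB⟩ := hφ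
  obtain ⟨D⟩ := BasicPartition.exists_setup B hB hk hψ
  exact D.locallyStable
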